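/- Let $n$ be a natural number, let $\Lambda=\{(i,\alpha)\in\mathbb N\times\mathbb N^n : i+|\alpha|\le 2,\ i<2\}$ and $N=\#\Lambda$. Let $F(t,x,z)$, with $z=\{z_{i,\alpha}\}_{(i,\alpha)\in\Lambda}$, be a function on an open neighbourhood $\Delta$ of the origin of $\mathbb C_t\times\mathbb C_x^n\times\mathbb C_z^N$ such that (A$_1$) $F$ is holomorphic in $\Delta$; (A$_2$) $F(0,x,0)=0$ whenever $(0,x,0)\in\Delta$; (A$_3$) $(\partial F/\partial z_{i,\alpha})(0,x,0)=0$ whenever $(0,x,0)\in\Delta$ and $|\alpha|>0$. Consider the equation $$\Bigl(t\frac{\partial}{\partial t}\Bigr)^2u=F\Bigl(t,x,\Bigl\{\Bigl(t\frac{\partial}{\partial t}\Bigr)^i\Bigl(\frac{\partial}{\partial x}\Bigr)^\alpha u\Bigr\}_{(i,\alpha)\in\Lambda}\Bigr),\qquad(*)$$ and let $\lambda_1(x),\lambda_2(x)$ be the roots of $\lambda^2-\frac{\partial F}{\partial z_{1,0}}(0,x,0)\lambda-\frac{\partial F}{\partial z_{0,0}}(0,x,0)=0$. Suppose that $\operatorname{Re}\lambda_i(0)<0$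 for $i=1,2$. For an open interval $I=(\theta_1,\theta_2)$ and $r>0$ let $S_I(r)$ be the set of the points $t$ of the universal covering space of $\mathbb C\setminus\{0\}$ with $\theta_1<\arg t<\theta_2$ and $0<|t|<r$, and for $R>0$ let $D_R=\{x\in\mathbb C^n:\max_j|x_j|<R\}$. Let $u(t,x)$ be a holomorphic solution of $(*)$ on $S_I(r_0)\times D_{R_0}$ for some nonempty open interval $I$ and some $r_0>0$, $R_0>0$ (in particular the arguments of $F$ in $(*)$ stay in $\Delta$). If $$\limsup_{R\to+0}\Bigl[\lim_{r\to+0}\Bigl(\frac1{R^4}\sup_{S_I(r)\times D_R}|u(t,x)|\Bigr)\Bigr]=0,$$ then $u(t,x)=u_0(t,x)$ on $S_I(\sigma)\times D_\delta$ for some $0<\sigma\le r_0$ and $0<\delta\le R_0$, where $u_0(t,x)$ is the holomorphic solution of $(*)$ in a neighbourhood of $(0,0)\in\mathbb C_t\times\mathbb C_x^n$ with $u_0(0,x)\equiv0$, which exists and is unique as a germ at $(0,0)$. -/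

import Mathlib

open Filter Topology
open scoped ENNReal

namespace Fuchs

/-- The index set of the pairs `(i, α) ∈ ℕ × ℕⁿ` with `i + |α| ≤ 2` and `i < 2`. -/
abbrev Lam (n : ℕ) : Type :=
  {p : ℕ × (Fin n → ℕ) // p.1 + ∑ j, p.2 j ≤ 2 ∧ p.1 < 2}

instance instFiniteLam (n : ℕ) : Finite (Lam n) := by
  have h : ({p : ℕ × (Fin n → ℕ) | p.1 + ∑ j, p.2 j ≤ 2 ∧ p.1 < 2}).Finite := by
    refine ((Set.finite_Iic 2).prod
      (Set.Finite.pi' (fun _ : Fin n => Set.finite_Iic 2))).subset ?_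
    rintro ⟨i, α⟩ ⟨h1, h2⟩
    refine ⟨h2.le, fun j => ?_⟩
    have := Finset.single_le_sum (f := α) (fun k _ => Nat.zero_le _) (Finset.mem_univ j)
    simp only [Set.mem_Iic] at h1 ⊢
    omega
  exact h.to_subtype

noncomputable instance instFintypeLam (n : ℕ) : Fintype (Lam n) := Fintype.ofFinite _

/-- The index `(0, 0)`, i.e. the variable `z_{0,0}`, which stands for `u`. -/
def idx00 (n : ℕ) : Lam n := ⟨(0, 0), by simp⟩

/-- The index `(1, 0)`, i.e. the variable `z_{1,0}`, which stands for `t ∂u/∂t`. -/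
def idx10 (n : ℕ) : Lam n := ⟨(1, 0), by simp⟩

/-- The space `ℂ_t × ℂ_xⁿ × ℂ_z^N` with `z = (z_{i,α})_{(i,α) ∈ Lam n}`. -/
abbrev JetSpace (n : ℕ) : Type := ℂ × (Fin n → ℂ) × (Lam n → ℂ)

/-- The partial derivative `∂F/∂z_{i,α}`, where `q = (i, α)`. -/
noncomputable def dz {n : ℕ} (q : Lam n) (F : JetSpace n → ℂ) (p : JetSpace n) : ℂ :=
  deriv (fun ζ : ℂ => F (p.1, p.2.1, Function.update p.2.2 q ζ)) (p.2.2 q)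

/-- `lam` is a characteristic exponent at `x`: a root of
`λ² - (∂F/∂z_{1,0})(0,x,0) λ - (∂F/∂z_{0,0})(0,x,0) = 0`. -/
def IsCharExponent {n : ℕ} (F : JetSpace n → ℂ) (x : Fin n → ℂ) (lam : ℂ) : Prop :=
  lam ^ 2 - (dz (idx10 n) F (0, x, 0) * lam + dz (idx00 n) F (0, x, 0)) = 0

/-- The partial derivative `∂/∂x_j` of a function of `(t, x)` (or of `(s, x)`). -/
noncomputable def dxj {n : ℕ} (j : Fin n) (u : ℂ × (Fin n → ℂ) → ℂ) :
    ℂ × (Fin n → ℂ) → ℂ :=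
  fun p => deriv (fun ζ : ℂ => u (p.1, Function.update p.2 j ζ)) (p.2 j)

/-- `(∂/∂x)^α = (∂/∂x_1)^{α_1} ⋯ (∂/∂x_n)^{α_n}`. -/
noncomputable def dx {n : ℕ} (α : Fin n → ℕ) (u : ℂ × (Fin n → ℂ) → ℂ) :
    ℂ × (Fin n → ℂ) → ℂ :=
  (List.finRange n).foldr (fun j g => (dxj j)^[α j] g) u

/-- The operator `t ∂/∂t` on functions of `(t, x) ∈ ℂ × ℂⁿ`. -/
noncomputable def euler {n : ℕ} (u : ℂ × (Fin n → ℂ) → ℂ) : ℂ × (Fin n → ℂ) → ℂ :=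
  fun p => p.1 * deriv (fun t : ℂ => u (t, p.2)) p.1

/-- The operator `t ∂/∂t` on functions on `R(ℂ ∖ {0}) × ℂⁿ`, where `R(ℂ ∖ {0})` is the universal
covering space of `ℂ ∖ {0}`. The covering is realised as `exp : ℂ → ℂ ∖ {0}`: the point `s`
lies over `t = exp s` and has `arg t = Im s`, `|t| = exp (Re s)`. In the coordinate `s` the
operator `t ∂/∂t` is `∂/∂s`; see `eulerCover_comp_exp`. -/
noncomputable def eulerCover {n : ℕ} (u : ℂ × (Fin n → ℂ) → ℂ) : ℂ × (Fin n → ℂ) → ℂ :=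
  fun p => deriv (fun s : ℂ => u (s, p.2)) p.1

/-- `eulerCover` corresponds to `t ∂/∂t` under the covering map `t = exp s`. -/
theorem eulerCover_comp_exp {n : ℕ} (u : ℂ × (Fin n → ℂ) → ℂ) (s : ℂ) (x : Fin n → ℂ)
    (h : DifferentiableAt ℂ (fun t : ℂ => u (t, x)) (Complex.exp s)) :
    eulerCover (fun p : ℂ × (Fin n → ℂ) => u (Complex.exp p.1, p.2)) (s, x) =
      euler u (Complex.exp s, x) := by
  have := h.hasDerivAt.comp s (Complex.hasDerivAt_exp s)
  simp only [eulerCover, euler]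
  rw [mul_comm]
  exact this.deriv

/-- The family `{θ^i (∂/∂x)^α u}_{(i,α)}` at a point, where `θ` is the operator `t ∂/∂t`
(`euler` or `eulerCover`). -/
noncomputable def jet {n : ℕ} (θ : (ℂ × (Fin n → ℂ) → ℂ) → (ℂ × (Fin n → ℂ) → ℂ))
    (u : ℂ × (Fin n → ℂ) → ℂ) (p : ℂ × (Fin n → ℂ)) : Lam n → ℂ :=
  fun q => (θ^[q.1.1] (dx q.1.2 u)) p

/-- The sector `S_I(r)`, `I = (θ₁, θ₂)`, in the universal covering space of `ℂ ∖ {0}`: the points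
`s` (over `t = exp s`) with `θ₁ < arg t < θ₂` and `0 < |t| < r`. -/
def sector (θ₁ θ₂ r : ℝ) : Set ℂ :=
  {s | θ₁ < s.im ∧ s.im < θ₂ ∧ ‖Complex.exp s‖ < r}

/-- `D_R = {x ∈ ℂⁿ : max_j |x_j| < R}` (the norm of `Fin n → ℂ` is the maximum norm). -/
def polydisc (n : ℕ) (R : ℝ) : Set (Fin n → ℂ) := Metric.ball 0 R

/-- `u` is a holomorphic solution on `S_I(r₀) × D_{R₀}` of
`(t ∂/∂t)² u = F(t, x, {(t ∂/∂t)^i (∂/∂x)^α u})`, where `F` is a function on `Δ`. -/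
def IsSectorialSolution {n : ℕ} (Δ : Set (JetSpace n)) (F : JetSpace n → ℂ)
    (θ₁ θ₂ r₀ R₀ : ℝ) (u : ℂ × (Fin n → ℂ) → ℂ) : Prop :=
  AnalyticOnNhd ℂ u (sector θ₁ θ₂ r₀ ×ˢ polydisc n R₀) ∧
  ∀ p ∈ sector θ₁ θ₂ r₀ ×ˢ polydisc n R₀,
    (Complex.exp p.1, p.2, jet eulerCover u p) ∈ Δ ∧
    (eulerCover^[2] u) p = F (Complex.exp p.1, p.2, jet eulerCover u p)

/-- `u₀` is a holomorphic solution of the same equation in a neighbourhood of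
`(0, 0) ∈ ℂ_t × ℂ_xⁿ`, with `u₀(0, x) ≡ 0`. -/
def IsRegularSolution {n : ℕ} (Δ : Set (JetSpace n)) (F : JetSpace n → ℂ)
    (u₀ : ℂ × (Fin n → ℂ) → ℂ) : Prop :=
  ∃ W : Set (ℂ × (Fin n → ℂ)), IsOpen W ∧ (0, 0) ∈ W ∧
    AnalyticOnNhd ℂ u₀ W ∧
    (∀ p ∈ W, (p.1, p.2, jet euler u₀ p) ∈ Δ ∧
      (euler^[2] u₀) p = F (p.1, p.2, jet euler u₀ p)) ∧
    ∀ x, (0, x) ∈ W → u₀ (0, x) = 0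

/-- `limsup_{R → +0} [ lim_{r → +0} ( R⁻⁴ sup_{S_I(r) × D_R} |u| ) ] = 0`, with suprema and limits
taken in `[0, ∞]`. (The inner limit exists for every `R > 0`, since the supremum is monotone
in `r`; `ℓ R` is this limit.) -/
def LimsupCondition {n : ℕ} (θ₁ θ₂ : ℝ) (u : ℂ × (Fin n → ℂ) → ℂ) : Prop :=
  ∃ ℓ : ℝ → ℝ≥0∞,
    (∀ᶠ R in 𝓝[>] (0 : ℝ),
      Tendsto (fun r : ℝ => ENNReal.ofReal (1 / R ^ 4) *
        ⨆ p ∈ sector θ₁ θ₂ r ×ˢ polydisc n R, ‖u p‖ₑ) (𝓝[>] 0) (𝓝 (ℓ R))) ∧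
    limsup ℓ (𝓝[>] (0 : ℝ)) = 0

end Fuchs

/-! Uniqueness. Write t = e^{ξ+iφ} with φ the midpoint of I, and let w = u - v, where v is the lift
of a regular solution. Along this ray w'' = c₁(x)w' + c₀(x)w + g. By (A₃) no x-derivative enters the
linear part, so |g| ≤ C(|t| + |jet u| + |jet v|)|jet w| (`exists_lipschitz_estimate`). The exponents
have negative real part, so the homogeneous solutions blow up as t → 0 and a bounded w is controlled
by g alone: |g| ≤ M e^{qξ} yields |w| ≲ M e^{qξ}/(q+1)² and |w'| ≲ M e^{qξ}/(q+1)
(`norm_le_of_hasDerivAt_second_order`). The jet of w costs at most two x-derivatives, that is a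
factor δ⁻² when the polydisc shrinks by 2δ.

These two facts are iterated in three regimes. Since u = o(R⁴), the jet of u is o(R²) on D_R, which
beats δ⁻² ~ R⁻²: halving R multiplies the bound on w by any prescribed ε (`bound_half`). Near x = 0
the bound on w is thus smaller than any power of the radius as t → 0, and Taylor expansion in x
makes w small on a fixed polydisc (`exists_small`). Once w is small, the nonlinear factor is small
too, and an iteration over geometrically shrinking polydiscs gives w = O(|t|)
(`exists_linear_bound`). From then on every step gains a factor |t|; with P steps and δ ~ 1/P the
losses P^{2P} are compensated up to e^{2P} by the denominators (P!)², so |w| ≤ A|t|(const·|t|)^P for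
all P and w = 0 for small t (`eq_zero`). The identity theorem extends this to the sector. Applied to
two regular solutions, the same argument gives uniqueness of the germ.

Existence. Put u₀ = tU(x) + t²f. The terms of order t determine U, because 1 is not a characteristic
exponent at 0; what remains is an equation for f whose nonlinear part contains the derivatives of f
only in the form t(∂/∂x)^α(t∂/∂t + 2)^i f (`exists_remainder`). Inverting the characteristic
polynomial on the coefficients of t^k gains (k+2)⁻². In the Banach algebra of power series with
weights T^k ρ^b / binom(2k+b, b), the factor t absorbs up to two x-derivatives at the price of
powers of k, and i + |α| ≤ 2 makes the balance exact (`exists_mul_t_operator`,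
`ascFactorial_mul_norm_charFactor_le`). The contraction principle then gives f
(`exists_coefficients`). -/

namespace Fuchs

/-! ### Expansion of analytic functions over words in the variables -/

section Words

variable {ι : Type*} [Fintype ι]

/-- Expanding the multilinear terms on the basis vectors gives one coefficient per tuple, so words
index the monomials without any symmetrisation. Such sums can be evaluated in a commutative Banach
algebra, which is how the nonlinearity acts on power series in the existence proof. -/
theorem analyticAt_exists_words {f : (ι → ℂ) → ℂ} (hf : AnalyticAt ℂ f 0) :
    ∃ (c : List ι → ℂ) (r : ℝ), 0 < r ∧ Summable (fun w => ‖c w‖ * r ^ w.length) ∧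
      ∀ y : ι → ℂ, ‖y‖ < r → HasSum (fun w => c w * (w.map y).prod) (f y) := by
  classical
  obtain ⟨p, R, hp⟩ := hf
  obtain ⟨s, hs0, hsR⟩ := ENNReal.lt_iff_exists_nnreal_btwn.1 hp.r_pos
  have hs0' : 0 < s := by exact_mod_cast hs0
  have hsum := p.summable_norm_mul_pow (hsR.trans_le hp.r_le)
  -- There are (card ι)^m words of length m, hence the division of the radius by N; the 1 keeps N
  -- positive when ι is empty.
  set N : ℝ := Fintype.card ι + 1
  have hN : 0 < N := by positivity
  set r : ℝ := s / N
  have hr : 0 < r := by positivity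
  let c : List ι → ℂ := fun w => p w.length (fun j => Pi.single (w.get j) 1)
  have hc : ∀ w, ‖c w‖ ≤ ‖p w.length‖ := fun w => by
    refine ((p w.length).le_opNorm _).trans ?_
    simp [Pi.norm_single]
  have key : Summable (fun w => ‖c w‖ * r ^ w.length) := by
    rw [← (List.equivSigmaTuple (α := ι)).symm.summable_iff,
      summable_sigma_of_nonneg (fun _ => by simp only [Function.comp]; positivity)]
    refine ⟨fun n => Summable.of_finite, ?_⟩
    refine hsum.of_nonneg_of_le (fun n => tsum_nonneg fun _ => by simp only [Function.comp]; positivity) fun n => ?_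
    rw [tsum_fintype]
    calc _ ≤ ∑ _i : Fin n → ι, ‖p n‖ * r ^ n := by
          refine Finset.sum_le_sum fun i _ => ?_
          have h1 : ‖p (List.ofFn i).length‖ = ‖p n‖ := congrArg (fun k => ‖p k‖) List.length_ofFn
          change ‖c (List.ofFn i)‖ * r ^ (List.ofFn i).length ≤ _
          rw [List.length_ofFn]
          exact mul_le_mul_of_nonneg_right ((hc _).trans h1.le) (by positivity)
      _ = ‖p n‖ * ((Fintype.card ι : ℝ) ^ n * r ^ n) := by simp; ring
      _ ≤ ‖p n‖ * (s : ℝ) ^ n := by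
          rw [← mul_pow]
          gcongr
          simp only [r]
          rw [mul_div_assoc', div_le_iff₀ hN, mul_comm]
          gcongr
          simp [N]
  refine ⟨c, r, hr, key, fun y hy => ?_⟩
  have hyR : y ∈ Metric.eball (0 : ι → ℂ) R := by
    rw [mem_eball_zero_iff]
    refine lt_of_lt_of_le ?_ hsR.le
    rw [← ofReal_norm, ← ENNReal.ofReal_coe_nnreal]
    apply ENNReal.ofReal_lt_ofReal_iff_of_nonneg (norm_nonneg _) |>.2
    refine hy.trans_le (div_le_self s.2 ?_)
    simp [N]
  have h1 := hp.hasSum hyR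
  rw [zero_add] at h1
  have hprod : ∀ w : List ι, ‖(w.map y).prod‖ ≤ r ^ w.length := fun w => by
    induction w with
    | nil => simp
    | cons a w ih =>
      simp only [List.map_cons, List.prod_cons, norm_mul, List.length_cons, pow_succ']
      exact mul_le_mul ((norm_le_pi_norm y a).trans hy.le) ih (norm_nonneg _) hr.le
  have hS : Summable (fun w => c w * (w.map y).prod) :=
    Summable.of_norm_bounded key fun w => by
      rw [norm_mul]; gcongr; exact hprod w
  rw [← (List.equivSigmaTuple (α := ι)).symm.hasSum_iff]
  refine HasSum.sigma_of_hasSum h1 (fun n => ?_)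
    ((List.equivSigmaTuple (α := ι)).symm.summable_iff.2 hS)
  have h2 : (p n fun _ => y) = ∑ i : Fin n → ι, c (List.ofFn i) * ((List.ofFn i).map y).prod := by
    have hy' : y = ∑ i, y i • (Pi.single i (1 : ℂ) : ι → ℂ) := by
      ext j; simp [Pi.single_apply]
    conv_lhs => rw [hy']
    rw [(p n).map_sum]
    refine Finset.sum_congr rfl fun i _ => ?_
    rw [(p n).map_smul_univ, smul_eq_mul, mul_comm, List.map_ofFn, List.prod_ofFn]
    congr 1
    -- The length of `List.ofFn i` is n only propositionally; with a variable length the transport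
    -- is `rfl`.
    have aux : ∀ (m : ℕ) (w : List ι) (h : w.length = m),
        c w = p m fun j => Pi.single (w.get (j.cast h.symm)) 1 := by
      rintro m w rfl; rfl
    rw [aux n _ (List.length_ofFn)]
    simp
  rw [h2]
  exact hasSum_fintype _

omit [Fintype ι] in
theorem norm_map_prod_le {A : Type*} [NormedCommRing A] [NormOneClass A] (y : ι → A) {r : ℝ} (hr : 0 ≤ r)
    (hy : ∀ i, ‖y i‖ ≤ r) (w : List ι) : ‖(w.map y).prod‖ ≤ r ^ w.length := by
  induction w with
  | nil => simp
  | cons a w ih =>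
    simp only [List.map_cons, List.prod_cons, List.length_cons, pow_succ']
    exact (norm_mul_le _ _).trans (mul_le_mul (hy a) ih (norm_nonneg _) hr)

theorem analyticOnNhd_of_words {c : List ι → ℂ} {r : ℝ} (hr : 0 < r)
    (hc : Summable (fun w => ‖c w‖ * r ^ w.length)) :
    AnalyticOnNhd ℂ (fun y : ι → ℂ => ∑' w, c w * (w.map y).prod) (Metric.ball 0 r) := by
  classical
  let p : FormalMultilinearSeries ℂ (ι → ℂ) ℂ := fun n => ∑ i : Fin n → ι,
    c (List.ofFn i) • (ContinuousMultilinearMap.mkPiAlgebra ℂ (Fin n) ℂ).compContinuousLinearMap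
      (fun j => ContinuousLinearMap.proj (R := ℂ) (φ := fun _ : ι => ℂ) (i j))
  have hpn : ∀ n, ‖p n‖ ≤ ∑ i : Fin n → ι, ‖c (List.ofFn i)‖ := fun n => by
    refine (norm_sum_le _ _).trans (Finset.sum_le_sum fun i _ => ?_)
    rw [norm_smul]
    refine mul_le_of_le_one_right (norm_nonneg _) ?_
    refine ContinuousMultilinearMap.opNorm_le_bound zero_le_one fun m => ?_
    simp only [ContinuousMultilinearMap.compContinuousLinearMap_apply,
      ContinuousMultilinearMap.mkPiAlgebra_apply, ContinuousLinearMap.proj_apply, norm_prod, one_mul]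
    exact Finset.prod_le_prod (fun _ _ => norm_nonneg _) fun j _ => norm_le_pi_norm _ _
  have hc' := (List.equivSigmaTuple (α := ι)).symm.summable_iff.2 hc
  have hc2 := ((summable_sigma_of_nonneg (fun _ => by
    simp only [Function.comp]; positivity)).1 hc').2
  have hrad : ENNReal.ofReal r ≤ p.radius := by
    refine p.le_radius_of_summable (r := r.toNNReal) ?_
    refine hc2.of_nonneg_of_le (fun n => by positivity) fun n => ?_
    rw [tsum_fintype, Real.coe_toNNReal _ hr.le]
    refine (mul_le_mul_of_nonneg_right (hpn n) (by positivity)).trans ?_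
    rw [Finset.sum_mul]
    simp [List.equivSigmaTuple]
  have hball : HasFPowerSeriesOnBall (fun y : ι → ℂ => ∑' w, c w * (w.map y).prod) p 0
      (ENNReal.ofReal r) := by
    refine ⟨hrad, by simpa using hr, fun {y} hy => ?_⟩
    rw [zero_add]
    have hy' : ‖y‖ < r := by
      rw [mem_eball_zero_iff, ← ofReal_norm] at hy
      exact (ENNReal.ofReal_lt_ofReal_iff hr).1 hy
    have hS : Summable (fun w => c w * (w.map y).prod) :=
      Summable.of_norm_bounded hc fun w => by
        rw [norm_mul]; gcongr
        exact norm_map_prod_le y hr.le (fun i => (norm_le_pi_norm y i).trans hy'.le) w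
    have h2 := ((List.equivSigmaTuple (α := ι)).symm.hasSum_iff.2 hS.hasSum).sigma
      (fun n => hasSum_fintype _)
    have e : (fun n => p n fun _ => y) =
        fun n => ∑ i : Fin n → ι, c (List.ofFn i) * ((List.ofFn i).map y).prod := by
      funext n
      have h3 : (p n fun _ => y) = ∑ i : Fin n → ι,
          (c (List.ofFn i) • (ContinuousMultilinearMap.mkPiAlgebra ℂ (Fin n)
            ℂ).compContinuousLinearMap (fun j => ContinuousLinearMap.proj (R := ℂ)
              (φ := fun _ : ι => ℂ) (i j))) fun _ => y := sum_apply _ _ _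
      rw [h3]
      refine Finset.sum_congr rfl fun i _ => ?_
      rw [List.map_ofFn, List.prod_ofFn]
      simp [ContinuousMultilinearMap.compContinuousLinearMap_apply]
    rw [e]
    exact h2
  intro y hy
  refine hball.analyticOnNhd y ?_
  rw [mem_eball_zero_iff, ← ofReal_norm]
  exact (ENNReal.ofReal_lt_ofReal_iff hr).2 (by simpa using hy)

end Words

end Fuchs

namespace Fuchs

/-! ### Differential operators on analytic functions of (t, x), and Cauchy's estimates -/

section Calculus

variable {n : ℕ} {U : Set (ℂ × (Fin n → ℂ))} {f g : ℂ × (Fin n → ℂ) → ℂ}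

theorem hasDerivAt_comp_update {f : ℂ × (Fin n → ℂ) → ℂ} {p : ℂ × (Fin n → ℂ)}
    (hf : DifferentiableAt ℂ f p) (j : Fin n) :
    HasDerivAt (fun ζ : ℂ => f (p.1, Function.update p.2 j ζ))
      (fderiv ℂ f p (0, Pi.single j 1)) (p.2 j) := by
  have h1 : HasDerivAt (fun ζ : ℂ => (p.1, Function.update p.2 j ζ)) (0, Pi.single j 1) (p.2 j) :=
    (hasDerivAt_const _ _).prodMk (hasDerivAt_update p.2 j (p.2 j))
  have hf' : HasFDerivAt f (fderiv ℂ f p) (p.1, Function.update p.2 j (p.2 j)) := by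
    rw [Function.update_eq_self]; exact hf.hasFDerivAt
  exact hf'.comp_hasDerivAt (p.2 j) h1

theorem hasDerivAt_fst {f : ℂ × (Fin n → ℂ) → ℂ} {p : ℂ × (Fin n → ℂ)}
    (hf : DifferentiableAt ℂ f p) :
    HasDerivAt (fun ζ : ℂ => f (ζ, p.2)) (fderiv ℂ f p (1, 0)) p.1 := by
  have h1 : HasDerivAt (fun ζ : ℂ => (ζ, p.2)) (1, 0) p.1 :=
    (hasDerivAt_id _).prodMk (hasDerivAt_const _ _)
  exact hf.hasFDerivAt.comp_hasDerivAt p.1 h1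

theorem dxj_eq (j : Fin n) {p : ℂ × (Fin n → ℂ)} (hf : AnalyticAt ℂ f p) :
    dxj j f p = fderiv ℂ f p (0, Pi.single j 1) :=
  (hasDerivAt_comp_update hf.differentiableAt j).deriv

theorem eulerCover_eq {p : ℂ × (Fin n → ℂ)} (hf : AnalyticAt ℂ f p) :
    eulerCover f p = fderiv ℂ f p (1, 0) :=
  (hasDerivAt_fst hf.differentiableAt).deriv

theorem euler_eq {p : ℂ × (Fin n → ℂ)} (hf : AnalyticAt ℂ f p) :
    euler f p = p.1 * fderiv ℂ f p (1, 0) := by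
  rw [euler, (hasDerivAt_fst hf.differentiableAt).deriv]

theorem AnalyticAt.fderiv_apply {p : ℂ × (Fin n → ℂ)} (hf : AnalyticAt ℂ f p)
    (v : ℂ × (Fin n → ℂ)) : AnalyticAt ℂ (fun q => fderiv ℂ f q v) p :=
  ((ContinuousLinearMap.apply ℂ ℂ v).analyticAt _).comp hf.fderiv

theorem analyticAt_dxj (j : Fin n) {p : ℂ × (Fin n → ℂ)} (hf : AnalyticAt ℂ f p) :
    AnalyticAt ℂ (dxj j f) p :=
  (AnalyticAt.fderiv_apply hf _).congr
    (hf.eventually_analyticAt.mono fun _ hq => (dxj_eq j hq).symm)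

theorem analyticAt_eulerCover {p : ℂ × (Fin n → ℂ)} (hf : AnalyticAt ℂ f p) :
    AnalyticAt ℂ (eulerCover f) p :=
  (AnalyticAt.fderiv_apply hf _).congr
    (hf.eventually_analyticAt.mono fun _ hq => (eulerCover_eq hq).symm)

theorem analyticAt_euler {p : ℂ × (Fin n → ℂ)} (hf : AnalyticAt ℂ f p) :
    AnalyticAt ℂ (euler f) p :=
  (analyticAt_fst.mul (AnalyticAt.fderiv_apply hf _)).congr
    (hf.eventually_analyticAt.mono fun _ hq => (euler_eq hq).symm)

theorem dxj_congr (j : Fin n) {p : ℂ × (Fin n → ℂ)} (h : f =ᶠ[𝓝 p] g) : dxj j f =ᶠ[𝓝 p] dxj j g := by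
  refine h.eventually_nhds.mono fun q hq => ?_
  refine Filter.EventuallyEq.deriv_eq ?_
  have hc : ContinuousAt (fun ζ : ℂ => (q.1, Function.update q.2 j ζ)) (q.2 j) := by fun_prop
  have hq' : ∀ᶠ r in 𝓝 (q.1, Function.update q.2 j (q.2 j)), f r = g r := by
    rwa [Function.update_eq_self]
  exact hc.eventually hq'

theorem eulerCover_congr {p : ℂ × (Fin n → ℂ)} (h : f =ᶠ[𝓝 p] g) :
    eulerCover f =ᶠ[𝓝 p] eulerCover g := by
  refine h.eventually_nhds.mono fun q hq => ?_
  refine Filter.EventuallyEq.deriv_eq ?_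
  have hc : ContinuousAt (fun ζ : ℂ => (ζ, q.2)) q.1 := by fun_prop
  exact hc.eventually hq

theorem euler_congr {p : ℂ × (Fin n → ℂ)} (h : f =ᶠ[𝓝 p] g) :
    euler f =ᶠ[𝓝 p] euler g :=
  (eulerCover_congr h).mono fun q hq => congrArg (q.1 * ·) hq

/-- An operator on functions of `(t, x)` behaving like a first-order differential operator with
constant coefficients in `x`. -/
structure IsLocalOp (T : (ℂ × (Fin n → ℂ) → ℂ) → (ℂ × (Fin n → ℂ) → ℂ)) : Prop where
  analyticAt : ∀ {f p}, AnalyticAt ℂ f p → AnalyticAt ℂ (T f) p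
  congr : ∀ {f g p}, f =ᶠ[𝓝 p] g → T f =ᶠ[𝓝 p] T g
  add : ∀ {f g p}, AnalyticAt ℂ f p → AnalyticAt ℂ g p → T (f + g) p = T f p + T g p
  smul : ∀ {f p} (c : ℂ), AnalyticAt ℂ f p → T (c • f) p = c * T f p
  comm : ∀ {f p} (j : Fin n), AnalyticAt ℂ f p → dxj j (T f) p = T (dxj j f) p

theorem fderiv_fderiv_apply {p v w : ℂ × (Fin n → ℂ)} (hf : AnalyticAt ℂ f p) :
    fderiv ℂ (fun q => fderiv ℂ f q v) p w = fderiv ℂ (fderiv ℂ f) p w v := by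
  rw [fderiv_clm_apply hf.fderiv.differentiableAt (differentiableAt_const v)]
  simp

theorem fderiv_fderiv_symm {p v w : ℂ × (Fin n → ℂ)} (hf : AnalyticAt ℂ f p) :
    fderiv ℂ (fderiv ℂ f) p v w = fderiv ℂ (fderiv ℂ f) p w v :=
  (hf.contDiffAt (n := ⊤)).isSymmSndFDerivAt le_top v w

theorem isLocalOp_dxj (j : Fin n) : IsLocalOp (dxj (n := n) j) where
  analyticAt := analyticAt_dxj j
  congr := dxj_congr j
  add hf hg := by
    rw [dxj_eq j (hf.add hg), dxj_eq j hf, dxj_eq j hg,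
      fderiv_add hf.differentiableAt hg.differentiableAt]
    rfl
  smul c hf := by
    rw [dxj_eq j hf, dxj_eq j (hf.const_smul (c := c)), fderiv_const_smul hf.differentiableAt]
    rfl
  comm i hf := by
    rw [dxj_eq i (analyticAt_dxj j hf), dxj_eq j (analyticAt_dxj i hf),
      Filter.EventuallyEq.fderiv_eq (hf.eventually_analyticAt.mono fun _ hq => dxj_eq j hq),
      Filter.EventuallyEq.fderiv_eq (hf.eventually_analyticAt.mono fun _ hq => dxj_eq i hq),
      fderiv_fderiv_apply hf, fderiv_fderiv_apply hf, fderiv_fderiv_symm hf]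

theorem isLocalOp_eulerCover : IsLocalOp (eulerCover (n := n)) where
  analyticAt := analyticAt_eulerCover
  congr := eulerCover_congr
  add hf hg := by
    rw [eulerCover_eq (hf.add hg), eulerCover_eq hf, eulerCover_eq hg,
      fderiv_add hf.differentiableAt hg.differentiableAt]
    rfl
  smul c hf := by
    rw [eulerCover_eq hf, eulerCover_eq (hf.const_smul (c := c)),
      fderiv_const_smul hf.differentiableAt]
    rfl
  comm i hf := by
    rw [dxj_eq i (analyticAt_eulerCover hf), eulerCover_eq (analyticAt_dxj i hf),
      Filter.EventuallyEq.fderiv_eq (hf.eventually_analyticAt.mono fun _ hq => eulerCover_eq hq),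
      Filter.EventuallyEq.fderiv_eq (hf.eventually_analyticAt.mono fun _ hq => dxj_eq i hq),
      fderiv_fderiv_apply hf, fderiv_fderiv_apply hf, fderiv_fderiv_symm hf]

theorem isLocalOp_euler : IsLocalOp (euler (n := n)) where
  analyticAt := analyticAt_euler
  congr := euler_congr
  add hf hg := by
    have := isLocalOp_eulerCover.add hf hg
    change _ * eulerCover _ _ = _ * eulerCover _ _ + _ * eulerCover _ _
    rw [this, mul_add]
  smul c hf := by
    have := isLocalOp_eulerCover.smul c hf
    change _ * eulerCover _ _ = _ * (_ * eulerCover _ _)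
    rw [this]; ring
  comm i hf := by
    have := isLocalOp_eulerCover.comm i hf
    change _ = _ * eulerCover _ _
    rw [← this]
    exact deriv_const_mul_field _

namespace IsLocalOp

variable {T : (ℂ × (Fin n → ℂ) → ℂ) → (ℂ × (Fin n → ℂ) → ℂ)}

theorem iterate (hT : IsLocalOp T) : ∀ i : ℕ, IsLocalOp (T^[i])
  | 0 => ⟨fun h => h, fun h => h, fun _ _ => rfl, fun _ _ => rfl, fun _ _ => rfl⟩
  | i + 1 => by
    have ih := hT.iterate i
    simp only [Function.iterate_succ', Function.comp_def]
    refine ⟨fun h => hT.analyticAt (ih.analyticAt h), fun h => hT.congr (ih.congr h), ?_, ?_, ?_⟩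
    · intro f g p hf hg
      rw [← hT.add (ih.analyticAt hf) (ih.analyticAt hg)]
      exact (hT.congr ((hf.eventually_analyticAt.and hg.eventually_analyticAt).mono
        fun q hq => ih.add hq.1 hq.2)).self_of_nhds
    · intro f p c hf
      rw [← hT.smul c (ih.analyticAt hf)]
      exact (hT.congr (hf.eventually_analyticAt.mono fun q hq => ih.smul c hq)).self_of_nhds
    · intro f p j hf
      rw [hT.comm j (ih.analyticAt hf)]
      exact (hT.congr (hf.eventually_analyticAt.mono fun q hq => ih.comm j hq)).self_of_nhds

theorem sub (hT : IsLocalOp T) {p : ℂ × (Fin n → ℂ)} (hf : AnalyticAt ℂ f p)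
    (hg : AnalyticAt ℂ g p) : T (f - g) p = T f p - T g p := by
  have : f - g = f + (-1 : ℂ) • g := by ext; simp; ring
  rw [this, hT.add hf (hg.const_smul), hT.smul _ hg]
  ring

end IsLocalOp

/-- Induction principle for families of iterated `x`-derivatives. -/
theorem dx_induction {κ : Type*} (P : ℕ → (κ → ℂ × (Fin n → ℂ) → ℂ) → Prop)
    (h : ∀ k j F, P k F → P (k + 1) (fun a => dxj j (F a)))
    (F : κ → ℂ × (Fin n → ℂ) → ℂ) (h0 : P 0 F) (α : Fin n → ℕ) :
    P (∑ j, α j) (fun a => dx α (F a)) := by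
  have iter : ∀ (j : Fin n) (m k : ℕ) F, P k F → P (m + k) (fun a => (dxj j)^[m] (F a)) := by
    intro j m
    induction m with
    | zero => intro k F hF; simpa using hF
    | succ m ih =>
      intro k F hF
      have := h _ j _ (ih k F hF)
      simp only [Function.iterate_succ', Function.comp_def]
      rwa [show m + 1 + k = m + k + 1 by ring]
  have fold : ∀ l : List (Fin n), P (l.map α).sum
      (fun a => l.foldr (fun j g => (dxj j)^[α j] g) (F a)) := by
    intro l
    induction l with
    | nil => simpa using h0
    | cons j l ih => simpa using iter j (α j) _ _ ih
  have := fold (List.finRange n)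
  rwa [← Fin.sum_univ_def] at this

theorem isLocalOp_dx (α : Fin n → ℕ) : IsLocalOp (dx (n := n) α) where
  analyticAt {f p} hf :=
    dx_induction (κ := Unit) (fun _ F => AnalyticAt ℂ (F ()) p)
      (fun _ j _ h => analyticAt_dxj j h) (fun _ => f) hf α
  congr {f g p} h :=
    dx_induction (κ := Bool) (fun _ F => F true =ᶠ[𝓝 p] F false)
      (fun _ j _ h => dxj_congr j h) (fun b => if b then f else g) h α
  add {f g p} hf hg := by
    have := dx_induction (κ := Fin 3) (fun _ F => AnalyticAt ℂ (F 0) p ∧ AnalyticAt ℂ (F 1) p ∧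
      F 2 =ᶠ[𝓝 p] F 0 + F 1) (fun _ j F h => ⟨analyticAt_dxj j h.1, analyticAt_dxj j h.2.1,
        (dxj_congr j h.2.2).trans ((h.1.eventually_analyticAt.and h.2.1.eventually_analyticAt).mono
          fun q hq => (isLocalOp_dxj j).add hq.1 hq.2)⟩) ![f, g, f + g] ⟨hf, hg, .rfl⟩ α
    exact this.2.2.self_of_nhds
  smul {f p} c hf := by
    have := dx_induction (κ := Fin 2) (fun _ F => AnalyticAt ℂ (F 0) p ∧
      F 1 =ᶠ[𝓝 p] c • F 0) (fun _ j F h => ⟨analyticAt_dxj j h.1,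
        (dxj_congr j h.2).trans (h.1.eventually_analyticAt.mono
          fun q hq => (isLocalOp_dxj j).smul c hq)⟩) ![f, c • f] ⟨hf, .rfl⟩ α
    exact this.2.self_of_nhds
  comm {f p} i hf := by
    have := dx_induction (κ := Fin 2) (fun _ F => AnalyticAt ℂ (F 0) p ∧
      F 1 =ᶠ[𝓝 p] dxj i (F 0)) (fun _ j F h => ⟨analyticAt_dxj j h.1,
        (dxj_congr j h.2).trans (h.1.eventually_analyticAt.mono
          fun q hq => (isLocalOp_dxj i).comm j hq)⟩) ![f, dxj i f] ⟨hf, .rfl⟩ α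
    exact this.2.self_of_nhds.symm

/-- `jet` applies θ^i after (∂/∂x)^α, whereas Cauchy's estimates in x need the x-derivatives
outermost. -/
theorem IsLocalOp.comm_dx {T : (ℂ × (Fin n → ℂ) → ℂ) → (ℂ × (Fin n → ℂ) → ℂ)} (hT : IsLocalOp T)
    {p : ℂ × (Fin n → ℂ)} (hf : AnalyticAt ℂ f p) (α : Fin n → ℕ) :
    dx α (T f) p = T (dx α f) p := by
  have := dx_induction (κ := Fin 2) (fun _ F => AnalyticAt ℂ (F 0) p ∧
    F 1 =ᶠ[𝓝 p] T (F 0)) (fun _ j F h => ⟨analyticAt_dxj j h.1,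
      (dxj_congr j h.2).trans (h.1.eventually_analyticAt.mono
        fun q hq => hT.comm j hq)⟩) ![f, T f] ⟨hf, .rfl⟩ α
  exact this.2.self_of_nhds

/-- Cauchy's estimates for `(∂/∂x)^α`. -/
theorem norm_dx_le {s : ℂ} {R δ M : ℝ} (hδ : 0 < δ)
    (hg : ∀ x : Fin n → ℂ, ‖x‖ < R → AnalyticAt ℂ g (s, x))
    (hM : ∀ x : Fin n → ℂ, ‖x‖ < R → ‖g (s, x)‖ ≤ M) (α : Fin n → ℕ) {x : Fin n → ℂ}
    (hx : ‖x‖ < R - (∑ j, α j : ℕ) * δ) : ‖dx α g (s, x)‖ ≤ M / δ ^ (∑ j, α j) := by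
  refine (dx_induction (κ := Unit) (fun k F => (∀ x : Fin n → ℂ, ‖x‖ < R → AnalyticAt ℂ (F ()) (s, x))
    ∧ ∀ x : Fin n → ℂ, ‖x‖ < R - k * δ → ‖F () (s, x)‖ ≤ M / δ ^ k) ?_ (fun _ => g)
    ⟨hg, by simpa using hM⟩ α).2 x hx
  rintro k j F ⟨h1, h2⟩
  refine ⟨fun x hx => analyticAt_dxj j (h1 x hx), fun x hx => ?_⟩
  push_cast at hx
  -- Each differentiation spends one δ of the radius: moving x_j by at most δ stays where the
  -- previous bound holds.
  have hup : ∀ ζ : ℂ, ‖ζ - x j‖ ≤ δ → ‖Function.update x j ζ‖ < R - k * δ := by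
    intro ζ hζ
    have e : Function.update x j ζ = x + Pi.single j (ζ - x j) := by
      ext i; by_cases h : i = j
      · subst h; simp
      · simp [h]
    rw [e]
    refine (norm_add_le _ _).trans_lt ?_
    rw [Pi.norm_single]
    linarith
  have hk : R - k * δ ≤ R := by
    have : 0 ≤ k * δ := by positivity
    linarith
  have hd : DifferentiableOn ℂ (fun ζ : ℂ => F () (s, Function.update x j ζ))
      (Metric.closedBall (x j) δ) := by
    intro ζ hζ
    rw [mem_closedBall_iff_norm] at hζ
    have ha := (h1 _ ((hup ζ hζ).trans_le hk)).differentiableAt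
    have := hasDerivAt_comp_update ha j
    simp only [Function.update_self, Function.update_idem] at this
    exact this.differentiableAt.differentiableWithinAt
  have := Complex.norm_deriv_le_of_forall_mem_sphere_norm_le (C := M / δ ^ k) hδ
    (hd.mono (closure_minimal Metric.ball_subset_closedBall Metric.isClosed_closedBall)).diffContOnCl
    (fun ζ hζ => h2 _ (hup ζ (by rw [mem_sphere_iff_norm] at hζ; exact hζ.le)))
  rw [pow_succ, ← div_div]
  exact this

theorem analyticAt_jet {θ : (ℂ × (Fin n → ℂ) → ℂ) → (ℂ × (Fin n → ℂ) → ℂ)} (hθ : IsLocalOp θ)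
    {p : ℂ × (Fin n → ℂ)} (hf : AnalyticAt ℂ f p) : AnalyticAt ℂ (jet θ f) p := by
  rw [analyticAt_pi_iff]
  exact fun q => (hθ.iterate _).analyticAt ((isLocalOp_dx _).analyticAt hf)

theorem jet_sub {θ : (ℂ × (Fin n → ℂ) → ℂ) → (ℂ × (Fin n → ℂ) → ℂ)} (hθ : IsLocalOp θ)
    {p : ℂ × (Fin n → ℂ)} (hf : AnalyticAt ℂ f p) (hg : AnalyticAt ℂ g p) :
    jet θ (f - g) p = jet θ f p - jet θ g p := by
  funext q
  have h1 : dx q.1.2 (f - g) =ᶠ[𝓝 p] dx q.1.2 f - dx q.1.2 g :=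
    (hf.eventually_analyticAt.and hg.eventually_analyticAt).mono
      fun _ h => (isLocalOp_dx _).sub h.1 h.2
  exact ((hθ.iterate _).congr h1).self_of_nhds.trans ((hθ.iterate _).sub
    ((isLocalOp_dx _).analyticAt hf) ((isLocalOp_dx _).analyticAt hg))

theorem dx_zero (f : ℂ × (Fin n → ℂ) → ℂ) : dx 0 f = f := by
  have : ∀ l : List (Fin n), l.foldr (fun j g => (dxj j)^[(0 : Fin n → ℕ) j] g) f = f := by
    intro l; induction l with
    | nil => rfl
    | cons a l _ => simp
  exact this _

theorem jet_idx00 (θ : (ℂ × (Fin n → ℂ) → ℂ) → (ℂ × (Fin n → ℂ) → ℂ)) (f) (p) :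
    jet θ f p (idx00 n) = f p := by
  change dx 0 f p = _
  rw [dx_zero]

theorem jet_idx10 (θ : (ℂ × (Fin n → ℂ) → ℂ) → (ℂ × (Fin n → ℂ) → ℂ)) (f) (p) :
    jet θ f p (idx10 n) = θ f p := by
  change θ (dx 0 f) p = _
  rw [dx_zero]

end Calculus

end Fuchs

namespace Fuchs

/-! ### Bounded solutions of linear differential equations on a half line -/

section ODE

/-- Bounded solutions on a half line `(-∞, ξ₀]` of `y' = λ y + g` with `Re λ < 0`. -/
theorem norm_le_of_hasDerivAt_first_order {κ q M ξ₀ B : ℝ} (hκ : 0 < κ) (hq : 0 ≤ q) {lam : ℂ}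
    (hlam : lam.re ≤ -κ) {y g : ℝ → ℂ} (hy : ∀ ξ ≤ ξ₀, HasDerivAt y (lam * y ξ + g ξ) ξ)
    (hB : ∀ ξ ≤ ξ₀, ‖y ξ‖ ≤ B) (hg : ∀ ξ ≤ ξ₀, ‖g ξ‖ ≤ M * Real.exp (q * ξ)) {ξ : ℝ} (hξ : ξ ≤ ξ₀) :
    ‖y ξ‖ ≤ M / (q + κ) * Real.exp (q * ξ) := by
  have hM : 0 ≤ M := by
    have := (norm_nonneg _).trans (hg ξ hξ)
    exact nonneg_of_mul_nonneg_left this (Real.exp_pos _)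
  set μ : ℝ := -lam.re with hμ
  have hμκ : κ ≤ μ := by simp only [μ]; linarith
  have hqμ : 0 < q + μ := by linarith
  -- The integrating factor has modulus e^{μτ} with μ > 0. As y is bounded, the initial value of z
  -- at a vanishes in the limit a → -∞, and no homogeneous part survives.
  let z : ℝ → ℂ := fun τ => Complex.exp (-lam * τ) * y τ
  have hexp : ∀ τ : ℝ, ‖Complex.exp (-lam * τ)‖ = Real.exp (μ * τ) := fun τ => by
    rw [Complex.norm_exp]; simp [μ]
  have hz : ∀ τ ≤ ξ₀, HasDerivAt z (Complex.exp (-lam * τ) * g τ) τ := by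
    intro τ hτ
    have h1 : HasDerivAt (fun τ : ℝ => Complex.exp (-lam * τ)) (Complex.exp (-lam * τ) * -lam) τ := by
      have := ((hasDerivAt_id (τ : ℂ)).const_mul (-lam)).cexp.comp_ofReal
      simpa using this
    exact (h1.mul (hy τ hτ)).congr_deriv (by ring)
  have bound : ∀ a ≤ ξ, ‖z ξ‖ ≤ B * Real.exp (μ * a) + M / (q + μ) * Real.exp ((q + μ) * ξ) := by
    intro a ha
    have := image_norm_le_of_norm_deriv_right_le_deriv_boundary (f := z)
      (f' := fun τ => Complex.exp (-lam * τ) * g τ) (a := a) (b := ξ)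
      (B := fun τ => B * Real.exp (μ * a) + M / (q + μ) * Real.exp ((q + μ) * τ))
      (B' := fun τ => M * Real.exp ((q + μ) * τ))
      (fun τ hτ => (hz τ (hτ.2.trans hξ)).continuousAt.continuousWithinAt)
      (fun τ hτ => (hz τ (hτ.2.le.trans hξ)).hasDerivWithinAt) ?_ ?_ ?_ (x := ξ) ⟨ha, le_rfl⟩
    · exact this
    · have h1 : ‖z a‖ ≤ B * Real.exp (μ * a) := by
        simp only [z, norm_mul, hexp]
        rw [mul_comm]
        exact mul_le_mul_of_nonneg_right (hB a (ha.trans hξ)) (Real.exp_pos _).le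
      have : 0 ≤ M / (q + μ) * Real.exp ((q + μ) * a) := by positivity
      linarith
    · intro τ
      have := (((hasDerivAt_id τ).const_mul (q + μ)).exp.const_mul (M / (q + μ))).const_add
        (B * Real.exp (μ * a))
      exact this.congr_deriv (by simp only [id, mul_one]; field_simp)
    · intro τ hτ
      rw [norm_mul, hexp, add_mul, Real.exp_add]
      have := hg τ (hτ.2.le.trans hξ)
      calc _ ≤ Real.exp (μ * τ) * (M * Real.exp (q * τ)) := by gcongr
        _ = _ := by ring
  have hlim : Tendsto (fun a : ℝ => B * Real.exp (μ * a) + M / (q + μ) * Real.exp ((q + μ) * ξ)) atBot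
      (𝓝 (B * 0 + M / (q + μ) * Real.exp ((q + μ) * ξ))) := by
    refine Tendsto.add_const _ (Tendsto.const_mul _ ?_)
    exact Real.tendsto_exp_atBot.comp (tendsto_id.const_mul_atBot (by linarith))
  have h := ge_of_tendsto hlim ((eventually_le_atBot ξ).mono bound)
  have hzξ : ‖z ξ‖ = Real.exp (μ * ξ) * ‖y ξ‖ := by simp only [z, norm_mul, hexp]
  rw [hzξ, mul_zero, zero_add, add_mul, Real.exp_add] at h
  have h2 : ‖y ξ‖ ≤ M / (q + μ) * Real.exp (q * ξ) := by
    have hp := Real.exp_pos (μ * ξ)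
    nlinarith
  refine h2.trans ?_
  gcongr

/-- The operator factors as (d/dξ - l₁)(d/dξ - l₂), and the first-order bound is used for each
factor. Thus y gains two powers of q + κ, but y' = l₂y + (y' - l₂y) only one in its last term. -/
theorem norm_le_of_hasDerivAt_second_order {κ q M ξ₀ B L : ℝ} (hκ : 0 < κ) (hq : 0 ≤ q)
    {c₁ c₀ : ℂ} (hroot : ∀ lam : ℂ, lam ^ 2 - (c₁ * lam + c₀) = 0 → lam.re ≤ -κ ∧ ‖lam‖ ≤ L)
    {y y' g : ℝ → ℂ} (hy : ∀ ξ ≤ ξ₀, HasDerivAt y (y' ξ) ξ)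
    (hy' : ∀ ξ ≤ ξ₀, HasDerivAt y' (c₁ * y' ξ + c₀ * y ξ + g ξ) ξ)
    (hB : ∀ ξ ≤ ξ₀, ‖y ξ‖ ≤ B) (hB' : ∀ ξ ≤ ξ₀, ‖y' ξ‖ ≤ B)
    (hg : ∀ ξ ≤ ξ₀, ‖g ξ‖ ≤ M * Real.exp (q * ξ)) {ξ : ℝ} (hξ : ξ ≤ ξ₀) :
    ‖y ξ‖ ≤ M / (q + κ) ^ 2 * Real.exp (q * ξ) ∧
    ‖y' ξ‖ ≤ (L * (M / (q + κ) ^ 2) + M / (q + κ)) * Real.exp (q * ξ) := by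
  obtain ⟨d, hd⟩ := IsAlgClosed.exists_pow_nat_eq (c₁ ^ 2 + 4 * c₀) (n := 2) (by norm_num)
  set l₁ : ℂ := (c₁ + d) / 2
  set l₂ : ℂ := (c₁ - d) / 2
  have hsum : l₁ + l₂ = c₁ := by simp only [l₁, l₂]; ring
  have hprod : l₁ * l₂ = -c₀ := by
    simp only [l₁, l₂]; linear_combination (-1 / 4 : ℂ) * hd
  obtain ⟨h1, -⟩ := hroot l₁ (by rw [← hsum, ← neg_eq_iff_eq_neg.2 hprod]; ring)
  obtain ⟨h2, h2L⟩ := hroot l₂ (by rw [← hsum, ← neg_eq_iff_eq_neg.2 hprod]; ring)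
  have hqκ : 0 < q + κ := by linarith
  have hz : ∀ ξ ≤ ξ₀, ‖y' ξ - l₂ * y ξ‖ ≤ M / (q + κ) * Real.exp (q * ξ) := fun ξ hξ =>
    norm_le_of_hasDerivAt_first_order (y := fun ξ => y' ξ - l₂ * y ξ) (B := B + ‖l₂‖ * B) hκ hq h1
      (fun ξ hξ => by
        refine ((hy' ξ hξ).sub ((hy ξ hξ).const_mul l₂)).congr_deriv ?_
        rw [← hsum, ← neg_eq_iff_eq_neg.2 hprod]; ring)
      (fun ξ hξ => (norm_sub_le _ _).trans (by
        rw [norm_mul]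
        exact add_le_add (hB' ξ hξ) (mul_le_mul_of_nonneg_left (hB ξ hξ) (norm_nonneg _)))) hg hξ
  have hyb : ∀ ξ ≤ ξ₀, ‖y ξ‖ ≤ M / (q + κ) ^ 2 * Real.exp (q * ξ) := fun ξ hξ => by
    have := norm_le_of_hasDerivAt_first_order (M := M / (q + κ)) (y := y) (B := B) hκ hq h2
      (g := fun ξ => y' ξ - l₂ * y ξ) (fun ξ hξ => by
        exact (hy ξ hξ).congr_deriv (by ring)) hB hz hξ
    rwa [div_div, ← pow_two] at this
  refine ⟨hyb ξ hξ, ?_⟩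
  have e : y' ξ = l₂ * y ξ + (y' ξ - l₂ * y ξ) := by ring
  rw [e]
  refine (norm_add_le _ _).trans ?_
  rw [norm_mul, add_mul]
  refine add_le_add ?_ (hz ξ hξ)
  rw [mul_assoc]
  exact mul_le_mul h2L (hyb ξ hξ) (norm_nonneg _) ((norm_nonneg _).trans h2L)

/-- The roots of a quadratic polynomial depend continuously on the coefficients, in the weak form
that a bound on their real parts is stable. -/
theorem eventually_roots_re_le {X : Type*} [TopologicalSpace X] {x₀ : X} {c₁ c₀ : X → ℂ}
    (h₁ : ContinuousAt c₁ x₀) (h₀ : ContinuousAt c₀ x₀)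
    (hroot : ∀ lam : ℂ, lam ^ 2 - (c₁ x₀ * lam + c₀ x₀) = 0 → lam.re < 0) :
    ∃ κ > 0, ∃ L > 0, ∀ᶠ x in 𝓝 x₀,
      ∀ lam : ℂ, lam ^ 2 - (c₁ x * lam + c₀ x) = 0 → lam.re ≤ -κ ∧ ‖lam‖ ≤ L := by
  obtain ⟨d, hd⟩ := IsAlgClosed.exists_pow_nat_eq (c₁ x₀ ^ 2 + 4 * c₀ x₀) (n := 2) (by norm_num)
  set l₁ : ℂ := (c₁ x₀ + d) / 2
  set l₂ : ℂ := (c₁ x₀ - d) / 2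
  have hsum : l₁ + l₂ = c₁ x₀ := by simp only [l₁, l₂]; ring
  have hprod : l₁ * l₂ = -c₀ x₀ := by
    simp only [l₁, l₂]; linear_combination (-1 / 4 : ℂ) * hd
  have hl₁ := hroot l₁ (by rw [← hsum, ← neg_eq_iff_eq_neg.2 hprod]; ring)
  have hl₂ := hroot l₂ (by rw [← hsum, ← neg_eq_iff_eq_neg.2 hprod]; ring)
  obtain ⟨κ, hκ, hκ₁, hκ₂⟩ : ∃ κ > 0, l₁.re ≤ -(2 * κ) ∧ l₂.re ≤ -(2 * κ) := by
    refine ⟨min (-l₁.re / 2) (-l₂.re / 2), lt_min (by linarith) (by linarith), ?_, ?_⟩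
    · linarith [min_le_left (-l₁.re / 2) (-l₂.re / 2)]
    · linarith [min_le_right (-l₁.re / 2) (-l₂.re / 2)]
  set L : ℝ := 2 + ‖c₁ x₀‖ + ‖c₀ x₀‖ + 1
  have hL : 1 ≤ L := by simp only [L]; linarith [norm_nonneg (c₁ x₀), norm_nonneg (c₀ x₀)]
  refine ⟨κ, hκ, L, by linarith, ?_⟩
  -- A point with real part above -κ is at distance at least κ from both l₁ and l₂, so the
  -- polynomial at x₀ has modulus at least κ² there; a perturbation smaller than κ² creates no root
  -- at such a point.
  have hb : ContinuousAt (fun x => ‖c₁ x - c₁ x₀‖ * L + ‖c₀ x - c₀ x₀‖) x₀ := by fun_prop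
  have hb' : ∀ᶠ x in 𝓝 x₀, ‖c₁ x - c₁ x₀‖ * L + ‖c₀ x - c₀ x₀‖ < κ ^ 2 :=
    hb.eventually_lt continuousAt_const (by simp; positivity)
  have e1 : ∀ᶠ x in 𝓝 x₀, ‖c₁ x‖ < ‖c₁ x₀‖ + 1 :=
    h₁.norm.eventually_lt continuousAt_const (by simp)
  have e0 : ∀ᶠ x in 𝓝 x₀, ‖c₀ x‖ < ‖c₀ x₀‖ + 1 :=
    h₀.norm.eventually_lt continuousAt_const (by simp)
  filter_upwards [hb', e1, e0] with x hx hx1 hx0 lam hlam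
  have hlamL : ‖lam‖ ≤ L := by
    by_contra! hcon
    have h1 : ‖lam‖ ^ 2 ≤ ‖c₁ x‖ * ‖lam‖ + ‖c₀ x‖ := by
      rw [← norm_pow, ← norm_mul, sub_eq_zero.1 hlam]; exact norm_add_le _ _
    have h3 : 1 ≤ ‖lam‖ := by linarith
    have h4 : ‖c₀ x‖ ≤ (‖c₀ x₀‖ + 1) * ‖lam‖ := by nlinarith [norm_nonneg (c₀ x₀)]
    have h5 : ‖c₁ x‖ * ‖lam‖ ≤ (‖c₁ x₀‖ + 1) * ‖lam‖ := by nlinarith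
    have : ‖lam‖ * ‖lam‖ ≤ ((‖c₁ x₀‖ + 1) + (‖c₀ x₀‖ + 1)) * ‖lam‖ := by nlinarith
    have := le_of_mul_le_mul_right this (by linarith)
    simp only [L] at hcon
    linarith
  refine ⟨?_, hlamL⟩
  by_contra! hcon
  have k1 : κ ≤ ‖lam - l₁‖ := by
    refine le_trans ?_ (Complex.re_le_norm _)
    rw [Complex.sub_re]; linarith
  have k2 : κ ≤ ‖lam - l₂‖ := by
    refine le_trans ?_ (Complex.re_le_norm _)
    rw [Complex.sub_re]; linarith
  have key : (lam - l₁) * (lam - l₂) = (c₁ x - c₁ x₀) * lam + (c₀ x - c₀ x₀) := by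
    have : (lam - l₁) * (lam - l₂) = lam ^ 2 - (l₁ + l₂) * lam + l₁ * l₂ := by ring
    rw [this, hsum, hprod]
    linear_combination hlam
  have : ‖lam - l₁‖ * ‖lam - l₂‖ ≤ ‖c₁ x - c₁ x₀‖ * L + ‖c₀ x - c₀ x₀‖ := by
    rw [← norm_mul, key]
    refine (norm_add_le _ _).trans ?_
    rw [norm_mul]
    gcongr
  nlinarith

end ODE

/-- A function bounded by `1` on the disc of radius `2` and very small near the origin is small
at `1`. -/
theorem norm_apply_one_le {h : ℂ → ℂ} {b ρ : ℝ} (hh : DifferentiableOn ℂ h (Metric.ball 0 3))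
    (hρ : 0 < ρ) (hρ1 : ρ ≤ 1) (hb : ∀ z, ‖z‖ ≤ ρ → ‖h z‖ ≤ b) (h1 : ∀ z, ‖z‖ ≤ 2 → ‖h z‖ ≤ 1)
    (J : ℕ) : ‖h 1‖ ≤ J * (b / ρ ^ J) + 2 * (1 / 2) ^ J := by
  have hb0 : 0 ≤ b := (norm_nonneg _).trans (hb 0 (by simpa using hρ.le))
  have hs := Complex.hasSum_taylorSeries_on_ball hh (z := 1) (by simp)
  set a : ℕ → ℂ := fun m => ((m.factorial : ℂ))⁻¹ • (1 - 0 : ℂ) ^ m • iteratedDeriv m h 0 with ha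
  have bd : ∀ m r C, 0 < r → r ≤ 2 → (∀ z : ℂ, ‖z‖ ≤ r → ‖h z‖ ≤ C) → ‖a m‖ ≤ C / r ^ m := by
    intro m r C hr hr2 hC
    have := Complex.norm_iteratedDeriv_le_of_forall_mem_sphere_norm_le (c := 0) (R := r) (C := C) m hr
      (hh.mono (Metric.closure_ball_subset_closedBall.trans
        (Metric.closedBall_subset_ball (by linarith : r < 3)))).diffContOnCl
      (fun z hz => hC z (by simpa using (mem_sphere_iff_norm.1 hz).le))
    simp only [ha, sub_zero, one_pow, one_smul, norm_smul, norm_inv, Complex.norm_natCast]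
    have hf : (0 : ℝ) < m.factorial := by positivity
    rw [inv_mul_le_iff₀ hf]
    exact this.trans_eq (by ring)
  -- Coefficients of order below J are estimated on the small circle, the others on the circle of
  -- radius 2, where the tail is ∑_{m ≥ J} 2^{-m} = 2·2^{-J}.
  have bd1 := fun m => bd m ρ b hρ (by linarith) hb
  have bd2 := fun m => bd m 2 1 two_pos le_rfl h1
  have hgeo := summable_geometric_two
  have hsa : Summable (fun m => ‖a m‖) :=
    hgeo.of_nonneg_of_le (fun _ => norm_nonneg _) fun m => by
      simpa using bd2 m
  rw [← hs.tsum_eq]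
  refine (norm_tsum_le_tsum_norm hsa).trans ?_
  rw [← hsa.sum_add_tsum_nat_add J]
  refine add_le_add ?_ ?_
  · calc _ ≤ ∑ _m ∈ Finset.range J, b / ρ ^ J := by
          refine Finset.sum_le_sum fun m hm => (bd1 m).trans ?_
          gcongr _ / ?_
          exact pow_le_pow_of_le_one hρ.le hρ1 (Finset.mem_range.1 hm).le
      _ = _ := by simp
  · have h2 : Summable (fun m : ℕ => (1 / 2 : ℝ) ^ m * (1 / 2) ^ J) := hgeo.mul_right _
    calc ∑' m, ‖a (m + J)‖ ≤ ∑' m : ℕ, (1 / 2 : ℝ) ^ m * (1 / 2) ^ J := by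
          refine ((summable_nat_add_iff J).2 hsa).tsum_le_tsum (fun m => ?_) h2
          refine (bd2 _).trans_eq ?_
          rw [pow_add]; simp; ring
      _ = _ := by rw [tsum_mul_right, tsum_geometric_two]

end Fuchs

namespace Fuchs

/-! ### Linearisation of F in z at (0, x, 0) -/

section Equation

variable {n : ℕ} {F : JetSpace n → ℂ}

theorem hasDerivAt_comp_update_jet {p : JetSpace n} (hF : DifferentiableAt ℂ F p) (q : Lam n) :
    HasDerivAt (fun ζ : ℂ => F (p.1, p.2.1, Function.update p.2.2 q ζ))
      (fderiv ℂ F p (0, 0, Pi.single q 1)) (p.2.2 q) := by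
  have h1 : HasDerivAt (fun ζ : ℂ => (p.1, p.2.1, Function.update p.2.2 q ζ))
      (0, 0, Pi.single q 1) (p.2.2 q) :=
    (hasDerivAt_const _ _).prodMk
      ((hasDerivAt_const _ _).prodMk (hasDerivAt_update p.2.2 q (p.2.2 q)))
  have hf' : HasFDerivAt F (fderiv ℂ F p) (p.1, p.2.1, Function.update p.2.2 q (p.2.2 q)) := by
    rw [Function.update_eq_self]; exact hF.hasFDerivAt
  exact hf'.comp_hasDerivAt (p.2.2 q) h1

theorem dz_eq (q : Lam n) {p : JetSpace n} (hF : AnalyticAt ℂ F p) :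
    dz q F p = fderiv ℂ F p (0, 0, Pi.single q 1) :=
  (hasDerivAt_comp_update_jet hF.differentiableAt q).deriv

theorem analyticAt_dz (q : Lam n) {x₀ : Fin n → ℂ} (hF : AnalyticAt ℂ F (0, x₀, 0)) :
    AnalyticAt ℂ (fun x => dz q F (0, x, 0)) x₀ := by
  have hι : AnalyticAt ℂ (fun x : Fin n → ℂ => ((0, x, 0) : JetSpace n)) x₀ :=
    analyticAt_const.prod (analyticAt_id.prod analyticAt_const)
  have h1 : AnalyticAt ℂ (fun x => fderiv ℂ F (0, x, 0) (0, 0, Pi.single q 1)) x₀ :=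
    ((ContinuousLinearMap.apply ℂ ℂ ((0, 0, Pi.single q 1) : JetSpace n)).analyticAt _).comp
      (AnalyticAt.fun_comp (f := fun x : Fin n → ℂ => ((0, x, 0) : JetSpace n)) hF.fderiv hι)
  refine h1.congr ?_
  have : ∀ᶠ x in 𝓝 x₀, AnalyticAt ℂ F (0, x, 0) :=
    hι.continuousAt.eventually hF.eventually_analyticAt
  exact this.mono fun x hx => (dz_eq q hx).symm

theorem eq_idx_of_sum_eq_zero (q : Lam n) (h : ∑ j, q.1.2 j = 0) : q = idx00 n ∨ q = idx10 n := by
  obtain ⟨⟨i, α⟩, h1, h2⟩ := q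
  have hα : α = 0 := by
    funext j
    exact Finset.sum_eq_zero_iff.1 h j (Finset.mem_univ j)
  subst hα
  simp only at h2
  interval_cases i
  · exact Or.inl rfl
  · exact Or.inr rfl

theorem idx00_ne_idx10 : idx00 n ≠ idx10 n := fun h => by
  have := congrArg (fun q : Lam n => q.1.1) h
  simp [idx00, idx10] at this

theorem sum_dz_mul {x : Fin n → ℂ}
    (hA3 : ∀ q : Lam n, 0 < ∑ j, q.1.2 j → dz q F (0, x, 0) = 0) (z : Lam n → ℂ) :
    ∑ q, z q * dz q F (0, x, 0) =
      dz (idx10 n) F (0, x, 0) * z (idx10 n) + dz (idx00 n) F (0, x, 0) * z (idx00 n) := by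
  classical
  rw [← Finset.sum_subset (Finset.subset_univ {idx10 n, idx00 n}),
    Finset.sum_pair idx00_ne_idx10.symm]
  · ring
  · intro q _ hq
    rw [hA3 q, mul_zero]
    by_contra h
    rcases eq_idx_of_sum_eq_zero q (by omega) with h | h <;> simp [h] at hq

theorem fderiv_apply_jet {p : JetSpace n} (hF : AnalyticAt ℂ F p) (z : Lam n → ℂ) :
    fderiv ℂ F p (0, 0, z) = ∑ q, z q * dz q F p := by
  have hz : ((0, 0, z) : JetSpace n) = ∑ q, z q • ((0, 0, Pi.single q 1) : JetSpace n) := by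
    refine Prod.ext ?_ (Prod.ext ?_ ?_)
    · simp [Prod.fst_sum]
    · simp [Prod.fst_sum, Prod.snd_sum]
    · ext j; simp [Prod.snd_sum, Pi.single_apply]
  rw [hz, map_sum]
  exact Finset.sum_congr rfl fun q _ => by rw [map_smul, dz_eq _ hF, smul_eq_mul]

/-- This is the mean value inequality relative to the fixed linear map F'(0, x, 0): F' is Lipschitz,
so it deviates from that map by O(|t| + |z| + |z'|) on the segment. By (A₃) only z_{1,0} and z_{0,0}
survive in the linear map. -/
theorem exists_lipschitz_estimate (hF : AnalyticAt ℂ F (0, 0, 0))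
    (hA3 : ∀ᶠ x in 𝓝 (0 : Fin n → ℂ), ∀ q : Lam n, 0 < ∑ j, q.1.2 j → dz q F (0, x, 0) = 0) :
    ∃ η > 0, ∃ C > 0, ∀ (t : ℂ) (x : Fin n → ℂ) (z z' : Lam n → ℂ), ‖t‖ < η → ‖x‖ < η →
      ‖z‖ < η → ‖z'‖ < η →
      ‖F (t, x, z) - F (t, x, z') - (dz (idx10 n) F (0, x, 0) * (z - z') (idx10 n) +
        dz (idx00 n) F (0, x, 0) * (z - z') (idx00 n))‖ ≤ C * (‖t‖ + ‖z‖ + ‖z'‖) * ‖z - z'‖ := by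
  obtain ⟨K, S, hS, hK⟩ := (hF.fderiv.contDiffAt (n := 1)).exists_lipschitzOnWith
  obtain ⟨η, hη, hball⟩ := Metric.eventually_nhds_iff_ball.1
    ((hF.eventually_analyticAt.and hS).and
      ((continuous_fst.comp continuous_snd).continuousAt.eventually hA3))
  refine ⟨η, hη, K + 1, by positivity, fun t x z z' ht hx hz hz' => ?_⟩
  have hmem : ∀ (s : ℂ) (y : Lam n → ℂ), ‖s‖ < η → ‖y‖ < η → ((s, x, y) : JetSpace n) ∈
      Metric.ball (0, 0, 0) η := by
    intro s y hs hy
    have : ((0, 0, 0) : JetSpace n) = 0 := rfl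
    rw [this, mem_ball_zero_iff, Prod.norm_def, Prod.norm_def]
    simp [hs, hx, hy]
  have h0 := hball _ (hmem 0 0 (by simpa using hη) (by simpa using hη))
  set ρ := max ‖z‖ ‖z'‖
  let s : Set (JetSpace n) := {t} ×ˢ {x} ×ˢ Metric.closedBall (0 : Lam n → ℂ) ρ
  have hs : Convex ℝ s := (convex_singleton _).prod ((convex_singleton _).prod (convex_closedBall _ _))
  have hlip : ∀ p ∈ s, ‖fderiv ℂ F p - fderiv ℂ F (0, x, 0)‖ ≤ K * (‖t‖ + ‖z‖ + ‖z'‖) ∧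
      AnalyticAt ℂ F p := by
    rintro ⟨t1, x1, y⟩ ⟨h1, h2, h3⟩
    simp only [Set.mem_singleton_iff] at h1 h2
    subst h1 h2
    have hy : ‖y‖ ≤ ρ := by simpa using h3
    have hy' : ‖y‖ < η := hy.trans_lt (max_lt hz hz')
    have hp := hball _ (hmem t1 y ht hy')
    refine ⟨?_, hp.1.1⟩
    have := hK.dist_le_mul _ hp.1.2 _ h0.1.2
    rw [dist_eq_norm, dist_eq_norm] at this
    refine this.trans ?_
    gcongr
    have e : ((t1, x1, y) : JetSpace n) - (0, x1, 0) = (t1, 0, y) := by simp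
    rw [e, Prod.norm_def, Prod.norm_def]
    have : ρ ≤ ‖z‖ + ‖z'‖ := max_le_add_of_nonneg (norm_nonneg _) (norm_nonneg _)
    simp only [norm_zero]
    refine max_le ?_ (max_le (by positivity) ?_)
    · linarith [norm_nonneg z, norm_nonneg z']
    · linarith [norm_nonneg t1]
  have key := hs.norm_image_sub_le_of_norm_hasFDerivWithin_le' (f := F) (f' := fderiv ℂ F)
    (φ := fderiv ℂ F (0, x, 0)) (x := (t, x, z')) (y := (t, x, z))
    (fun p hp => (hlip p hp).2.differentiableAt.hasFDerivAt.hasFDerivWithinAt)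
    (fun p hp => (hlip p hp).1) ⟨rfl, rfl, by simp [ρ]⟩ ⟨rfl, rfl, by simp [ρ]⟩
  have e : ((t, x, z) : JetSpace n) - (t, x, z') = (0, 0, z - z') := by simp
  rw [e, fderiv_apply_jet h0.1.1, sum_dz_mul (x := x) h0.2] at key
  refine key.trans ?_
  have e2 : ‖((0, 0, z - z') : JetSpace n)‖ = ‖z - z'‖ := by simp [Prod.norm_def]
  rw [e2]
  gcongr
  linarith

end Equation

end Fuchs

namespace Fuchs

/-! ### The difference of two solutions along a ray -/

section RayPair

variable {n : ℕ}

/-- Exponential bounds for `w` and `w'` on `(-∞, ξ₀] × D_R`. -/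
def RayBound (w w' : ℝ → (Fin n → ℂ) → ℂ) (p ξ₀ R A A' : ℝ) : Prop :=
  ∀ ξ ≤ ξ₀, ∀ x, ‖x‖ < R → ‖w ξ x‖ ≤ A * Real.exp (p * ξ) ∧ ‖w' ξ x‖ ≤ A' * Real.exp (p * ξ)

/-- The a priori information on the difference `w` of two solutions along a ray, `w'` being
`t ∂w/∂t` and `ju`, `jv`, `jw` being the norms of the jets of the solutions and of `w`. -/
structure IsRayPair (w w' : ℝ → (Fin n → ℂ) → ℂ) (ju jv jw : ℝ → (Fin n → ℂ) → ℝ)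
    (ξs Rs K η : ℝ) : Prop where
  Rs_pos : 0 < Rs
  Rs_le : Rs ≤ 1
  K_pos : 0 < K
  η_pos : 0 < η
  diff : ∀ ξ ≤ ξs, ∀ x, DifferentiableOn ℂ (fun ζ : ℂ => w ξ (ζ • x)) {ζ | ‖ζ • x‖ < Rs} ∧
    DifferentiableOn ℂ (fun ζ : ℂ => w' ξ (ζ • x)) {ζ | ‖ζ • x‖ < Rs}
  ju_nonneg : ∀ ξ x, 0 ≤ ju ξ x
  jv_nonneg : ∀ ξ x, 0 ≤ jv ξ x
  ju_le : ∀ ξ ≤ ξs, ∀ x, ‖x‖ < Rs → ju ξ x ≤ jv ξ x + jw ξ x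
  w_le : ∀ ξ ≤ ξs, ∀ x, ‖x‖ < Rs → ‖w ξ x‖ ≤ ju ξ x + jv ξ x ∧ ‖w' ξ x‖ ≤ ju ξ x + jv ξ x
  -- An entry of the jet is at most two x-derivatives of w or one x-derivative of w', hence δ⁻² and
  -- δ⁻¹.
  jet_le : ∀ {ξ₀ R δ p A A'}, ξ₀ ≤ ξs → R ≤ Rs → 0 < δ → δ ≤ 1 → 0 ≤ A → 0 ≤ A' →
    RayBound w w' p ξ₀ R A A' → ∀ ξ ≤ ξ₀, ∀ x, ‖x‖ < R - 2 * δ →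
      jw ξ x ≤ (A / δ ^ 2 + A' / δ) * Real.exp (p * ξ)
  -- One turn of the iteration: the shrinking by 2δ pays for the jet of w, the factor μe^{mξ} comes
  -- from the nonlinearity, and the powers of p + m + 1 are the gain of the differential equation.
  step : ∀ {ξ₀ R δ p m μ A A'}, ξ₀ ≤ ξs → R ≤ Rs → 0 < δ → δ ≤ 1 → 0 ≤ p → 0 ≤ m → 0 ≤ A → 0 ≤ A' →
    0 ≤ μ → RayBound w w' p ξ₀ R A A' →
    (∀ ξ ≤ ξ₀, ∀ x, ‖x‖ < R - 2 * δ → ju ξ x < η ∧ jv ξ x < η ∧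
      Real.exp ξ + ju ξ x + jv ξ x ≤ μ * Real.exp (m * ξ)) →
    RayBound w w' (p + m) ξ₀ (R - 2 * δ) (K * μ * (A / δ ^ 2 + A' / δ) / (p + m + 1) ^ 2)
      (K * μ * (A / δ ^ 2 + A' / δ) / (p + m + 1))

theorem IsSectorialSolution.mono {Δ : Set (JetSpace n)} {F : JetSpace n → ℂ} {θ₁ θ₂ r₀ R₀ r R : ℝ}
    {u : ℂ × (Fin n → ℂ) → ℂ} (hu : IsSectorialSolution Δ F θ₁ θ₂ r₀ R₀ u) (hr : r ≤ r₀)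
    (hR : R ≤ R₀) : IsSectorialSolution Δ F θ₁ θ₂ r R u := by
  have hsub : sector θ₁ θ₂ r ×ˢ polydisc n R ⊆ sector θ₁ θ₂ r₀ ×ˢ polydisc n R₀ := by
    refine Set.prod_mono (fun s hs => ⟨hs.1, hs.2.1, hs.2.2.trans_le hr⟩)
      (Metric.ball_subset_ball hR)
  exact ⟨hu.1.mono hsub, fun p hp => hu.2 p (hsub hp)⟩

theorem norm_jet_le {w : ℂ × (Fin n → ℂ) → ℂ} {s : ℂ} {R δ A A' : ℝ} (hδ : 0 < δ) (hδ1 : δ ≤ 1)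
    (hA : 0 ≤ A) (hA' : 0 ≤ A')
    (hw : ∀ x : Fin n → ℂ, ‖x‖ < R → AnalyticAt ℂ w (s, x))
    (hb : ∀ x : Fin n → ℂ, ‖x‖ < R → ‖w (s, x)‖ ≤ A)
    (hb' : ∀ x : Fin n → ℂ, ‖x‖ < R → ‖eulerCover w (s, x)‖ ≤ A') {x : Fin n → ℂ}
    (hx : ‖x‖ < R - 2 * δ) : ‖jet eulerCover w (s, x)‖ ≤ A / δ ^ 2 + A' / δ := by
  have hxR : ‖x‖ < R := by linarith
  refine (pi_norm_le_iff_of_nonneg (by positivity)).2 fun q => ?_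
  obtain ⟨⟨i, α⟩, h1, h2⟩ := q
  simp only at h1 h2
  have hx' : ∀ k : ℕ, k ≤ 2 → ‖x‖ < R - k * δ := fun k hk => by
    have : (k : ℝ) ≤ 2 := by exact_mod_cast hk
    nlinarith
  have hpow : ∀ k m : ℕ, k ≤ m → 1 / δ ^ k ≤ 1 / δ ^ m := fun k m hk =>
    one_div_le_one_div_of_le (by positivity) (pow_le_pow_of_le_one hδ.le hδ1 hk)
  interval_cases i
  · have := norm_dx_le hδ hw hb α (x := x) (hx' _ (by omega))
    change ‖dx α w (s, x)‖ ≤ _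
    refine this.trans ?_
    have h3 := mul_le_mul_of_nonneg_left (hpow (∑ j, α j) 2 (by omega)) hA
    rw [mul_one_div, mul_one_div] at h3
    have : 0 ≤ A' / δ := by positivity
    linarith
  · have := norm_dx_le hδ (g := eulerCover w) (fun x hx => analyticAt_eulerCover (hw x hx)) hb' α
      (x := x) (hx' _ (by omega))
    change ‖eulerCover (dx α w) (s, x)‖ ≤ _
    rw [← isLocalOp_eulerCover.comm_dx (hw x hxR)]
    refine this.trans ?_
    have h3 := mul_le_mul_of_nonneg_left (hpow (∑ j, α j) 1 (by omega)) hA'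
    rw [mul_one_div, mul_one_div, pow_one] at h3
    have : 0 ≤ A / δ ^ 2 := by positivity
    linarith

theorem mem_sector_ray {θ₁ θ₂ r φ ξ : ℝ} (hφ₁ : θ₁ < φ) (hφ₂ : φ < θ₂) (hr : Real.exp ξ < r) :
    (ξ : ℂ) + φ * Complex.I ∈ sector θ₁ θ₂ r := by
  refine ⟨by simpa using hφ₁, by simpa using hφ₂, ?_⟩
  rw [Complex.norm_exp]; simpa using hr

/-- From here on the uniqueness argument uses the equation only through `IsRayPair`. The
differential equation is solved in ξ for each fixed x, with coefficients frozen at (0, x, 0). -/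
theorem exists_isRayPair {Δ : Set (JetSpace n)} {F : JetSpace n → ℂ}
    (hF : AnalyticAt ℂ F (0, 0, 0))
    (hA3 : ∀ᶠ x in 𝓝 (0 : Fin n → ℂ), ∀ q : Lam n, 0 < ∑ j, q.1.2 j → dz q F (0, x, 0) = 0)
    (hexp : ∀ lam : ℂ, IsCharExponent F 0 lam → lam.re < 0) {θ₁ θ₂ φ r₀ R₀ : ℝ} (hr₀ : 0 < r₀)
    (hR₀ : 0 < R₀) (hφ₁ : θ₁ < φ) (hφ₂ : φ < θ₂) {u v : ℂ × (Fin n → ℂ) → ℂ}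
    (hu : IsSectorialSolution Δ F θ₁ θ₂ r₀ R₀ u) (hv : IsSectorialSolution Δ F θ₁ θ₂ r₀ R₀ v) :
    ∃ ξs Rs K η : ℝ, Rs ≤ R₀ ∧ Real.exp ξs < r₀ ∧ IsRayPair
      (fun ξ x => (u - v) ((ξ : ℂ) + φ * Complex.I, x))
      (fun ξ x => eulerCover (u - v) ((ξ : ℂ) + φ * Complex.I, x))
      (fun ξ x => ‖jet eulerCover u ((ξ : ℂ) + φ * Complex.I, x)‖)
      (fun ξ x => ‖jet eulerCover v ((ξ : ℂ) + φ * Complex.I, x)‖)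
      (fun ξ x => ‖jet eulerCover (u - v) ((ξ : ℂ) + φ * Complex.I, x)‖) ξs Rs K η := by
  obtain ⟨η, hη, C, hC, hlip⟩ := exists_lipschitz_estimate hF hA3
  obtain ⟨κ, hκ, L, hL, hroots⟩ := eventually_roots_re_le (x₀ := (0 : Fin n → ℂ))
    (analyticAt_dz (idx10 n) hF).continuousAt (analyticAt_dz (idx00 n) hF).continuousAt hexp
  obtain ⟨Rr, hRr, hroots⟩ := Metric.eventually_nhds_iff_ball.1 hroots
  set Rs := min (min R₀ 1) (min η Rr)
  have hRs : 0 < Rs := by positivity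
  set ρ := min r₀ η
  have hρ : 0 < ρ := by positivity
  set ξs := Real.log (ρ / 2)
  have hξs : Real.exp ξs = ρ / 2 := Real.exp_log (by positivity)
  have hξ : ∀ ξ ≤ ξs, Real.exp ξ < r₀ ∧ Real.exp ξ < η := fun ξ h => by
    have h1 := Real.exp_le_exp.2 h
    rw [hξs] at h1
    have h2 : ρ / 2 < ρ := by linarith
    exact ⟨(h1.trans_lt h2).trans_le (min_le_left _ _), (h1.trans_lt h2).trans_le (min_le_right _ _)⟩
  -- For q ≥ 0 one has 1/(q + κ) ≤ κ'/(q + 1), so the denominators in `step` need not involve κ.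
  set κ' := 1 / min κ 1
  have hmk : 0 < min κ 1 := by positivity
  have hκ' : 0 < κ' := by positivity
  have hκ1 : 1 ≤ κ' := (one_le_div hmk).2 (min_le_right _ _)
  set K := C * κ' ^ 2 * (L + 1)
  have hmem : ∀ ξ ≤ ξs, ∀ x : Fin n → ℂ, ‖x‖ < Rs →
      ((ξ : ℂ) + φ * Complex.I, x) ∈ sector θ₁ θ₂ r₀ ×ˢ polydisc n R₀ := fun ξ h x hx =>
    ⟨mem_sector_ray hφ₁ hφ₂ (hξ ξ h).1, mem_ball_zero_iff.2 (hx.trans_le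
      ((min_le_left _ _).trans (min_le_left _ _)))⟩
  have hua := fun ξ h x hx => hu.1 _ (hmem ξ h x hx)
  have hva := fun ξ h x hx => hv.1 _ (hmem ξ h x hx)
  have hwa := fun ξ h x hx => (hua ξ h x hx).sub (hva ξ h x hx)
  have hjet := fun ξ h x hx => jet_sub isLocalOp_eulerCover (hua ξ h x hx) (hva ξ h x hx)
  have hlin : ∀ (ξ : ℝ) (x : Fin n → ℂ) (ζ : ℂ),
      DifferentiableAt ℂ (fun ζ : ℂ => ((ξ : ℂ) + φ * Complex.I, ζ • x)) ζ := fun ξ x ζ => by fun_prop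
  have hjw : ∀ {ξ₀ R δ p A A' : ℝ}, ξ₀ ≤ ξs → R ≤ Rs → 0 < δ → δ ≤ 1 → 0 ≤ A → 0 ≤ A' →
    RayBound (fun ξ x => (u - v) ((ξ : ℂ) + φ * Complex.I, x))
      (fun ξ x => eulerCover (u - v) ((ξ : ℂ) + φ * Complex.I, x)) p ξ₀ R A A' →
      ∀ ξ ≤ ξ₀, ∀ x, ‖x‖ < R - 2 * δ →
      ‖jet eulerCover (u - v) ((ξ : ℂ) + φ * Complex.I, x)‖
        ≤ (A / δ ^ 2 + A' / δ) * Real.exp (p * ξ) := by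
    intro ξ₀ R δ p A A' hξ₀ hR hδ hδ1 hA hA' hb ξ hξ' x hx
    have := norm_jet_le (w := u - v) hδ hδ1 (by positivity : 0 ≤ A * Real.exp (p * ξ))
      (by positivity : 0 ≤ A' * Real.exp (p * ξ))
      (fun x hx => hwa ξ (hξ'.trans hξ₀) x (hx.trans_le hR))
      (fun x hx => (hb ξ hξ' x hx).1) (fun x hx => (hb ξ hξ' x hx).2) hx
    refine this.trans_eq ?_
    ring
  refine ⟨ξs, Rs, K, η, (min_le_left _ _).trans (min_le_left _ _), (hξ ξs le_rfl).1, ?_⟩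
  refine ⟨hRs, (min_le_left _ _).trans (min_le_right _ _), by positivity, hη, ?_,
    fun _ _ => norm_nonneg _, fun _ _ => norm_nonneg _, ?_, ?_, hjw, ?_⟩
  · intro ξ h x
    refine ⟨fun ζ hζ => ?_, fun ζ hζ => ?_⟩
    · exact (DifferentiableAt.comp ζ (g := u - v) (f := fun ζ : ℂ => ((ξ : ℂ) + φ * Complex.I, ζ • x))
        (hwa ξ h _ hζ).differentiableAt (hlin ξ x ζ)).differentiableWithinAt
    · exact (DifferentiableAt.comp ζ (g := eulerCover (u - v))
        (f := fun ζ : ℂ => ((ξ : ℂ) + φ * Complex.I, ζ • x))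
        (analyticAt_eulerCover (hwa ξ h _ hζ)).differentiableAt (hlin ξ x ζ)).differentiableWithinAt
  · intro ξ h x hx
    rw [hjet ξ h x hx]
    exact norm_le_norm_add_norm_sub' _ _
  · intro ξ h x hx
    have h1 : ‖jet eulerCover (u - v) ((ξ : ℂ) + φ * Complex.I, x)‖ ≤ _ :=
      (congrArg norm (hjet ξ h x hx)).le.trans (norm_sub_le _ _)
    refine ⟨le_trans ?_ h1, le_trans ?_ h1⟩
    · rw [← jet_idx00 eulerCover (u - v)]
      exact norm_le_pi_norm _ _
    · rw [← jet_idx10 eulerCover (u - v)]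
      exact norm_le_pi_norm _ _
  · intro ξ₀ R δ p m μ A A' hξ₀ hR hδ hδ1 hp hm hA hA' hμ hb hsmall ξ hξ' x hx
    have hxR : ‖x‖ < R := by linarith
    have hxRs : ‖x‖ < Rs := hxR.trans_le hR
    set D := A / δ ^ 2 + A' / δ
    have hD : 0 ≤ D := by positivity
    set M := C * μ * D
    have hM : 0 ≤ M := by positivity
    set c₁ := dz (idx10 n) F (0, x, 0)
    set c₀ := dz (idx00 n) F (0, x, 0)
    set pt : ℝ → ℂ × (Fin n → ℂ) := fun ξ => ((ξ : ℂ) + φ * Complex.I, x)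
    have hder : ∀ f : ℂ × (Fin n → ℂ) → ℂ, ∀ ξ : ℝ, AnalyticAt ℂ f (pt ξ) →
        HasDerivAt (fun ξ => f (pt ξ)) (eulerCover f (pt ξ)) ξ := by
      intro f ξ hf
      have h1 := hasDerivAt_fst hf.differentiableAt
      rw [← eulerCover_eq hf] at h1
      exact (HasDerivAt.comp_add_const (ξ : ℂ) (φ * Complex.I) h1).comp_ofReal
    -- The defect of w in the linear equation; being a difference of values of F minus the linear
    -- part, it is bounded by the Lipschitz estimate.
    set g : ℝ → ℂ := fun ξ => eulerCover (eulerCover (u - v)) (pt ξ) -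
      (c₁ * eulerCover (u - v) (pt ξ) + c₀ * (u - v) (pt ξ))
    have hq : 0 ≤ p + m := by positivity
    have hg : ∀ ξ ≤ ξ₀, ‖g ξ‖ ≤ M * Real.exp ((p + m) * ξ) := by
      intro ξ hξ'
      have hs := hξ'.trans hξ₀
      obtain ⟨a1, a2, a3⟩ := hsmall ξ hξ' x hx
      have hnexp : ‖Complex.exp (pt ξ).1‖ = Real.exp ξ := by
        rw [Complex.norm_exp]; simp [pt]
      have := hlip (Complex.exp (pt ξ).1) x (jet eulerCover u (pt ξ)) (jet eulerCover v (pt ξ))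
        (by rw [hnexp]; exact (hξ ξ hs).2) (hxRs.trans_le ((min_le_right _ _).trans (min_le_left _ _)))
        a1 a2
      rw [← hjet ξ hs x hxRs, jet_idx00, jet_idx10] at this
      have e1 := (hu.2 _ (hmem ξ hs x hxRs)).2
      have e2 := (hv.2 _ (hmem ξ hs x hxRs)).2
      have e3 := (isLocalOp_eulerCover.iterate 2).sub (hua ξ hs x hxRs) (hva ξ hs x hxRs)
      rw [e1, e2] at e3
      have e4 : eulerCover (eulerCover (u - v)) (pt ξ) = _ := e3
      simp only [g]
      rw [e4]
      refine this.trans ?_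
      rw [hnexp, add_mul, Real.exp_add]
      calc _ ≤ C * (μ * Real.exp (m * ξ)) * (D * Real.exp (p * ξ)) := by
            gcongr
            exact hjw hξ₀ hR hδ hδ1 hA hA' hb ξ hξ' x hx
        _ = _ := by simp only [M]; ring
    set B := (A + A') * Real.exp (p * ξ₀)
    have hE : ∀ ξ ≤ ξ₀, Real.exp (p * ξ) ≤ Real.exp (p * ξ₀) := fun ξ h =>
      Real.exp_le_exp.2 (mul_le_mul_of_nonneg_left h hp)
    have key := norm_le_of_hasDerivAt_second_order (κ := κ) (q := p + m) (M := M) (ξ₀ := ξ₀) (B := B)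
      (L := L) hκ hq
      (hroots x (mem_ball_zero_iff.2 (hxRs.trans_le ((min_le_right _ _).trans (min_le_right _ _)))))
      (y := fun ξ => (u - v) (pt ξ)) (y' := fun ξ => eulerCover (u - v) (pt ξ)) (g := g)
      (fun ξ h => hder _ ξ (hwa ξ (h.trans hξ₀) x hxRs))
      (fun ξ h => (hder _ ξ (analyticAt_eulerCover (hwa ξ (h.trans hξ₀) x hxRs))).congr_deriv
        (by simp only [g, c₁, c₀]; ring))
      (fun ξ h => ((hb ξ h x hxR).1).trans (mul_le_mul (by linarith) (hE ξ h) (Real.exp_pos _).le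
        (by positivity)))
      (fun ξ h => ((hb ξ h x hxR).2).trans (mul_le_mul (by linarith) (hE ξ h) (Real.exp_pos _).le
        (by positivity))) hg hξ'
    have hq1 : 0 < p + m + 1 := by linarith
    have hqκ : M / (p + m + κ) ≤ κ' * (M / (p + m + 1)) := by
      rw [show κ' * (M / (p + m + 1)) = M / (min κ 1 * (p + m + 1)) by simp only [κ']; field_simp]
      gcongr
      have h1 : min κ 1 * (p + m) ≤ 1 * (p + m) := by gcongr; exact min_le_right _ _
      linarith [min_le_left κ 1]
    have hqκ2 : M / (p + m + κ) ^ 2 ≤ κ' ^ 2 * (M / (p + m + 1) ^ 2) := by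
      rw [show κ' ^ 2 * (M / (p + m + 1) ^ 2) = M / (min κ 1 * (p + m + 1)) ^ 2 by
        simp only [κ']; field_simp]
      gcongr
      have h1 : min κ 1 * (p + m) ≤ 1 * (p + m) := by gcongr; exact min_le_right _ _
      linarith [min_le_left κ 1]
    have hM1 : M / (p + m + 1) ^ 2 ≤ M / (p + m + 1) := by
      gcongr
      nlinarith
    have hM0 : 0 ≤ M / (p + m + 1) ^ 2 := by positivity
    have hM0' : 0 ≤ M / (p + m + 1) := by positivity
    have hκ2 : κ' ≤ κ' ^ 2 := by nlinarith
    constructor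
    · refine key.1.trans (mul_le_mul_of_nonneg_right ?_ (Real.exp_pos _).le)
      rw [show K * μ * D / (p + m + 1) ^ 2 = (L + 1) * (κ' ^ 2 * (M / (p + m + 1) ^ 2)) by
        simp only [K, M]; ring]
      have : 0 ≤ L * (κ' ^ 2 * (M / (p + m + 1) ^ 2)) := by positivity
      linarith
    · refine key.2.trans (mul_le_mul_of_nonneg_right ?_ (Real.exp_pos _).le)
      rw [show K * μ * D / (p + m + 1) = L * (κ' ^ 2 * (M / (p + m + 1))) +
        κ' ^ 2 * (M / (p + m + 1)) by simp only [K, M]; ring]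
      refine add_le_add (mul_le_mul_of_nonneg_left (hqκ2.trans ?_) hL.le) (hqκ.trans ?_)
      · gcongr
      · gcongr

end RayPair

end Fuchs

namespace Fuchs

/-! ### Bootstrap along a ray: from bounded to small, to O(|t|), to zero -/

section RayUniqueness

variable {n : ℕ} {w w' : ℝ → (Fin n → ℂ) → ℂ} {ju jv jw : ℝ → (Fin n → ℂ) → ℝ} {ξs Rs K η : ℝ}

theorem RayBound.mono {p ξ₀ ξ₁ R R₁ A A' A₁ A₁' : ℝ} (h : RayBound w w' p ξ₀ R A A') (hξ : ξ₁ ≤ ξ₀)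
    (hR : R₁ ≤ R) (hA : A ≤ A₁) (hA' : A' ≤ A₁') : RayBound w w' p ξ₁ R₁ A₁ A₁' := fun ξ h1 x hx =>
  have := h ξ (h1.trans hξ) x (hx.trans_le hR)
  ⟨this.1.trans (by gcongr), this.2.trans (by gcongr)⟩

/-- Here the order 4 in the growth condition is used: with δ = R/4 the jet of w costs 16/R² + 4/R,
and the nonlinear factor is o(R²). -/
theorem IsRayPair.bound_half (h : IsRayPair w w' ju jv jw ξs Rs K η)
    (hJ : ∀ ε > 0, ∃ Rε > 0, ∀ R, 0 < R → R < Rε → ∃ ξR, ∀ ξ ≤ ξR, ∀ x, ‖x‖ < R →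
      Real.exp ξ + ju ξ x + jv ξ x ≤ ε * R ^ 2) {ε : ℝ} (hε : 0 < ε) :
    ∃ Rε > 0, Rε ≤ Rs ∧ ∀ R, 0 < R → R < Rε → ∀ A ≥ 0, ∀ ξ₁ ≤ ξs, RayBound w w' 0 ξ₁ R A A →
      ∃ ξ₂ ≤ ξs, RayBound w w' 0 ξ₂ (R / 2) (ε * A) (ε * A) := by
  have hK := h.K_pos
  have hη := h.η_pos
  -- The 20 bounds 16 + 4R for R ≤ 1; the η/2 keeps both jets in the range admitted by `step`.
  obtain ⟨Rε, hRε, hJ⟩ := hJ (min (ε / (20 * K)) (η / 2)) (by positivity)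
  refine ⟨min Rε Rs, lt_min hRε h.Rs_pos, min_le_right _ _, fun R hR hRR A hA ξ₁ hξ₁ hb => ?_⟩
  have hR1 : R ≤ 1 := hRR.le.trans ((min_le_right _ _).trans h.Rs_le)
  obtain ⟨ξR, hξR⟩ := hJ R hR (hRR.trans_le (min_le_left _ _))
  refine ⟨min ξ₁ ξR, (min_le_left _ _).trans hξ₁, ?_⟩
  have key := h.step (ξ₀ := min ξ₁ ξR) (R := R) (δ := R / 4) (p := 0) (m := 0)
    (μ := ε / (20 * K) * R ^ 2) (A := A) (A' := A) ((min_le_left _ _).trans hξ₁)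
    (hRR.le.trans (min_le_right _ _)) (by positivity) (by linarith) le_rfl le_rfl hA hA
    (by positivity) (hb.mono (min_le_left _ _) le_rfl le_rfl le_rfl) ?_
  · have e : K * (ε / (20 * K) * R ^ 2) * (A / (R / 4) ^ 2 + A / (R / 4)) ≤ ε * A := by
      have : K * (ε / (20 * K) * R ^ 2) * (A / (R / 4) ^ 2 + A / (R / 4)) =
          ε * A * ((16 + 4 * R) / 20) := by
        field_simp; ring
      rw [this]
      refine mul_le_of_le_one_right (by positivity) ?_
      linarith
    rw [show (0 : ℝ) + 0 = 0 by ring] at key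
    exact key.mono le_rfl (by linarith) (by simpa using e) (by simpa using e)
  · intro ξ hξ x hx
    have h1 := hξR ξ (hξ.trans (min_le_right _ _)) x (by linarith)
    have h2 := h.ju_nonneg ξ x
    have h3 := h.jv_nonneg ξ x
    have h4 := Real.exp_pos ξ
    have h5 : min (ε / (20 * K)) (η / 2) * R ^ 2 ≤ η / 2 := by
      have hR2 : R ^ 2 ≤ 1 := pow_le_one₀ hR.le hR1
      have := mul_le_of_le_one_right (by positivity : 0 ≤ min (ε / (20 * K)) (η / 2)) hR2
      exact this.trans (min_le_right _ _)
    refine ⟨by linarith, by linarith, h1.trans ?_⟩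
    rw [zero_mul, Real.exp_zero, mul_one]
    gcongr
    exact min_le_left _ _

/-- Repeated halving makes w tiny on tiny polydiscs, for t small depending on their size. On the
complex line through x, `norm_apply_one_le` combines this with the bound 1 on the fixed polydisc. -/
theorem IsRayPair.exists_small (h : IsRayPair w w' ju jv jw ξs Rs K η)
    (hJ : ∀ ε > 0, ∃ Rε > 0, ∀ R, 0 < R → R < Rε → ∃ ξR, ∀ ξ ≤ ξR, ∀ x, ‖x‖ < R →
      Real.exp ξ + ju ξ x + jv ξ x ≤ ε * R ^ 2) {R₁ ξ₁ : ℝ} (hR₁ : 0 < R₁) (hR₁s : R₁ ≤ Rs)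
    (hξ₁ : ξ₁ ≤ ξs) (hb : RayBound w w' 0 ξ₁ R₁ 1 1) {τ : ℝ} (hτ : 0 < τ) :
    ∃ ξ₂ ≤ ξs, RayBound w w' 0 ξ₂ (R₁ / 4) τ τ := by
  have hRs1 := h.Rs_le
  obtain ⟨J, hJτ⟩ : ∃ J : ℕ, 2 * (1 / 2 : ℝ) ^ J ≤ τ / 2 := by
    obtain ⟨J, hJ⟩ := exists_pow_lt_of_lt_one (show (0 : ℝ) < τ / 4 by positivity)
      (show (1 / 2 : ℝ) < 1 by norm_num)
    exact ⟨J, by linarith⟩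
  -- After k halvings the bound ε^k is divided by (R'/2^k)^J; this choice of ε leaves 2^{-k}/R'^J,
  -- which tends to 0 for fixed J.
  obtain ⟨Rε, hRε, -, hhalf⟩ := h.bound_half hJ (ε := (1 / 2) ^ (J + 1)) (by positivity)
  set R' := min R₁ (Rε / 2)
  have hR' : 0 < R' := by positivity
  have hR'1 : R' ≤ 1 := (min_le_left _ _).trans (hR₁s.trans hRs1)
  have hiter : ∀ k : ℕ, ∃ ξ₂ ≤ ξs, RayBound w w' 0 ξ₂ (R' / 2 ^ k) (((1 / 2) ^ (J + 1)) ^ k)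
      (((1 / 2) ^ (J + 1)) ^ k) := by
    intro k
    induction k with
    | zero => exact ⟨ξ₁, hξ₁, by simpa using hb.mono le_rfl (min_le_left _ _) le_rfl le_rfl⟩
    | succ k ih =>
      obtain ⟨ξ₂, h2, hb2⟩ := ih
      have hlt : R' / 2 ^ k < Rε := by
        have h1 : R' / 2 ^ k ≤ R' := div_le_self hR'.le (one_le_pow₀ one_le_two)
        have h2 : R' ≤ Rε / 2 := min_le_right _ _
        linarith
      obtain ⟨ξ₃, h3, hb3⟩ := hhalf _ (by positivity) hlt _ (by positivity) ξ₂ h2 hb2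
      refine ⟨ξ₃, h3, ?_⟩
      rwa [pow_succ' ((1 / 2 : ℝ) ^ (J + 1)) k, pow_succ 2 k, ← div_div]
  obtain ⟨k, hk⟩ : ∃ k : ℕ, J / R' ^ J * (1 / 2 : ℝ) ^ k ≤ τ / 2 := by
    obtain ⟨k, hk⟩ := exists_pow_lt_of_lt_one
      (show (0 : ℝ) < τ / 2 / (J / R' ^ J + 1) by positivity) (show (1 / 2 : ℝ) < 1 by norm_num)
    refine ⟨k, ?_⟩
    rw [lt_div_iff₀ (by positivity)] at hk
    have : (0 : ℝ) < (1 / 2) ^ k := by positivity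
    nlinarith
  obtain ⟨ξ₂, hξ₂, hb2⟩ := hiter k
  refine ⟨min ξ₁ ξ₂, (min_le_left _ _).trans hξ₁, fun ξ hξ x hx => ?_⟩
  have main : ∀ f : ℝ → (Fin n → ℂ) → ℂ,
      DifferentiableOn ℂ (fun ζ : ℂ => f ξ (ζ • x)) {ζ | ‖ζ • x‖ < Rs} →
      (∀ y, ‖y‖ < R₁ → ‖f ξ y‖ ≤ 1) → (∀ y, ‖y‖ < R' / 2 ^ k → ‖f ξ y‖ ≤ ((1 / 2) ^ (J + 1)) ^ k) →
      ‖f ξ x‖ ≤ τ := by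
    intro f hd h1 h2
    have hsub : Metric.ball (0 : ℂ) 3 ⊆ {ζ | ‖ζ • x‖ < Rs} := fun ζ hζ => by
      rw [mem_ball_zero_iff] at hζ
      rw [Set.mem_ofPred_eq, norm_smul]
      nlinarith [norm_nonneg x, norm_nonneg ζ]
    have := norm_apply_one_le (h := fun ζ : ℂ => f ξ (ζ • x)) (ρ := R' / 2 ^ k) (hd.mono hsub)
      (by positivity) ((div_le_self hR'.le (one_le_pow₀ one_le_two)).trans hR'1)
      (fun z hz => h2 _ (by
        rw [norm_smul]
        have hp : 0 < R' / 2 ^ k := by positivity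
        have hx1 : ‖x‖ < 1 := by linarith
        calc ‖z‖ * ‖x‖ ≤ R' / 2 ^ k * ‖x‖ := by gcongr
          _ < R' / 2 ^ k * 1 := by gcongr
          _ = _ := mul_one _))
      (fun z hz => h1 _ (by rw [norm_smul]; nlinarith [norm_nonneg x, norm_nonneg z])) J
    simp only [one_smul] at this
    refine this.trans ?_
    have e : (J : ℝ) * (((1 / 2) ^ (J + 1)) ^ k / (R' / 2 ^ k) ^ J) = J / R' ^ J * (1 / 2) ^ k := by
      have : ((1 / 2 : ℝ) ^ (J + 1)) ^ k = (1 / 2) ^ k * 1 / (2 ^ k) ^ J := by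
        rw [← pow_mul, ← pow_mul, add_mul, pow_add, one_mul, mul_comm J k]
        simp; ring
      rw [this, div_pow R' (2 ^ k) J]
      field_simp
    linarith
  have hd := h.diff ξ (hξ.trans ((min_le_left _ _).trans hξ₁)) x
  have hb1 := hb ξ (hξ.trans (min_le_left _ _))
  have hb2 := hb2 ξ (hξ.trans (min_le_right _ _))
  simp only [zero_mul, Real.exp_zero, mul_one] at hb1 hb2 ⊢
  exact ⟨main w hd.1 (fun y hy => (hb1 y hy).1) (fun y hy => (hb2 y hy).1),
    main w' hd.2 (fun y hy => (hb1 y hy).2) (fun y hy => (hb2 y hy).2)⟩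

/-- The nonlinearity feeds back. If |w| ≤ τ16^{-k}, shrinking by about 2^{-k} costs 4^k, so the jet
of w, and with it the whole nonlinear factor, is at most a small multiple of 4^{-k}. In `step` this
cancels the next 4^k, and the small constant supplies the further 1/16. -/
theorem IsRayPair.exists_linear_bound (h : IsRayPair w w' ju jv jw ξs Rs K η) {R₂ C : ℝ}
    (hR₂ : 0 < R₂) (hR₂s : R₂ ≤ Rs) (hC : 0 ≤ C) {ξv : ℝ}
    (hv : ∀ ξ ≤ ξv, ∀ x, ‖x‖ < R₂ → jv ξ x ≤ C * Real.exp ξ)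
    (hsmall : ∀ τ > 0, ∃ ξ₂ ≤ ξs, RayBound w w' 0 ξ₂ R₂ τ τ) :
    ∃ A ≥ 0, ∃ ξ₁ ≤ ξs, ξ₁ ≤ ξv ∧ RayBound w w' 1 ξ₁ (R₂ / 2) A A := by
  have hK := h.K_pos
  have hη := h.η_pos
  have hRs1 := h.Rs_le
  -- With δ = R₂/2^{k+3} as below, δ⁻² + δ⁻¹ ≤ 2δ⁻² = D·4^k.
  set D := 128 / R₂ ^ 2
  have hD : 0 < D := by positivity
  set G := min (η / 2) (1 / (16 * K * D))
  have hG : 0 < G := by positivity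
  set τ := G / (2 * D)
  have hτ : 0 < τ := by positivity
  obtain ⟨ξ₂, hξ₂, hb₂⟩ := hsmall τ hτ
  set ξ₀ := min (min ξ₂ ξv) (Real.log (G / (2 * (1 + 2 * C))))
  have hξ₀₂ : ξ₀ ≤ ξ₂ := (min_le_left _ _).trans (min_le_left _ _)
  have hξ₀v : ξ₀ ≤ ξv := (min_le_left _ _).trans (min_le_right _ _)
  have hξ₀G : (1 + 2 * C) * Real.exp ξ₀ ≤ G / 2 := by
    have : Real.exp ξ₀ ≤ G / (2 * (1 + 2 * C)) := by
      rw [← Real.exp_log (show 0 < G / (2 * (1 + 2 * C)) by positivity)]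
      exact Real.exp_le_exp.2 (min_le_right _ _)
    rw [le_div_iff₀ (by positivity)] at this
    linarith
  have hDτ : D * τ = G / 2 := by simp only [τ]; field_simp
  -- Lowering ξ by log 16 divides |t| by 16, the rate aimed at for w: the bound τ16^{-k} for |t| ≤
  -- e^{ξ₀}16^{-k} is a linear bound in |t|.
  set ℓ := Real.log 16
  have hℓ : 0 < ℓ := Real.log_pos (by norm_num)
  have hexpℓ : ∀ k : ℕ, Real.exp (-(k * ℓ)) = (1 / 16) ^ k := fun k => by
    rw [Real.exp_neg, mul_comm, Real.exp_mul, Real.exp_log (by norm_num)]; simp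
  have hiter : ∀ k : ℕ, RayBound w w' 0 (ξ₀ - k * ℓ) (R₂ / 2 + R₂ / 2 ^ (k + 1))
      (τ * (1 / 16) ^ k) (τ * (1 / 16) ^ k) := by
    intro k
    induction k with
    | zero => exact hb₂.mono (by simpa using hξ₀₂) (by norm_num) (by simp) (by simp)
    | succ k ih =>
      set δ := R₂ / 2 ^ (k + 3)
      have hδ : 0 < δ := by positivity
      have hδ1 : δ ≤ 1 := (div_le_self hR₂.le (one_le_pow₀ one_le_two)).trans (hR₂s.trans hRs1)
      set a := τ * (1 / 16) ^ k
      have ha : 0 < a := by positivity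
      have hRk : R₂ / 2 + R₂ / 2 ^ (k + 1) ≤ Rs := by
        have : R₂ / 2 ^ (k + 1) ≤ R₂ / 2 := by
          gcongr; exact le_self_pow₀ one_le_two (by omega)
        linarith
      have hRδ : R₂ / 2 + R₂ / 2 ^ (k + 1) - 2 * δ = R₂ / 2 + R₂ / 2 ^ (k + 1 + 1) := by
        simp only [δ]; field_simp; ring
      have hkℓ : 0 ≤ k * ℓ := by positivity
      have hξk : ξ₀ - k * ℓ ≤ ξ₀ := by linarith
      have hξks : ξ₀ - k * ℓ ≤ ξs := by linarith
      have hδa : a / δ ^ 2 + a / δ ≤ D * 4 ^ k * a := by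
        have h1 : a / δ ≤ a / δ ^ 2 := by
          gcongr; nlinarith
        have h2 : D * 4 ^ k * a = a / δ ^ 2 + a / δ ^ 2 := by
          have : (4 : ℝ) ^ k = 2 ^ k * 2 ^ k := by rw [← mul_pow]; norm_num
          simp only [δ, D, this]
          field_simp; ring
        linarith
      have hda : D * 4 ^ k * a = D * τ * (1 / 4) ^ k := by
        simp only [a]
        have : (1 / 4 : ℝ) ^ k = 4 ^ k * (1 / 16) ^ k := by rw [← mul_pow]; norm_num
        rw [this]; ring
      have key := h.step (ξ₀ := ξ₀ - k * ℓ) (m := 0) (μ := G * (1 / 4) ^ k) hξks hRk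
        hδ hδ1 le_rfl le_rfl ha.le ha.le (by positivity) ih ?_
      · have e : K * (G * (1 / 4) ^ k) * (a / δ ^ 2 + a / δ) ≤ τ * (1 / 16) ^ (k + 1) := by
          calc _ ≤ K * (G * (1 / 4) ^ k) * (D * 4 ^ k * a) := by gcongr
            _ = (16 * K * D * G) * (τ * (1 / 16) ^ (k + 1)) := by
              have : (1 / 4 : ℝ) ^ k * 4 ^ k = 1 := by rw [← mul_pow]; norm_num
              simp only [a]
              rw [pow_succ]
              linear_combination (K * G * D * τ * (1 / 16) ^ k) * this
            _ ≤ 1 * (τ * (1 / 16) ^ (k + 1)) := by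
              gcongr
              have : G ≤ 1 / (16 * K * D) := min_le_right _ _
              rw [le_div_iff₀ (by positivity)] at this
              linarith
            _ = _ := one_mul _
        rw [hRδ, show (0 : ℝ) + 0 = 0 by ring] at key
        exact key.mono (by push_cast; nlinarith) le_rfl (by simpa using e) (by simpa using e)
      · intro ξ hξ x hx
        have hx0 : ‖x‖ < R₂ := by
          have : R₂ / 2 ^ (k + 1) ≤ R₂ / 2 := by
            gcongr; exact le_self_pow₀ one_le_two (by omega)
          linarith
        have h1 := h.jet_le hξks hRk hδ hδ1 ha.le ha.le ih ξ hξ x hx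
        rw [zero_mul, Real.exp_zero, mul_one] at h1
        have h2 := h.ju_le ξ (hξ.trans hξks) x (hx0.trans_le hR₂s)
        have h3 := hv ξ ((hξ.trans hξk).trans hξ₀v) x hx0
        have h4 : Real.exp ξ ≤ Real.exp ξ₀ * (1 / 16) ^ k := by
          rw [← hexpℓ, ← Real.exp_add]
          exact Real.exp_le_exp.2 (by linarith)
        have h5 : (1 / 16 : ℝ) ^ k ≤ (1 / 4) ^ k := by gcongr; norm_num
        have h6 : (1 + 2 * C) * Real.exp ξ ≤ G / 2 * (1 / 4) ^ k := by
          calc _ ≤ (1 + 2 * C) * (Real.exp ξ₀ * (1 / 4) ^ k) := by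
                gcongr; exact h4.trans (by gcongr)
            _ = (1 + 2 * C) * Real.exp ξ₀ * (1 / 4) ^ k := by ring
            _ ≤ _ := by gcongr
        have h7 : jw ξ x ≤ G / 2 * (1 / 4) ^ k := by
          rw [← hDτ, ← hda]; exact h1.trans hδa
        have h8 : Real.exp ξ + ju ξ x + jv ξ x ≤ G * (1 / 4) ^ k := by linarith
        have h9 : G * (1 / 4 : ℝ) ^ k ≤ η / 2 :=
          (mul_le_of_le_one_right hG.le (pow_le_one₀ (by norm_num) (by norm_num))).trans
            (min_le_left _ _)
        have := h.ju_nonneg ξ x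
        have := h.jv_nonneg ξ x
        have := Real.exp_pos ξ
        refine ⟨by linarith, by linarith, ?_⟩
        rwa [zero_mul, Real.exp_zero, mul_one]
  refine ⟨16 * τ * Real.exp (-ξ₀), by positivity, ξ₀, hξ₀₂.trans hξ₂, hξ₀v, fun ξ hξ x hx => ?_⟩
  -- The last stage that still contains ξ; rounding down costs at most one factor 16.
  set k := ⌊(ξ₀ - ξ) / ℓ⌋₊
  have hk1 : k * ℓ ≤ ξ₀ - ξ := by
    rw [← le_div_iff₀ hℓ]; exact Nat.floor_le (div_nonneg (by linarith) hℓ.le)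
  have hk2 : ξ₀ - ξ < (k + 1) * ℓ := by
    rw [← div_lt_iff₀ hℓ]; exact Nat.lt_floor_add_one _
  have h1 := hiter k ξ (by linarith) x (by
    have : 0 < R₂ / 2 ^ (k + 1) := by positivity
    linarith)
  have h2 : τ * (1 / 16) ^ k ≤ 16 * τ * Real.exp (-ξ₀) * Real.exp (1 * ξ) := by
    have h3 : Real.exp (-(k * ℓ)) ≤ 16 * (Real.exp (-ξ₀) * Real.exp (1 * ξ)) := by
      rw [← Real.exp_log (show (0 : ℝ) < 16 by norm_num), ← Real.exp_add, ← Real.exp_add]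
      refine Real.exp_le_exp.2 ?_
      change _ ≤ ℓ + _
      linarith
    rw [hexpℓ] at h3
    calc τ * (1 / 16) ^ k ≤ τ * (16 * (Real.exp (-ξ₀) * Real.exp (1 * ξ))) := by gcongr
      _ = _ := by ring
  rw [zero_mul, Real.exp_zero, mul_one] at h1
  exact ⟨h1.1.trans h2, h1.2.trans h2⟩

/-- Now the nonlinear factor is at most μ|t|, so each step raises the exponent of |t| by 1.
Splitting a fixed loss of radius into P equal parts and letting P → ∞ forces w = 0 where |t| is
below a threshold independent of P. -/
theorem IsRayPair.eq_zero (h : IsRayPair w w' ju jv jw ξs Rs K η) {R₃ C A : ℝ}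
    (hR₃ : 0 < R₃) (hR₃s : R₃ ≤ Rs) (hC : 0 ≤ C) (hA : 0 ≤ A) {ξ₁ : ℝ} (hξ₁ : ξ₁ ≤ ξs)
    (hv : ∀ ξ ≤ ξ₁, ∀ x, ‖x‖ < R₃ → jv ξ x ≤ C * Real.exp ξ)
    (hb : RayBound w w' 1 ξ₁ R₃ A A) :
    ∃ ξ₂ ≤ ξs, ∀ ξ ≤ ξ₂, ∀ x, ‖x‖ < R₃ / 4 → w ξ x = 0 := by
  have hK := h.K_pos
  have hη := h.η_pos
  have hRs1 := h.Rs_le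
  set R := R₃ / 2
  have hR : 0 < R := by positivity
  have hR1 : R ≤ 1 := by simp only [R]; linarith
  set μ := 1 + 2 * C + (A / (R₃ / 4) ^ 2 + A / (R₃ / 4))
  have hμ : 0 < μ := by positivity
  have hjets : ∀ ξ ≤ ξ₁, ∀ x, ‖x‖ < R → Real.exp ξ + ju ξ x + jv ξ x ≤ μ * Real.exp ξ := by
    intro ξ hξ x hx
    have hx3 : ‖x‖ < R₃ := by simp only [R] at hx; linarith
    have h1 := h.jet_le hξ₁ hR₃s (by positivity : 0 < R₃ / 4) (by linarith) hA hA hb ξ hξ x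
      (by simp only [R] at hx; linarith)
    have h2 := h.ju_le ξ (hξ.trans hξ₁) x (hx3.trans_le hR₃s)
    have h3 := hv ξ hξ x hx3
    rw [one_mul] at h1
    simp only [μ]
    linarith
  -- With δ = R/(4P), Kμ·2δ⁻² = QP².
  set Q := 32 * K * μ / R ^ 2
  have hQ : 0 < Q := by positivity
  set ρ := min (η / (2 * μ)) (1 / (2 * (Q * Real.exp 2)))
  have hρ : 0 < ρ := by positivity
  set ξ₂ := min ξ₁ (Real.log ρ)
  have hξ₂ : ξ₂ ≤ ξ₁ := min_le_left _ _
  have hρξ : ∀ ξ ≤ ξ₂, Real.exp ξ ≤ ρ := fun ξ hξ => by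
    rw [← Real.exp_log hρ]
    exact Real.exp_le_exp.2 (hξ.trans (min_le_right _ _))
  have hη' : ∀ ξ ≤ ξ₂, μ * Real.exp ξ < η := fun ξ hξ => by
    have := (hρξ ξ hξ).trans (min_le_left _ _)
    rw [le_div_iff₀ (by positivity)] at this
    linarith
  refine ⟨ξ₂, hξ₂.trans hξ₁, fun ξ hξ x hx => ?_⟩
  -- The bound on w' has one power of j + 1 less, and w' suffers one x-derivative less. Both terms
  -- of the jet are thus at most B/((j+1)δ)², since (j+1)δ ≤ 1, and the squares build up (j!)².
  have hiter : ∀ P : ℕ, 0 < P → ∀ j ≤ P, RayBound w w' (j + 1) ξ₂ (R - 2 * (R / (4 * P)) * j)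
      (A * Q ^ j * P ^ (2 * j) / (j.factorial : ℝ) ^ 2 / (j + 1) ^ 2)
      (A * Q ^ j * P ^ (2 * j) / (j.factorial : ℝ) ^ 2 / (j + 1)) := by
    intro P hP j
    have hP' : (1 : ℝ) ≤ P := by exact_mod_cast hP
    induction j with
    | zero =>
      intro _
      simpa using hb.mono hξ₂ (show R - 2 * (R / (4 * P)) * 0 ≤ R₃ by simp [R]; linarith)
        le_rfl le_rfl
    | succ j ih =>
      intro hj
      have ih := ih (by omega)
      set B := A * Q ^ j * P ^ (2 * j) / (j.factorial : ℝ) ^ 2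
      have hB : 0 ≤ B := by positivity
      set δ := R / (4 * P)
      have hδ : 0 < δ := by positivity
      have hδ1 : δ ≤ 1 := (div_le_self hR.le (by linarith)).trans hR1
      have hjP : (j : ℝ) + 1 ≤ P := by exact_mod_cast hj
      have hjδ : (j + 1) * δ ≤ 1 := by
        simp only [δ]
        rw [mul_div_assoc', div_le_one (by positivity)]
        nlinarith
      have hδj : 0 ≤ 2 * δ * j := by positivity
      have hRR : R - 2 * δ * j ≤ R := by linarith
      have key := h.step (ξ₀ := ξ₂) (m := 1) (μ := μ) (hξ₂.trans hξ₁)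
        (hRR.trans (by simp only [R]; linarith)) hδ hδ1 (by positivity) zero_le_one (by positivity)
        (by positivity) hμ.le ih ?_
      · have e0 : B / (j + 1) ^ 2 / δ ^ 2 + B / (j + 1) / δ ≤ 2 * (B / ((j + 1) * δ) ^ 2) := by
          have h1 : B / ((j + 1) * δ) ≤ B / ((j + 1) * δ) ^ 2 := by
            gcongr
            have : 0 < (j + 1) * δ := by positivity
            nlinarith
          have h2 : B / (j + 1) ^ 2 / δ ^ 2 = B / ((j + 1) * δ) ^ 2 := by rw [div_div, mul_pow]
          have h3 : B / (j + 1) / δ = B / ((j + 1) * δ) := div_div _ _ _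
          linarith
        have e1 : K * μ * (B / (j + 1) ^ 2 / δ ^ 2 + B / (j + 1) / δ) ≤
            A * Q ^ (j + 1) * P ^ (2 * (j + 1)) / ((j + 1).factorial : ℝ) ^ 2 := by
          refine (mul_le_mul_of_nonneg_left e0 (by positivity)).trans_eq ?_
          have hQd : K * μ * 2 / δ ^ 2 = Q * P ^ 2 := by
            simp only [Q, δ, div_pow, mul_pow]
            field_simp
            norm_num
          calc K * μ * (2 * (B / ((j + 1) * δ) ^ 2)) = K * μ * 2 / δ ^ 2 * B / (j + 1) ^ 2 := by
                rw [mul_pow]; field_simp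
            _ = _ := by
                rw [hQd]
                simp only [B, Nat.factorial_succ]
                push_cast
                field_simp
                ring
        have hj0 : (0 : ℝ) ≤ j := by positivity
        have e2 : 0 ≤ A * Q ^ (j + 1) * P ^ (2 * (j + 1)) / ((j + 1).factorial : ℝ) ^ 2 := by
          positivity
        push_cast
        refine key.mono le_rfl (by linarith) ?_ ?_
        · gcongr
          linarith
        · gcongr
          linarith
      · intro ξ hξ x hx
        have hx' : ‖x‖ < R := by linarith
        have h1 := hjets ξ (hξ.trans hξ₂) x hx'
        have h2 := hη' ξ hξ
        have := h.ju_nonneg ξ x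
        have := h.jv_nonneg ξ x
        have := Real.exp_pos ξ
        refine ⟨by linarith, by linarith, by rwa [one_mul]⟩
  have hbound : ∀ P : ℕ, 0 < P → ‖w ξ x‖ ≤ A * Real.exp ξ * (1 / 2) ^ P := by
    intro P hP
    have hP' : (1 : ℝ) ≤ P := by exact_mod_cast hP
    have h1 := (hiter P hP P le_rfl ξ hξ x (by
      have : R - 2 * (R / (4 * P)) * P = R / 2 := by field_simp; ring
      rw [this]; simp only [R]; linarith)).1
    refine h1.trans ?_
    -- Hence P^{2P}/(P!)² ≤ e^{2P}, and the accumulated loss is only geometric in P.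
    have hf : (P : ℝ) ^ P / P.factorial ≤ Real.exp P :=
      Real.pow_div_factorial_le_exp _ (by positivity) P
    have h2 : A * Q ^ P * P ^ (2 * P) / (P.factorial : ℝ) ^ 2 / (P + 1) ^ 2 ≤
        A * Q ^ P * (Real.exp 2) ^ P := by
      calc _ ≤ A * Q ^ P * P ^ (2 * P) / (P.factorial : ℝ) ^ 2 :=
            div_le_self (by positivity) (one_le_pow₀ (by linarith))
        _ = A * Q ^ P * ((P : ℝ) ^ P / P.factorial) ^ 2 := by
            rw [div_pow ((P : ℝ) ^ P), ← pow_mul, mul_comm P 2]; ring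
        _ ≤ A * Q ^ P * (Real.exp P) ^ 2 := by gcongr
        _ = _ := by
            rw [← Real.exp_nat_mul, ← Real.exp_nat_mul]; push_cast; ring_nf
    have h3 : Real.exp ((P + 1) * ξ) = Real.exp ξ * Real.exp ξ ^ P := by
      rw [← Real.exp_nat_mul, ← Real.exp_add]; ring_nf
    rw [h3]
    calc _ ≤ A * Q ^ P * (Real.exp 2) ^ P * (Real.exp ξ * Real.exp ξ ^ P) := by gcongr
      _ = A * Real.exp ξ * (Q * Real.exp 2 * Real.exp ξ) ^ P := by
          rw [mul_pow, mul_pow]; ring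
      _ ≤ _ := by
          gcongr
          have := (hρξ ξ hξ).trans (min_le_right _ _)
          rw [le_div_iff₀ (by positivity)] at this
          linarith
  have hlim : Tendsto (fun P : ℕ => A * Real.exp ξ * (1 / 2 : ℝ) ^ P) atTop (𝓝 0) := by
    simpa using (tendsto_pow_atTop_nhds_zero_of_lt_one (by norm_num : (0 : ℝ) ≤ 1 / 2)
      (by norm_num)).const_mul (A * Real.exp ξ)
  have := ge_of_tendsto hlim ((eventually_gt_atTop 0).mono hbound)
  exact norm_le_zero_iff.1 this

end RayUniqueness

end Fuchs

namespace Fuchs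

/-! ### From the ray to the sector, and uniqueness of the regular germ -/

section Uniqueness

variable {n : ℕ} {Δ : Set (JetSpace n)} {F : JetSpace n → ℂ}

/-- The roles are asymmetric: the jet of v is O(|t|), that of u is only o(R²) on D_R as t → 0. The
first is stronger than the second, so u may also be a lifted regular solution. -/
theorem eq_on_ray (hF : AnalyticAt ℂ F (0, 0, 0))
    (hA3 : ∀ᶠ x in 𝓝 (0 : Fin n → ℂ), ∀ q : Lam n, 0 < ∑ j, q.1.2 j → dz q F (0, x, 0) = 0)
    (hexp : ∀ lam : ℂ, IsCharExponent F 0 lam → lam.re < 0) {θ₁ θ₂ φ r₀ R₀ : ℝ} (hr₀ : 0 < r₀)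
    (hR₀ : 0 < R₀) (hφ₁ : θ₁ < φ) (hφ₂ : φ < θ₂) {u v : ℂ × (Fin n → ℂ) → ℂ}
    (hu : IsSectorialSolution Δ F θ₁ θ₂ r₀ R₀ u) (hv : IsSectorialSolution Δ F θ₁ θ₂ r₀ R₀ v)
    (hJ : ∀ ε > 0, ∃ Rε > 0, ∀ R, 0 < R → R < Rε → ∃ ξR : ℝ, ∀ ξ ≤ ξR, ∀ x, ‖x‖ < R →
      ‖jet eulerCover u ((ξ : ℂ) + φ * Complex.I, x)‖ ≤ ε * R ^ 2)
    {C Rv ξv : ℝ} (hC : 0 ≤ C) (hRv : 0 < Rv) (hlin : ∀ ξ ≤ ξv, ∀ x, ‖x‖ < Rv →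
      ‖jet eulerCover v ((ξ : ℂ) + φ * Complex.I, x)‖ ≤ C * Real.exp ξ) :
    ∃ δ > 0, ∃ ξ₁ : ℝ, ∀ ξ ≤ ξ₁, ∀ x, ‖x‖ < δ →
      u ((ξ : ℂ) + φ * Complex.I, x) = v ((ξ : ℂ) + φ * Complex.I, x) := by
  obtain ⟨ξs, Rs, K, η, -, -, h⟩ := exists_isRayPair hF hA3 hexp hr₀ hR₀ hφ₁ hφ₂ hu hv
  have hRs := h.Rs_pos
  have hJ' : ∀ ε > 0, ∃ Rε > 0, ∀ R, 0 < R → R < Rε → ∃ ξR : ℝ, ∀ ξ ≤ ξR, ∀ x, ‖x‖ < R →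
      Real.exp ξ + ‖jet eulerCover u ((ξ : ℂ) + φ * Complex.I, x)‖ +
        ‖jet eulerCover v ((ξ : ℂ) + φ * Complex.I, x)‖ ≤ ε * R ^ 2 := by
    intro ε hε
    obtain ⟨Rε, hRε, hJ⟩ := hJ (ε / 2) (by positivity)
    refine ⟨min Rε Rv, by positivity, fun R hR hRR => ?_⟩
    obtain ⟨ξR, hξR⟩ := hJ R hR (hRR.trans_le (min_le_left _ _))
    have hpos : 0 < ε / 2 * R ^ 2 / (1 + C) := by positivity
    refine ⟨min (min ξR ξv) (Real.log (ε / 2 * R ^ 2 / (1 + C))), fun ξ hξ x hx => ?_⟩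
    have h1 := hξR ξ (hξ.trans ((min_le_left _ _).trans (min_le_left _ _))) x hx
    have h2 := hlin ξ (hξ.trans ((min_le_left _ _).trans (min_le_right _ _))) x
      (hx.trans (hRR.trans_le (min_le_right _ _)))
    have h3 : Real.exp ξ ≤ ε / 2 * R ^ 2 / (1 + C) := by
      rw [← Real.exp_log hpos]; exact Real.exp_le_exp.2 (hξ.trans (min_le_right _ _))
    rw [le_div_iff₀ (by positivity)] at h3
    linarith
  obtain ⟨Rε, hRε, hstart⟩ := hJ' 1 one_pos
  set R₁ := min (min Rs Rv) (Rε / 2)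
  have hR₁ : 0 < R₁ := by positivity
  have hR₁s : R₁ ≤ Rs := (min_le_left _ _).trans (min_le_left _ _)
  have hR₁v : R₁ ≤ Rv := (min_le_left _ _).trans (min_le_right _ _)
  obtain ⟨ξR, hξR⟩ := hstart R₁ hR₁ ((min_le_right _ _).trans_lt (by linarith))
  have hb : RayBound (fun ξ x => (u - v) ((ξ : ℂ) + φ * Complex.I, x))
      (fun ξ x => eulerCover (u - v) ((ξ : ℂ) + φ * Complex.I, x)) 0 (min ξs ξR) R₁ 1 1 := by
    intro ξ hξ x hx
    have h1 := hξR ξ (hξ.trans (min_le_right _ _)) x hx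
    have h2 := h.w_le ξ (hξ.trans (min_le_left _ _)) x (hx.trans_le hR₁s)
    have h3 : R₁ ^ 2 ≤ 1 := pow_le_one₀ hR₁.le (hR₁s.trans h.Rs_le)
    have h4 := Real.exp_pos ξ
    simp only [zero_mul, Real.exp_zero, mul_one]
    exact ⟨h2.1.trans (by linarith), h2.2.trans (by linarith)⟩
  obtain ⟨A, hA, ξ₁, hξ₁, hξ₁v, hb1⟩ := h.exists_linear_bound (R₂ := R₁ / 4) (by positivity)
    (by linarith) hC (fun ξ hξ x hx => hlin ξ hξ x (by linarith))
    (fun τ hτ => h.exists_small hJ' hR₁ hR₁s (min_le_left _ _) hb hτ)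
  obtain ⟨ξ₂, -, h0⟩ := h.eq_zero (R₃ := R₁ / 4 / 2) (by positivity) (by linarith) hC hA hξ₁
    (fun ξ hξ x hx => hlin ξ (hξ.trans hξ₁v) x (by linarith)) hb1
  exact ⟨R₁ / 4 / 2 / 4, by positivity, ξ₂, fun ξ hξ x hx => sub_eq_zero.1 (h0 ξ hξ x hx)⟩

theorem LimsupCondition.exists_bound {θ₁ θ₂ : ℝ} {u : ℂ × (Fin n → ℂ) → ℂ}
    (h : LimsupCondition θ₁ θ₂ u) {ε : ℝ} (hε : 0 < ε) :
    ∃ Rε > 0, ∀ R, 0 < R → R < Rε → ∃ r > 0, ∀ p ∈ sector θ₁ θ₂ r ×ˢ polydisc n R,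
      ‖u p‖ ≤ ε * R ^ 4 := by
  obtain ⟨l, hl, hlim⟩ := h
  have h1 : ∀ᶠ R in 𝓝[>] (0 : ℝ), l R < ENNReal.ofReal ε :=
    eventually_lt_of_limsup_lt (by rw [hlim]; simpa using hε)
  obtain ⟨Rε, hRε, h2⟩ := mem_nhdsGT_iff_exists_Ioo_subset.1 (hl.and h1)
  refine ⟨Rε, hRε, fun R hR hRR => ?_⟩
  obtain ⟨ht, hlt⟩ := h2 ⟨hR, hRR⟩
  obtain ⟨r, hr, hrpos⟩ := ((ht.eventually_lt_const hlt).and self_mem_nhdsWithin).exists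
  refine ⟨r, hrpos, fun p hp => ?_⟩
  have h3 : ENNReal.ofReal (1 / R ^ 4) * ‖u p‖ₑ ≤ ENNReal.ofReal ε :=
    le_trans (by gcongr; exact le_iSup₂ (f := fun p _ => ‖u p‖ₑ) p hp) hr.le
  rw [← ofReal_norm, ← ENNReal.ofReal_mul (by positivity)] at h3
  have h4 := (ENNReal.ofReal_le_ofReal_iff hε.le).1 h3
  rw [one_div, inv_mul_le_iff₀ (by positivity)] at h4
  linarith

theorem closedBall_subset_sector {θ₁ θ₂ r φ ξ d : ℝ} (hφ₁ : θ₁ < φ - d) (hφ₂ : φ + d < θ₂)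
    (hr : Real.exp (ξ + d) < r) :
    Metric.closedBall ((ξ : ℂ) + φ * Complex.I) d ⊆ sector θ₁ θ₂ r := by
  intro s hs
  rw [mem_closedBall_iff_norm] at hs
  have him := (abs_le.1 ((Complex.abs_im_le_norm _).trans hs))
  have hre := ((le_abs_self _).trans (Complex.abs_re_le_norm _)).trans hs
  simp only [Complex.sub_im, Complex.add_im, Complex.ofReal_im, Complex.mul_im, Complex.ofReal_re,
    Complex.I_im, Complex.I_re, mul_one, mul_zero, zero_add, add_zero] at him
  simp only [Complex.sub_re, Complex.add_re, Complex.ofReal_re, Complex.mul_re, Complex.I_re,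
    Complex.ofReal_im, Complex.I_im, mul_zero, mul_one, sub_zero, add_zero] at hre
  refine ⟨by linarith, by linarith, ?_⟩
  rw [Complex.norm_exp]
  exact (Real.exp_le_exp.2 (by linarith)).trans_lt hr

/-- Two x-derivatives on scale R turn R⁴ into R². The operator t∂/∂t is ∂/∂s on the covering, and a
disc of fixed radius d about each point of the middle ray with small |t| fits in the sector, so it
costs only a constant. -/
theorem LimsupCondition.exists_jet_bound {θ₁ θ₂ r₀ R₀ : ℝ} (hθ : θ₁ < θ₂) (hr₀ : 0 < r₀)
    (hR₀ : 0 < R₀) {u : ℂ × (Fin n → ℂ) → ℂ}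
    (hu : AnalyticOnNhd ℂ u (sector θ₁ θ₂ r₀ ×ˢ polydisc n R₀))
    (h : LimsupCondition θ₁ θ₂ u) :
    ∀ ε > 0, ∃ Rε > 0, ∀ R, 0 < R → R < Rε → ∃ ξR : ℝ, ∀ ξ ≤ ξR, ∀ x : Fin n → ℂ, ‖x‖ < R →
      ‖jet eulerCover u ((ξ : ℂ) + ((θ₁ + θ₂) / 2 : ℝ) * Complex.I, x)‖ ≤ ε * R ^ 2 := by
  intro ε hε
  set d := (θ₂ - θ₁) / 4
  have hd : 0 < d := by simp only [d]; linarith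
  set φ := (θ₁ + θ₂) / 2
  -- 16 and 4/d come from δ = R/4 and the radius d; the 4 is R²/R'² with R = 2R'.
  set ε' := ε / (4 * (16 + 4 / d))
  have hε' : 0 < ε' := by positivity
  obtain ⟨Rε, hRε, hb⟩ := h.exists_bound hε'
  refine ⟨min Rε (min R₀ 1) / 2, by positivity, fun R' hR' hRR => ?_⟩
  set R := 2 * R'
  have hR : 0 < R := by positivity
  have hRm : R < min Rε (min R₀ 1) := by simp only [R]; linarith
  have hR1 : R ≤ 1 := hRm.le.trans ((min_le_right _ _).trans (min_le_right _ _))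
  have hRR₀ : R ≤ R₀ := hRm.le.trans ((min_le_right _ _).trans (min_le_left _ _))
  obtain ⟨r, hr, hbr⟩ := hb R hR (hRm.trans_le (min_le_left _ _))
  refine ⟨Real.log (min r r₀ / 2) - d, fun ξ hξ x hx => ?_⟩
  have hexp : Real.exp (ξ + d) < min r r₀ := by
    have h1 : Real.exp (ξ + d) ≤ min r r₀ / 2 := by
      rw [← Real.exp_log (show 0 < min r r₀ / 2 by positivity)]
      exact Real.exp_le_exp.2 (by linarith)
    have : 0 < min r r₀ := by positivity
    linarith
  have hsub : Metric.closedBall ((ξ : ℂ) + φ * Complex.I) d ⊆ sector θ₁ θ₂ (min r r₀) :=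
    closedBall_subset_sector (by simp only [φ, d]; linarith) (by simp only [φ, d]; linarith) hexp
  have hsub1 : ∀ s ∈ Metric.closedBall ((ξ : ℂ) + φ * Complex.I) d, s ∈ sector θ₁ θ₂ r := fun s hs =>
    ⟨(hsub hs).1, (hsub hs).2.1, (hsub hs).2.2.trans_le (min_le_left _ _)⟩
  have hsub0 : ∀ s ∈ Metric.closedBall ((ξ : ℂ) + φ * Complex.I) d, s ∈ sector θ₁ θ₂ r₀ :=
    fun s hs => ⟨(hsub hs).1, (hsub hs).2.1, (hsub hs).2.2.trans_le (min_le_right _ _)⟩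
  have hs0 : (ξ : ℂ) + φ * Complex.I ∈ Metric.closedBall ((ξ : ℂ) + φ * Complex.I) d :=
    Metric.mem_closedBall_self hd.le
  have han : ∀ s ∈ Metric.closedBall ((ξ : ℂ) + φ * Complex.I) d, ∀ x : Fin n → ℂ, ‖x‖ < R →
      AnalyticAt ℂ u (s, x) := fun s hs x hx =>
    hu _ ⟨hsub0 s hs, mem_ball_zero_iff.2 (hx.trans_le hRR₀)⟩
  have hbu : ∀ s ∈ Metric.closedBall ((ξ : ℂ) + φ * Complex.I) d, ∀ x : Fin n → ℂ, ‖x‖ < R →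
      ‖u (s, x)‖ ≤ ε' * R ^ 4 := fun s hs x hx => hbr _ ⟨hsub1 s hs, mem_ball_zero_iff.2 hx⟩
  have hbu' : ∀ x : Fin n → ℂ, ‖x‖ < R →
      ‖eulerCover u ((ξ : ℂ) + φ * Complex.I, x)‖ ≤ ε' * R ^ 4 / d := by
    intro x hx
    refine Complex.norm_deriv_le_of_forall_mem_sphere_norm_le hd ?_
      (fun s hs => hbu s (Metric.sphere_subset_closedBall hs) x hx)
    refine DifferentiableOn.diffContOnCl fun s hs => ?_
    have := han s (Metric.closure_ball_subset_closedBall hs) x hx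
    exact (hasDerivAt_fst this.differentiableAt).differentiableAt.differentiableWithinAt
  have key := norm_jet_le (δ := R / 4) (by positivity) (by linarith)
    (by positivity : 0 ≤ ε' * R ^ 4) (by positivity : 0 ≤ ε' * R ^ 4 / d)
    (fun x hx => han _ hs0 x hx) (fun x hx => hbu _ hs0 x hx) hbu' (x := x)
    (by simp only [R]; linarith)
  refine key.trans ?_
  have e1 : ε' * R ^ 4 / (R / 4) ^ 2 + ε' * R ^ 4 / d / (R / 4) =
      ε' * (16 + 4 / d * R) * R ^ 2 := by
    field_simp
    ring
  rw [e1]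
  have e2 : ε' * (16 + 4 / d) = ε / 4 := by simp only [ε']; field_simp
  have e3 : 4 / d * R ≤ 4 / d := mul_le_of_le_one_right (by positivity) hR1
  calc ε' * (16 + 4 / d * R) * R ^ 2 ≤ ε' * (16 + 4 / d) * R ^ 2 := by gcongr
    _ = ε * R' ^ 2 := by rw [e2]; simp only [R]; ring

theorem sector_isPreconnected (θ₁ θ₂ r : ℝ) : IsPreconnected (sector θ₁ θ₂ r) := by
  refine Convex.isPreconnected fun s hs s' hs' a b ha hb hab => ?_
  have hexp : ∀ s : ℂ, ‖Complex.exp s‖ < r ↔ 0 < r ∧ s.re < Real.log r := by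
    intro s
    rw [Complex.norm_exp]
    constructor
    · intro h
      have hr := (Real.exp_pos _).trans h
      exact ⟨hr, (Real.lt_log_iff_exp_lt hr).2 h⟩
    · rintro ⟨hr, h⟩
      exact (Real.lt_log_iff_exp_lt hr).1 h
  obtain ⟨h1, h2, h3⟩ := hs
  obtain ⟨k1, k2, k3⟩ := hs'
  rw [hexp] at h3 k3
  have im : (a • s + b • s').im = a * s.im + b * s'.im := by simp
  have re : (a • s + b • s').re = a * s.re + b * s'.re := by simp
  refine ⟨?_, ?_, (hexp _).2 ⟨h3.1, ?_⟩⟩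
  · rw [im]
    exact convex_Ioi θ₁ (x := s.im) h1 (y := s'.im) k1 ha hb hab
  · rw [im]
    exact convex_Iio θ₂ (x := s.im) h2 (y := s'.im) k2 ha hb hab
  · rw [re]
    exact convex_Iio (Real.log r) (x := s.re) h3.2 (y := s'.re) k3.2 ha hb hab

theorem dx_comp_exp (α : Fin n → ℕ) (u : ℂ × (Fin n → ℂ) → ℂ) :
    dx α (fun p : ℂ × (Fin n → ℂ) => u (Complex.exp p.1, p.2)) =
      fun p => dx α u (Complex.exp p.1, p.2) :=
  dx_induction (κ := Bool) (fun _ G => G true = fun p => G false (Complex.exp p.1, p.2))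
    (fun k j G hG => by
      change dxj j (G true) = fun p => dxj j (G false) (Complex.exp p.1, p.2)
      rw [hG]; rfl)
    (fun b => if b then (fun p : ℂ × (Fin n → ℂ) => u (Complex.exp p.1, p.2)) else u) rfl α

theorem analyticAt_comp_exp {u : ℂ × (Fin n → ℂ) → ℂ} {p : ℂ × (Fin n → ℂ)}
    (hu : AnalyticAt ℂ u (Complex.exp p.1, p.2)) :
    AnalyticAt ℂ (fun p : ℂ × (Fin n → ℂ) => u (Complex.exp p.1, p.2)) p :=
  AnalyticAt.fun_comp_of_eq hu ((AnalyticAt.cexp' analyticAt_fst).prod analyticAt_snd) rfl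

theorem iterate_eulerCover_comp_exp {u : ℂ × (Fin n → ℂ) → ℂ} {p : ℂ × (Fin n → ℂ)} (i : ℕ)
    (hu : AnalyticAt ℂ u (Complex.exp p.1, p.2)) :
    eulerCover^[i] (fun p : ℂ × (Fin n → ℂ) => u (Complex.exp p.1, p.2)) p =
      euler^[i] u (Complex.exp p.1, p.2) := by
  have hc : ContinuousAt (fun p : ℂ × (Fin n → ℂ) => (Complex.exp p.1, p.2)) p := by fun_prop
  suffices ∀ᶠ p' in 𝓝 p, eulerCover^[i] (fun p : ℂ × (Fin n → ℂ) => u (Complex.exp p.1, p.2)) p' =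
      euler^[i] u (Complex.exp p'.1, p'.2) from this.self_of_nhds
  induction i with
  | zero => exact Eventually.of_forall fun _ => rfl
  | succ i ih =>
    simp only [Function.iterate_succ', Function.comp_apply]
    have h1 := eulerCover_congr (g := fun p : ℂ × (Fin n → ℂ) => euler^[i] u (Complex.exp p.1, p.2)) ih
    filter_upwards [h1, hc.eventually hu.eventually_analyticAt] with p' hp' hp'a
    rw [hp']
    have := ((isLocalOp_euler.iterate i).analyticAt hp'a).differentiableAt
    exact eulerCover_comp_exp _ p'.1 p'.2 (hasDerivAt_fst this).differentiableAt

theorem jet_comp_exp {u : ℂ × (Fin n → ℂ) → ℂ} {p : ℂ × (Fin n → ℂ)}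
    (hu : AnalyticAt ℂ u (Complex.exp p.1, p.2)) :
    jet eulerCover (fun p : ℂ × (Fin n → ℂ) => u (Complex.exp p.1, p.2)) p =
      jet euler u (Complex.exp p.1, p.2) := by
  funext q
  change eulerCover^[q.1.1] (dx q.1.2 _) p = _
  rw [dx_comp_exp]
  exact iterate_eulerCover_comp_exp q.1.1 ((isLocalOp_dx q.1.2).analyticAt hu)

/-- A regular solution, lifted to the covering space, is a sectorial solution with a jet that is
`O(|t|)`. -/
theorem IsRegularSolution.lift {v : ℂ × (Fin n → ℂ) → ℂ} (hv : IsRegularSolution Δ F v) :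
    ∃ r > 0, ∃ C ≥ 0, (∀ t x, ‖t‖ < r → ‖x‖ < r → AnalyticAt ℂ v (t, x)) ∧
      (∀ θ₁ θ₂ : ℝ, IsSectorialSolution Δ F θ₁ θ₂ r r (fun p => v (Complex.exp p.1, p.2))) ∧
      ∀ s x, ‖Complex.exp s‖ < r → ‖x‖ < r →
        ‖jet eulerCover (fun p => v (Complex.exp p.1, p.2)) (s, x)‖ ≤ C * ‖Complex.exp s‖ := by
  obtain ⟨W, hW, h0, han, heq, hzero⟩ := hv
  have hjan : AnalyticAt ℂ (jet euler v) (0, 0) := analyticAt_jet isLocalOp_euler (han _ h0)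
  obtain ⟨K, S, hS, hK⟩ := (hjan.contDiffAt (n := 1)).exists_lipschitzOnWith
  obtain ⟨r, hr, hball⟩ := Metric.eventually_nhds_iff_ball.1 ((hW.eventually_mem h0).and hS)
  have hmem : ∀ (t : ℂ) (x : Fin n → ℂ), ‖t‖ < r → ‖x‖ < r → (t, x) ∈ W ∧ (t, x) ∈ S := by
    intro t x ht hx
    refine hball _ ?_
    have : ((0, 0) : ℂ × (Fin n → ℂ)) = 0 := rfl
    rw [this, mem_ball_zero_iff, Prod.norm_def]
    simp [ht, hx]
  -- The x-derivatives vanish along with v(0, ·), and a positive power of t∂/∂t carries a factor t.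
  -- Lipschitz continuity of the jet between (t, x) and (0, x) then gives O(|t|).
  have hjet0 : ∀ x : Fin n → ℂ, ‖x‖ < r → jet euler v (0, x) = 0 := by
    intro x hx
    funext q
    have hd := dx_induction (κ := Unit)
      (fun _ G => ∀ᶠ y in 𝓝 x, G () (0, y) = 0) (fun k j G hG => by
        filter_upwards [hG.eventually_nhds] with y hy
        have hc : ContinuousAt (fun ζ : ℂ => Function.update y j ζ) (y j) := by fun_prop
        have hy' : ∀ᶠ z in 𝓝 (Function.update y j (y j)), G () (0, z) = 0 := by
          rwa [Function.update_eq_self]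
        have : (fun ζ : ℂ => G () (0, Function.update y j ζ)) =ᶠ[𝓝 (y j)] fun _ => 0 :=
          hc.eventually hy'
        exact this.deriv_eq.trans (deriv_const _ _)) (fun _ => v)
      (((Metric.isOpen_ball.eventually_mem (mem_ball_zero_iff.2 hx))).mono fun y hy =>
        hzero y (hmem 0 y (by simpa using hr) (mem_ball_zero_iff.1 hy)).1) q.1.2
    have hd0 := hd.self_of_nhds
    change euler^[q.1.1] (dx q.1.2 v) (0, x) = 0
    rcases hq : q.1.1 with _ | i
    · exact hd0
    · rw [Function.iterate_succ']
      exact zero_mul _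
  refine ⟨r, hr, K, K.2, fun t x ht hx => han _ (hmem t x ht hx).1, ?_, ?_⟩
  · intro θ₁ θ₂
    have hm : ∀ p ∈ sector θ₁ θ₂ r ×ˢ polydisc n r, (Complex.exp p.1, p.2) ∈ W := fun p hp =>
      (hmem _ _ hp.1.2.2 (mem_ball_zero_iff.1 hp.2)).1
    refine ⟨fun p hp => analyticAt_comp_exp (han _ (hm p hp)), fun p hp => ?_⟩
    rw [jet_comp_exp (han _ (hm p hp)), iterate_eulerCover_comp_exp 2 (han _ (hm p hp))]
    exact heq _ (hm p hp)
  · intro s x hs hx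
    rw [jet_comp_exp (han _ (hmem _ _ hs hx).1)]
    have := hK.dist_le_mul _ (hmem _ _ hs hx).2 _ (hmem 0 x (by simpa using hr) hx).2
    rw [dist_eq_norm, hjet0 x hx, sub_zero, dist_eq_norm] at this
    refine this.trans_eq ?_
    simp [Prod.norm_def]

/-- Both lifts are compared on the ray arg t = 0. For each small x the positive t on which they
agree accumulate at 0, inside the disc of holomorphy. -/
theorem IsRegularSolution.eventuallyEq (hF : AnalyticAt ℂ F (0, 0, 0))
    (hA3 : ∀ᶠ x in 𝓝 (0 : Fin n → ℂ), ∀ q : Lam n, 0 < ∑ j, q.1.2 j → dz q F (0, x, 0) = 0)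
    (hexp : ∀ lam : ℂ, IsCharExponent F 0 lam → lam.re < 0) {u v : ℂ × (Fin n → ℂ) → ℂ}
    (hu : IsRegularSolution Δ F u) (hv : IsRegularSolution Δ F v) : u =ᶠ[𝓝 (0, 0)] v := by
  obtain ⟨r₁, hr₁, C₁, hC₁, hua, hus, huj⟩ := hu.lift
  obtain ⟨r₂, hr₂, C₂, hC₂, hva, hvs, hvj⟩ := hv.lift
  set r := min r₁ r₂
  have hr : 0 < r := by positivity
  have hnorm : ∀ ξ : ℝ, ‖Complex.exp ((ξ : ℂ) + (0 : ℝ) * Complex.I)‖ = Real.exp ξ := fun ξ => by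
    rw [Complex.norm_exp]; simp
  have hlog : ∀ ρ : ℝ, 0 < ρ → ∀ ξ ≤ Real.log (ρ / 2), Real.exp ξ < ρ := fun ρ hρ ξ hξ => by
    have : Real.exp ξ ≤ ρ / 2 := by
      rw [← Real.exp_log (show 0 < ρ / 2 by positivity)]; exact Real.exp_le_exp.2 hξ
    linarith
  obtain ⟨δ, hδ, ξ₁, heq⟩ := eq_on_ray (θ₁ := -1) (θ₂ := 1) (φ := 0) (r₀ := r) (R₀ := r) hF hA3 hexp
    hr hr (by norm_num) (by norm_num) ((hus (-1) 1).mono (min_le_left _ _) (min_le_left _ _))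
    ((hvs (-1) 1).mono (min_le_right _ _) (min_le_right _ _))
    (fun ε hε => ⟨r₁, hr₁, fun R hR hRR => ⟨min (Real.log (r₁ / 2)) (Real.log (ε * R ^ 2 / (C₁ + 1))),
      fun ξ hξ x hx => by
        have h1 := huj ((ξ : ℂ) + (0 : ℝ) * Complex.I) x
          (by rw [hnorm]; exact hlog _ hr₁ ξ (hξ.trans (min_le_left _ _))) (hx.trans hRR)
        rw [hnorm] at h1
        refine h1.trans ?_
        have h2 : Real.exp ξ ≤ ε * R ^ 2 / (C₁ + 1) := by
          rw [← Real.exp_log (show 0 < ε * R ^ 2 / (C₁ + 1) by positivity)]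
          exact Real.exp_le_exp.2 (hξ.trans (min_le_right _ _))
        rw [le_div_iff₀ (by positivity)] at h2
        linarith [Real.exp_pos ξ]⟩⟩)
    hC₂ hr₂ (ξv := Real.log (r₂ / 2)) (fun ξ hξ x hx => by
      have h1 := hvj ((ξ : ℂ) + (0 : ℝ) * Complex.I) x (by rw [hnorm]; exact hlog _ hr₂ ξ hξ) hx
      rwa [hnorm] at h1)
  set ρ := min r δ
  have hρ : 0 < ρ := by positivity
  have hslice : ∀ x : Fin n → ℂ, ‖x‖ < ρ → ∀ t : ℂ, ‖t‖ < r → u (t, x) = v (t, x) := by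
    intro x hx t ht
    have hxr : ‖x‖ < r := hx.trans_le (min_le_left _ _)
    have ha1 : AnalyticOnNhd ℂ (fun t => u (t, x)) (Metric.ball 0 r) := fun t ht =>
      AnalyticAt.fun_comp_of_eq (f := fun t : ℂ => (t, x)) (hua t x ((mem_ball_zero_iff.1 ht).trans_le
        (min_le_left _ _)) (hxr.trans_le (min_le_left _ _)))
        (analyticAt_id.prod analyticAt_const) rfl
    have ha2 : AnalyticOnNhd ℂ (fun t => v (t, x)) (Metric.ball 0 r) := fun t ht =>
      AnalyticAt.fun_comp_of_eq (f := fun t : ℂ => (t, x)) (hva t x ((mem_ball_zero_iff.1 ht).trans_le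
        (min_le_right _ _)) (hxr.trans_le (min_le_right _ _)))
        (analyticAt_id.prod analyticAt_const) rfl
    refine ha1.eqOn_of_preconnected_of_frequently_eq ha2 (convex_ball _ _).isPreconnected
      (Metric.mem_ball_self hr) ?_ (mem_ball_zero_iff.2 ht)
    have htend : Tendsto (fun ξ : ℝ => (Real.exp ξ : ℂ)) atBot (𝓝[≠] 0) := by
      rw [tendsto_nhdsWithin_iff]
      refine ⟨?_, Eventually.of_forall fun ξ => by
        simp only [Set.mem_compl_iff, Set.mem_singleton_iff, Complex.ofReal_eq_zero]
        exact (Real.exp_pos ξ).ne'⟩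
      exact (Complex.continuous_ofReal.tendsto 0).comp Real.tendsto_exp_atBot
    refine htend.frequently (Eventually.frequently ?_)
    filter_upwards [eventually_le_atBot ξ₁] with ξ hξ
    have := heq ξ hξ x (hx.trans_le (min_le_right _ _))
    simpa using this
  refine Metric.eventually_nhds_iff_ball.2 ⟨ρ, hρ, fun p hp => ?_⟩
  have : ((0, 0) : ℂ × (Fin n → ℂ)) = 0 := rfl
  rw [this, mem_ball_zero_iff, Prod.norm_def, max_lt_iff] at hp
  exact hslice p.2 hp.2 p.1 (hp.1.trans_le (min_le_left _ _))

/-- Equality on part of the middle ray spreads, for each fixed x, over the sector, which is convex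
in the coordinate s; only the polydisc has to shrink further. -/
theorem eq_regular_of_limsupCondition (hF : AnalyticAt ℂ F (0, 0, 0))
    (hA3 : ∀ᶠ x in 𝓝 (0 : Fin n → ℂ), ∀ q : Lam n, 0 < ∑ j, q.1.2 j → dz q F (0, x, 0) = 0)
    (hexp : ∀ lam : ℂ, IsCharExponent F 0 lam → lam.re < 0) {θ₁ θ₂ r₀ R₀ : ℝ} (hθ : θ₁ < θ₂)
    (hr₀ : 0 < r₀) (hR₀ : 0 < R₀) {u v : ℂ × (Fin n → ℂ) → ℂ}
    (hu : IsSectorialSolution Δ F θ₁ θ₂ r₀ R₀ u) (hlim : LimsupCondition θ₁ θ₂ u)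
    (hv : IsRegularSolution Δ F v) :
    ∃ σ δ : ℝ, 0 < σ ∧ σ ≤ r₀ ∧ 0 < δ ∧ δ ≤ R₀ ∧ ∀ s ∈ sector θ₁ θ₂ σ, ∀ x ∈ polydisc n δ,
      u (s, x) = v (Complex.exp s, x) := by
  obtain ⟨r₂, hr₂, C₂, hC₂, hva, hvs, hvj⟩ := hv.lift
  set r := min r₀ r₂
  set R := min R₀ r₂
  have hr : 0 < r := by positivity
  have hR : 0 < R := by positivity
  set φ : ℝ := (θ₁ + θ₂) / 2 with hφ
  have hφ₁ : θ₁ < φ := by simp only [φ]; linarith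
  have hφ₂ : φ < θ₂ := by simp only [φ]; linarith
  have hnorm : ∀ ξ : ℝ, ‖Complex.exp ((ξ : ℂ) + φ * Complex.I)‖ = Real.exp ξ := fun ξ => by
    rw [Complex.norm_exp]; simp
  have hlog : ∀ ρ : ℝ, 0 < ρ → ∀ ξ ≤ Real.log (ρ / 2), Real.exp ξ < ρ := fun ρ hρ ξ hξ => by
    have : Real.exp ξ ≤ ρ / 2 := by
      rw [← Real.exp_log (show 0 < ρ / 2 by positivity)]; exact Real.exp_le_exp.2 hξ
    linarith
  have hu' := hu.mono (min_le_left _ _ : r ≤ r₀) (min_le_left _ _ : R ≤ R₀)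
  have hv' := (hvs θ₁ θ₂).mono (min_le_right _ _ : r ≤ r₂) (min_le_right _ _ : R ≤ r₂)
  obtain ⟨δ, hδ, ξ₁, heq⟩ := eq_on_ray hF hA3 hexp hr hR hφ₁ hφ₂ hu' hv'
    (hlim.exists_jet_bound hθ hr₀ hR₀ hu.1) hC₂ hr₂ (ξv := Real.log (r₂ / 2)) (fun ξ hξ x hx => by
      have h1 := hvj ((ξ : ℂ) + φ * Complex.I) x (by rw [hnorm]; exact hlog _ hr₂ ξ hξ) hx
      rwa [hnorm] at h1)
  refine ⟨r, min R δ, hr, min_le_left _ _, by positivity, (min_le_left _ _).trans (min_le_left _ _),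
    fun s hs x hx => ?_⟩
  have hx' := mem_ball_zero_iff.1 hx
  have hxR : x ∈ polydisc n R := mem_ball_zero_iff.2 (hx'.trans_le (min_le_left _ _))
  have ha1 : AnalyticOnNhd ℂ (fun s => u (s, x)) (sector θ₁ θ₂ r) := fun s hs =>
    AnalyticAt.fun_comp_of_eq (f := fun t : ℂ => (t, x)) (hu'.1 (s, x) ⟨hs, hxR⟩)
      (analyticAt_id.prod analyticAt_const) rfl
  have ha2 : AnalyticOnNhd ℂ (fun s => v (Complex.exp s, x)) (sector θ₁ θ₂ r) := fun s hs =>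
    AnalyticAt.fun_comp_of_eq (f := fun t : ℂ => (t, x)) (hv'.1 (s, x) ⟨hs, hxR⟩)
      (analyticAt_id.prod analyticAt_const) rfl
  set ξ₂ := min ξ₁ (Real.log (r / 2))
  have hmem : (ξ₂ : ℂ) + φ * Complex.I ∈ sector θ₁ θ₂ r :=
    mem_sector_ray hφ₁ hφ₂ (hlog r hr _ (min_le_right _ _))
  refine ha1.eqOn_of_preconnected_of_frequently_eq ha2 (sector_isPreconnected _ _ _) hmem ?_ hs
  have htend : Tendsto (fun ξ : ℝ => (ξ : ℂ) + φ * Complex.I) (𝓝[<] ξ₂)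
      (𝓝[≠] ((ξ₂ : ℂ) + φ * Complex.I)) := by
    rw [tendsto_nhdsWithin_iff]
    constructor
    · have : Continuous (fun ξ : ℝ => (ξ : ℂ) + φ * Complex.I) := by fun_prop
      exact (this.tendsto ξ₂).mono_left nhdsWithin_le_nhds
    · filter_upwards [self_mem_nhdsWithin] with ξ hξ
      simpa using (ne_of_lt hξ)
  refine htend.frequently (Eventually.frequently ?_)
  filter_upwards [self_mem_nhdsWithin] with ξ hξ
  exact heq ξ (hξ.le.trans (min_le_left _ _)) x (hx'.trans_le (min_le_right _ _))

end Uniqueness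

end Fuchs

/-! ### Banach algebras of power series with weighted summable coefficients -/

namespace Fuchs

/-- A submultiplicative weight on the exponents of power series in the variables `σ`. -/
structure Weight (σ : Type*) where
  /-- The value of the weight on an exponent. -/
  val : (σ →₀ ℕ) → ℝ
  pos : ∀ m, 0 < val m
  zero : val 0 = 1
  add_le : ∀ m m', val (m + m') ≤ val m * val m'

section WeightedSeries

variable {σ : Type*} (ω : Weight σ)

theorem summable_convolution [DecidableEq σ] {a b c : (σ →₀ ℕ) → ℝ} (ha : Summable a) (hb : Summable b)
    (ha0 : 0 ≤ a) (hb0 : 0 ≤ b) (hc0 : 0 ≤ c)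
    (h : ∀ m, c m ≤ ∑ kl ∈ Finset.HasAntidiagonal.antidiagonal m, a kl.1 * b kl.2) :
    Summable c ∧ ∑' m, c m ≤ (∑' m, a m) * ∑' m, b m := by
  have hab := ha.mul_of_nonneg hb ha0 hb0
  have hS := summable_sum_mul_antidiagonal_of_summable_mul hab
  have h1 := hS.of_nonneg_of_le hc0 h
  refine ⟨h1, ?_⟩
  rw [ha.tsum_mul_tsum_eq_tsum_sum_antidiagonal hb hab]
  exact h1.tsum_le_tsum h hS

theorem summable_coeff_mul {f g : MvPowerSeries σ ℂ}
    (hf : Summable fun m => ‖MvPowerSeries.coeff m f‖ * ω.val m)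
    (hg : Summable fun m => ‖MvPowerSeries.coeff m g‖ * ω.val m) :
    (Summable fun m => ‖MvPowerSeries.coeff m (f * g)‖ * ω.val m) ∧
    ∑' m, ‖MvPowerSeries.coeff m (f * g)‖ * ω.val m ≤
      (∑' m, ‖MvPowerSeries.coeff m f‖ * ω.val m) * ∑' m, ‖MvPowerSeries.coeff m g‖ * ω.val m := by
  classical
  have hnn : ∀ f : MvPowerSeries σ ℂ, 0 ≤ fun m => ‖MvPowerSeries.coeff m f‖ * ω.val m :=
    fun f m => mul_nonneg (norm_nonneg _) (ω.pos m).le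
  refine summable_convolution hf hg (hnn f) (hnn g) (hnn (f * g)) fun m => ?_
  rw [MvPowerSeries.coeff_mul]
  refine (mul_le_mul_of_nonneg_right (norm_sum_le _ _) (ω.pos m).le).trans ?_
  rw [Finset.sum_mul]
  refine Finset.sum_le_sum fun kl hkl => ?_
  rw [norm_mul, ← Finset.HasAntidiagonal.mem_antidiagonal.1 hkl]
  calc _ ≤ ‖MvPowerSeries.coeff kl.1 f‖ * ‖MvPowerSeries.coeff kl.2 g‖ *
        (ω.val kl.1 * ω.val kl.2) := by gcongr; exact ω.add_le _ _
    _ = _ := by ring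

theorem summable_coeff_monomial (m : σ →₀ ℕ) (c : ℂ) :
    HasSum (fun k => ‖MvPowerSeries.coeff k (MvPowerSeries.monomial m c)‖ * ω.val k)
      (‖c‖ * ω.val m) := by
  classical
  have : (fun k => ‖MvPowerSeries.coeff k (MvPowerSeries.monomial m c)‖ * ω.val k) =
      fun k => if k = m then ‖c‖ * ω.val m else 0 := by
    funext k
    rw [MvPowerSeries.coeff_monomial]
    split_ifs with h
    · rw [h]
    · simp
  rw [this]
  exact hasSum_ite_eq m _

/-- The algebra of the power series whose coefficients are summable with respect to a weight. -/
def weightedSeries : Subalgebra ℂ (MvPowerSeries σ ℂ) where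
  carrier := {f | Summable fun m => ‖MvPowerSeries.coeff m f‖ * ω.val m}
  mul_mem' hf hg := (summable_coeff_mul ω hf hg).1
  add_mem' {f g} hf hg := by
    refine (Summable.add hf hg).of_nonneg_of_le
      (fun m => mul_nonneg (norm_nonneg _) (ω.pos m).le) fun m => ?_
    rw [map_add, ← add_mul]
    exact mul_le_mul_of_nonneg_right (norm_add_le _ _) (ω.pos m).le
  algebraMap_mem' c := (summable_coeff_monomial ω 0 c).summable

variable {ω}

/-- The coefficients of an element of the weighted algebra. -/
noncomputable def wcoeff (m : σ →₀ ℕ) : weightedSeries ω →ₗ[ℂ] ℂ :=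
  (MvPowerSeries.coeff m).comp (weightedSeries ω).val.toLinearMap

theorem summable_wcoeff (f : weightedSeries ω) : Summable fun m => ‖wcoeff m f‖ * ω.val m := f.2

theorem wcoeff_ext {f g : weightedSeries ω} (h : ∀ m, wcoeff m f = wcoeff m g) : f = g :=
  Subtype.ext (MvPowerSeries.ext h)

noncomputable instance : NormedCommRing (weightedSeries ω) :=
  { (inferInstance : CommRing (weightedSeries ω)),
    AddGroupNorm.toNormedAddCommGroup (E := weightedSeries ω)
      { toFun := fun f => ∑' m, ‖wcoeff m f‖ * ω.val m
        map_zero' := by simp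
        add_le' := fun f g => by
          rw [← (summable_wcoeff f).tsum_add (summable_wcoeff g)]
          refine (summable_wcoeff (f + g)).tsum_le_tsum (fun m => ?_)
            ((summable_wcoeff f).add (summable_wcoeff g))
          rw [map_add, ← add_mul]
          exact mul_le_mul_of_nonneg_right (norm_add_le _ _) (ω.pos m).le
        neg' := fun f => by simp
        eq_zero_of_map_eq_zero' := fun f hf => by
          refine wcoeff_ext fun m => ?_
          have h1 := (summable_wcoeff f).le_tsum m
            (fun m _ => mul_nonneg (norm_nonneg _) (ω.pos m).le)
          rw [hf] at h1
          have h2 := ω.pos m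
          have h3 : ‖wcoeff m f‖ ≤ 0 := by
            by_contra! h
            have := mul_pos h h2
            linarith
          rw [norm_le_zero_iff.1 h3, map_zero] } with
    norm_mul_le := fun f g => (summable_coeff_mul ω f.2 g.2).2 }

theorem wnorm_def (f : weightedSeries ω) : ‖f‖ = ∑' m, ‖wcoeff m f‖ * ω.val m := rfl

noncomputable instance : NormedAlgebra ℂ (weightedSeries ω) where
  norm_smul_le c f := by
    rw [wnorm_def, wnorm_def, ← tsum_mul_left]
    refine le_of_eq (tsum_congr fun m => ?_)
    rw [map_smul, smul_eq_mul, norm_mul, mul_assoc]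

/-- The monomials, as elements of the weighted algebra. -/
noncomputable def wmonomial (m : σ →₀ ℕ) (c : ℂ) : weightedSeries ω :=
  ⟨MvPowerSeries.monomial m c, (summable_coeff_monomial ω m c).summable⟩

theorem norm_wmonomial (m : σ →₀ ℕ) (c : ℂ) : ‖(wmonomial m c : weightedSeries ω)‖ = ‖c‖ * ω.val m :=
  (summable_coeff_monomial ω m c).tsum_eq

theorem wcoeff_wmonomial [DecidableEq σ] (k m : σ →₀ ℕ) (c : ℂ) :
    wcoeff k (wmonomial m c : weightedSeries ω) = if k = m then c else 0 :=
  MvPowerSeries.coeff_monomial k m c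

instance : NormOneClass (weightedSeries ω) where
  norm_one := by
    have h : (1 : weightedSeries ω) = wmonomial 0 1 := rfl
    rw [h, norm_wmonomial, ω.zero]
    simp

/-- An element of the weighted algebra given by its coefficients. -/
def wmk (a : (σ →₀ ℕ) → ℂ) (ha : Summable fun m => ‖a m‖ * ω.val m) : weightedSeries ω := ⟨a, ha⟩

theorem wcoeff_wmk (a : (σ →₀ ℕ) → ℂ) (ha : Summable fun m => ‖a m‖ * ω.val m) (m : σ →₀ ℕ) :
    wcoeff m (wmk a ha) = a m := rfl

/-- Multiplying each coefficient by its weight is an isometry onto ℓ¹. -/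
instance : CompleteSpace (weightedSeries ω) := by
  have hω : ∀ m, (ω.val m : ℂ) ≠ 0 := fun m => by exact_mod_cast (ω.pos m).ne'
  let toLp : weightedSeries ω → lp (fun _ : σ →₀ ℕ => ℂ) 1 := fun f =>
    ⟨fun m => wcoeff m f * ω.val m, memℓp_gen (by
      simpa [abs_of_pos (ω.pos _)] using summable_wcoeff f)⟩
  have hiso : Isometry toLp := by
    refine Isometry.of_dist_eq fun f g => ?_
    rw [dist_eq_norm, dist_eq_norm, lp.norm_eq_tsum_rpow (by simp), wnorm_def]
    simp only [ENNReal.toReal_one, Real.rpow_one, div_one]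
    refine tsum_congr fun m => ?_
    change ‖wcoeff m f * ω.val m - wcoeff m g * ω.val m‖ = _
    rw [← sub_mul, norm_mul, Complex.norm_real, Real.norm_of_nonneg (ω.pos m).le, map_sub]
  have hsurj : Function.Surjective toLp := by
    intro g
    have hg : Summable fun m => ‖g m / ω.val m‖ * ω.val m := by
      have := (memℓp_gen_iff (by simp)).1 g.2
      simp only [ENNReal.toReal_one, Real.rpow_one] at this
      refine this.congr fun m => ?_
      rw [norm_div, Complex.norm_real, Real.norm_of_nonneg (ω.pos m).le,
        div_mul_cancel₀ _ (ω.pos m).ne']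
    refine ⟨wmk _ hg, ?_⟩
    ext m
    exact div_mul_cancel₀ _ (hω m)
  exact (IsometryEquiv.mk (Equiv.ofBijective toLp ⟨hiso.injective, hsurj⟩) hiso).completeSpace

/-- The monomial function with exponent `m`. -/
noncomputable def monEval (y : σ → ℂ) (m : σ →₀ ℕ) : ℂ := m.prod fun i k => y i ^ k

theorem monEval_add (y : σ → ℂ) (m m' : σ →₀ ℕ) :
    monEval y (m + m') = monEval y m * monEval y m' := by
  classical
  exact Finsupp.prod_add_index' (fun _ => pow_zero _) fun _ _ _ => pow_add _ _ _

/-- The points at which all elements of the weighted algebra can be evaluated. -/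
def IsEvalPoint (ω : Weight σ) (y : σ → ℂ) : Prop := ∀ m, ‖monEval y m‖ ≤ ω.val m

theorem IsEvalPoint.summable {y : σ → ℂ} (hy : IsEvalPoint ω y) (f : weightedSeries ω) :
    Summable fun m => ‖wcoeff m f * monEval y m‖ :=
  (summable_wcoeff f).of_nonneg_of_le (fun _ => norm_nonneg _) fun m => by
    rw [norm_mul]; exact mul_le_mul_of_nonneg_left (hy m) (norm_nonneg _)

theorem IsEvalPoint.tsum_wmonomial {y : σ → ℂ} (m : σ →₀ ℕ) (c : ℂ) :
    ∑' k, wcoeff k (wmonomial m c : weightedSeries ω) * monEval y k = c * monEval y m := by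
  classical
  rw [tsum_eq_single m]
  · rw [wcoeff_wmonomial, if_pos rfl]
  · intro k hk
    rw [wcoeff_wmonomial, if_neg hk, zero_mul]

/-- Evaluation at a point, as a character of the weighted algebra. -/
noncomputable def IsEvalPoint.eval {y : σ → ℂ} (hy : IsEvalPoint ω y) : weightedSeries ω →ₐ[ℂ] ℂ where
  toFun f := ∑' m, wcoeff m f * monEval y m
  map_one' := (IsEvalPoint.tsum_wmonomial (ω := ω) (y := y) 0 1).trans (by simp [monEval])
  map_zero' := by simp
  map_add' f g := by
    rw [← (hy.summable f).of_norm.tsum_add (hy.summable g).of_norm]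
    exact tsum_congr fun m => by rw [map_add, add_mul]
  commutes' c := (IsEvalPoint.tsum_wmonomial (ω := ω) (y := y) 0 c).trans (by simp [monEval])
  map_mul' f g := by
    classical
    have hfg := summable_mul_of_summable_norm (hy.summable f) (hy.summable g)
    rw [(hy.summable f).of_norm.tsum_mul_tsum_eq_tsum_sum_antidiagonal (hy.summable g).of_norm hfg]
    refine tsum_congr fun m => ?_
    have : wcoeff m (f * g) = ∑ kl ∈ Finset.HasAntidiagonal.antidiagonal m, wcoeff kl.1 f * wcoeff kl.2 g :=
      MvPowerSeries.coeff_mul _ _ _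
    rw [this, Finset.sum_mul]
    refine Finset.sum_congr rfl fun kl hkl => ?_
    rw [← Finset.HasAntidiagonal.mem_antidiagonal.1 hkl, monEval_add]
    ring

theorem IsEvalPoint.eval_def {y : σ → ℂ} (hy : IsEvalPoint ω y) (f : weightedSeries ω) :
    hy.eval f = ∑' m, wcoeff m f * monEval y m := rfl

theorem IsEvalPoint.eval_wmonomial {y : σ → ℂ} (hy : IsEvalPoint ω y) (m : σ →₀ ℕ) (c : ℂ) :
    hy.eval (wmonomial m c) = c * monEval y m := IsEvalPoint.tsum_wmonomial m c

end WeightedSeries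

/-! ### Substitution of Banach algebra elements into sums over words -/

section WordSum

variable {ι I A : Type*} [NormedCommRing A] [NormOneClass A] [NormedAlgebra ℂ A] [CompleteSpace A]

/-- The sum of a family of monomials (given by words) evaluated in a Banach algebra. -/
noncomputable def wordSum (c : I → ℂ) (W : I → List ι) (Y : ι → A) : A :=
  ∑' i, c i • ((W i).map Y).prod

variable {c : I → ℂ} {W : I → List ι} {r : ℝ}

omit [CompleteSpace A] in
theorem norm_smul_word_le (hr : 0 ≤ r) {Y : ι → A} (hY : ∀ j, ‖Y j‖ ≤ r) (i : I) :
    ‖c i • ((W i).map Y).prod‖ ≤ ‖c i‖ * r ^ (W i).length := by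
  rw [norm_smul]
  exact mul_le_mul_of_nonneg_left (norm_map_prod_le Y hr hY _) (norm_nonneg _)

theorem summable_wordSum (hc : Summable fun i => ‖c i‖ * r ^ (W i).length) (hr : 0 ≤ r) {Y : ι → A}
    (hY : ∀ j, ‖Y j‖ ≤ r) : Summable fun i => c i • ((W i).map Y).prod :=
  Summable.of_norm_bounded hc (norm_smul_word_le hr hY)

omit [CompleteSpace A] in
theorem norm_wordSum_le (hc : Summable fun i => ‖c i‖ * r ^ (W i).length) (hr : 0 ≤ r) {Y : ι → A}
    (hY : ∀ j, ‖Y j‖ ≤ r) : ‖wordSum c W Y‖ ≤ ∑' i, ‖c i‖ * r ^ (W i).length :=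
  tsum_of_norm_bounded hc.hasSum (norm_smul_word_le hr hY)

-- Replacing one letter at a time telescopes the difference, each replacement costing d in place of
-- a factor r.
omit [NormedAlgebra ℂ A] [CompleteSpace A] in
theorem norm_map_prod_sub_le {Y Y' : ι → A} {d : ℝ} (hr : 0 < r) (hY : ∀ j, ‖Y j‖ ≤ r)
    (hY' : ∀ j, ‖Y' j‖ ≤ r) (hd : ∀ j, ‖Y j - Y' j‖ ≤ d) (w : List ι) :
    ‖(w.map Y).prod - (w.map Y').prod‖ ≤ w.length * r ^ w.length * (d / r) := by
  induction w with
  | nil => simp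
  | cons a w ih =>
    have hd0 : 0 ≤ d := (norm_nonneg _).trans (hd a)
    simp only [List.map_cons, List.prod_cons, List.length_cons]
    have e : Y a * (w.map Y).prod - Y' a * (w.map Y').prod =
        (Y a - Y' a) * (w.map Y).prod + Y' a * ((w.map Y).prod - (w.map Y').prod) := by ring
    rw [e]
    refine (norm_add_le _ _).trans ?_
    have h1 : ‖(Y a - Y' a) * (w.map Y).prod‖ ≤ d * r ^ w.length :=
      (norm_mul_le _ _).trans (mul_le_mul (hd a) (norm_map_prod_le Y hr.le hY w) (norm_nonneg _) hd0)
    have h2 : ‖Y' a * ((w.map Y).prod - (w.map Y').prod)‖ ≤ r * (w.length * r ^ w.length * (d / r)) :=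
      (norm_mul_le _ _).trans (mul_le_mul (hY' a) ih (norm_nonneg _) hr.le)
    refine (add_le_add h1 h2).trans_eq ?_
    push_cast
    field_simp
    ring

/-- The factor k from the Lipschitz estimate is absorbed by passing from r to s < r, since k(s/r)^k
is bounded. -/
theorem summable_length_mul {s : ℝ} (hr : 0 < r) (hs : 0 < s) (hsr : s < r)
    (hc : Summable fun i => ‖c i‖ * r ^ (W i).length) :
    Summable fun i => ‖c i‖ * ((W i).length * s ^ (W i).length) := by
  have hq : Tendsto (fun k : ℕ => (k : ℝ) * (s / r) ^ k) atTop (𝓝 0) :=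
    tendsto_self_mul_const_pow_of_lt_one (by positivity) ((div_lt_one hr).2 hsr)
  obtain ⟨C, hC⟩ := hq.bddAbove_range
  refine (hc.mul_left C).of_nonneg_of_le (fun i => by positivity) fun i => ?_
  have h1 : ((W i).length : ℝ) * (s / r) ^ (W i).length ≤ C := hC ⟨_, rfl⟩
  rw [div_pow, mul_div_assoc', div_le_iff₀ (by positivity)] at h1
  calc _ ≤ ‖c i‖ * (C * r ^ (W i).length) := by gcongr
    _ = _ := by ring

theorem norm_wordSum_sub_le {s : ℝ} (hr : 0 < r) (hs : 0 < s) (hsr : s < r)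
    (hc : Summable fun i => ‖c i‖ * r ^ (W i).length) {Y Y' : ι → A} {d : ℝ}
    (hY : ∀ j, ‖Y j‖ ≤ s) (hY' : ∀ j, ‖Y' j‖ ≤ s) (hd : ∀ j, ‖Y j - Y' j‖ ≤ d) :
    ‖wordSum c W Y - wordSum c W Y'‖ ≤
      (∑' i, ‖c i‖ * ((W i).length * s ^ (W i).length)) * (d / s) := by
  have h1 := summable_wordSum hc hr.le (fun j => (hY j).trans hsr.le)
  have h2 := summable_wordSum hc hr.le (fun j => (hY' j).trans hsr.le)
  rw [wordSum, wordSum, ← h1.tsum_sub h2]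
  have h3 := (summable_length_mul hr hs hsr hc).mul_right (d / s)
  rw [← tsum_mul_right]
  refine tsum_of_norm_bounded h3.hasSum fun i => ?_
  rw [← smul_sub, norm_smul, mul_assoc]
  exact mul_le_mul_of_nonneg_left (norm_map_prod_sub_le hs hY hY' hd _) (norm_nonneg _)

/-- Applied to the evaluation characters, this turns an identity in the algebra of power series into
the equation at each point. -/
theorem map_wordSum (φ : A →ₐ[ℂ] ℂ) (hc : Summable fun i => ‖c i‖ * r ^ (W i).length) (hr : 0 ≤ r)
    {Y : ι → A} (hY : ∀ j, ‖Y j‖ ≤ r) :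
    φ (wordSum c W Y) = wordSum c W (fun j => φ (Y j)) := by
  have h := (AlgHom.toContinuousLinearMap φ).map_tsum (summable_wordSum hc hr hY)
  rw [wordSum, wordSum]
  refine h.trans (tsum_congr fun i => ?_)
  change φ (c i • _) = _
  rw [map_smul, map_list_prod, List.map_map]
  rfl

end WordSum

end Fuchs

namespace Fuchs

/-! ### Weights for which multiplication by t absorbs two x-derivatives -/

section Majorant

variable {n : ℕ}

/-- The total degree of an exponent in the variables `x`. -/
def xdeg (m : Option (Fin n) →₀ ℕ) : ℕ := ∑ j, m (some j)

theorem xdeg_add (m m' : Option (Fin n) →₀ ℕ) : xdeg (m + m') = xdeg m + xdeg m' := by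
  simp [xdeg, Finset.sum_add_distrib]

theorem xdeg_single_some (j : Fin n) : xdeg (Finsupp.single (some j) 1) = 1 := by
  simp [xdeg, Finsupp.single_apply]

theorem xdeg_single_none : xdeg (Finsupp.single (none : Option (Fin n)) 1) = 0 := by
  simp [xdeg]

/-- The weights `T^k ρ^b / binom(2k + l + b, b)`, where `k` is the degree in `t` and `b` the degree
in `x`. -/
noncomputable def shiftedWeight (T ρ : ℝ) (l : ℕ) (m : Option (Fin n) →₀ ℕ) : ℝ :=
  T ^ m none * ρ ^ xdeg m / ((2 * m none + l + xdeg m).choose (xdeg m) : ℝ)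

/-- The left side is one term of Vandermonde's sum. The binomials stand in the denominator of the
weight, so this is its submultiplicativity. -/
theorem choose_mul_choose_le (a b c d : ℕ) :
    a.choose b * c.choose d ≤ (a + c).choose (b + d) := by
  rw [Nat.add_choose_eq]
  exact Finset.single_le_sum (f := fun ij : ℕ × ℕ => a.choose ij.1 * c.choose ij.2)
    (fun _ _ => Nat.zero_le _)
    (Finset.HasAntidiagonal.mem_antidiagonal.2 (rfl : (b, d).1 + (b, d).2 = b + d))

variable {T ρ : ℝ}

theorem choose_shift_pos (k l b : ℕ) : (0 : ℝ) < ((2 * k + l + b).choose b : ℝ) := by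
  exact_mod_cast Nat.choose_pos (Nat.le_add_left _ _)

theorem shiftedWeight_pos (hT : 0 < T) (hρ : 0 < ρ) (l : ℕ) (m : Option (Fin n) →₀ ℕ) :
    0 < shiftedWeight T ρ l m := by
  have := choose_shift_pos (m none) l (xdeg m)
  unfold shiftedWeight
  positivity

/-- The weight `T^k ρ^b / binom(2k + b, b)`. -/
noncomputable def majorantWeight (n : ℕ) (hT : 0 < T) (hρ : 0 < ρ) : Weight (Option (Fin n)) where
  val := shiftedWeight T ρ 0
  pos := shiftedWeight_pos hT hρ 0
  zero := by simp [shiftedWeight, xdeg]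
  add_le m m' := by
    have h := choose_mul_choose_le (2 * m none + 0 + xdeg m) (xdeg m) (2 * m' none + 0 + xdeg m')
      (xdeg m')
    rw [show 2 * m none + 0 + xdeg m + (2 * m' none + 0 + xdeg m') =
      2 * (m + m') none + 0 + xdeg (m + m') by rw [xdeg_add, Finsupp.add_apply]; ring] at h
    have h' : (((2 * m none + 0 + xdeg m).choose (xdeg m) : ℝ)) *
        ((2 * m' none + 0 + xdeg m').choose (xdeg m') : ℝ) ≤
        ((2 * (m + m') none + 0 + xdeg (m + m')).choose (xdeg (m + m')) : ℝ) := by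
      rw [xdeg_add m m'] at h ⊢
      exact_mod_cast h
    unfold shiftedWeight
    rw [div_mul_div_comm]
    have e : T ^ m none * ρ ^ xdeg m * (T ^ m' none * ρ ^ xdeg m') =
        T ^ (m + m') none * ρ ^ xdeg (m + m') := by
      rw [xdeg_add, Finsupp.add_apply, pow_add, pow_add]; ring
    rw [e]
    exact div_le_div_of_nonneg_left (by positivity)
      (mul_pos (choose_shift_pos _ _ _) (choose_shift_pos _ _ _)) h'

theorem val_majorantWeight (hT : 0 < T) (hρ : 0 < ρ) (m : Option (Fin n) →₀ ℕ) :
    (majorantWeight n hT hρ).val m = shiftedWeight T ρ 0 m := rfl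

theorem shiftedWeight_single_none : shiftedWeight T ρ 0 (Finsupp.single (none : Option (Fin n)) 1) = T := by
  simp [shiftedWeight, xdeg_single_none]

theorem shiftedWeight_single_some (j : Fin n) :
    shiftedWeight T ρ 0 (Finsupp.single (some j) 1) = ρ := by
  simp [shiftedWeight, xdeg_single_some]

/-- Raising the t-degree by 1 raises 2k by 2, which covers the shift l left by at most two
x-derivatives; this is why the weight contains 2k. -/
theorem shiftedWeight_add_single_none_le (hT : 0 < T) (hρ : 0 < ρ) {l : ℕ} (hl : l ≤ 2)
    (m : Option (Fin n) →₀ ℕ) :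
    shiftedWeight T ρ 0 (m + Finsupp.single none 1) ≤ T * shiftedWeight T ρ l m := by
  unfold shiftedWeight
  rw [xdeg_add, xdeg_single_none, add_zero, Finsupp.add_apply, Finsupp.single_eq_same,
    ← mul_div_assoc]
  have h : (2 * m none + l + xdeg m).choose (xdeg m) ≤
      (2 * (m none + 1) + 0 + xdeg m).choose (xdeg m) := Nat.choose_le_choose _ (by omega)
  have h' : ((2 * m none + l + xdeg m).choose (xdeg m) : ℝ) ≤
      ((2 * (m none + 1) + 0 + xdeg m).choose (xdeg m) : ℝ) := by exact_mod_cast h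
  rw [pow_succ, show T ^ m none * T * ρ ^ xdeg m = T * (T ^ m none * ρ ^ xdeg m) by ring]
  exact div_le_div_of_nonneg_left (by positivity) (choose_shift_pos _ _ _) h'

/-- An x-derivative produces a factor b + 1 that nothing else would compensate. The recursion of the
binomials trades it for 2k + 1 + l, which depends on the t-degree alone, at the price of shifting l.
-/
theorem shiftedWeight_add_single_some (hρ : 0 < ρ) (l : ℕ) (j : Fin n) (m : Option (Fin n) →₀ ℕ) :
    (xdeg m + 1 : ℝ) * shiftedWeight T ρ (l + 1) m =
      ρ⁻¹ * ((2 * m none + 1 + l) * shiftedWeight T ρ l (m + Finsupp.single (some j) 1)) := by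
  unfold shiftedWeight
  rw [xdeg_add, xdeg_single_some, Finsupp.add_apply, Finsupp.single_eq_of_ne (by simp), add_zero]
  have h := Nat.choose_succ_right_eq (2 * m none + (l + 1) + xdeg m) (xdeg m)
  rw [show 2 * m none + (l + 1) + xdeg m - xdeg m = 2 * m none + (l + 1) by omega] at h
  have h' : ((2 * m none + l + (xdeg m + 1)).choose (xdeg m + 1) : ℝ) * (xdeg m + 1) =
      ((2 * m none + (l + 1) + xdeg m).choose (xdeg m) : ℝ) * (2 * m none + (l + 1)) := by
    rw [show 2 * m none + l + (xdeg m + 1) = 2 * m none + (l + 1) + xdeg m by ring]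
    exact_mod_cast h
  have h1 := choose_shift_pos (m none) l (xdeg m + 1)
  have h2 := choose_shift_pos (m none) (l + 1) (xdeg m)
  generalize ((2 * m none + l + (xdeg m + 1)).choose (xdeg m + 1) : ℝ) = A at h' h1 ⊢
  generalize ((2 * m none + (l + 1) + xdeg m).choose (xdeg m) : ℝ) = B at h' h2 ⊢
  rw [pow_succ]
  field_simp
  linear_combination T ^ m none * h'

/-- The action of `∂/∂x_j` on the coefficients of power series. -/
noncomputable def coeffDeriv (j : Fin n) :
    ((Option (Fin n) →₀ ℕ) → ℂ) →ₗ[ℂ] ((Option (Fin n) →₀ ℕ) → ℂ) where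
  toFun a m := (m (some j) + 1) * a (m + Finsupp.single (some j) 1)
  map_add' a b := by ext m; simp [mul_add]
  map_smul' c a := by ext m; simp; ring

theorem coeffDeriv_apply (j : Fin n) (a : (Option (Fin n) →₀ ℕ) → ℂ) (m) :
    coeffDeriv j a m = (m (some j) + 1) * a (m + Finsupp.single (some j) 1) := rfl

theorem summable_coeffDeriv (hT : 0 < T) (hρ : 0 < ρ) (j : Fin n) (l : ℕ)
    (a : (Option (Fin n) →₀ ℕ) → ℂ) {φ : ℕ → ℝ} (hφ : ∀ k, 0 ≤ φ k)
    (h : Summable fun m => φ (m none) * (2 * m none + 1 + l) * ‖a m‖ * shiftedWeight T ρ l m) :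
    (Summable fun m => φ (m none) * ‖coeffDeriv j a m‖ * shiftedWeight T ρ (l + 1) m) ∧
    ∑' m, φ (m none) * ‖coeffDeriv j a m‖ * shiftedWeight T ρ (l + 1) m ≤
      ρ⁻¹ * ∑' m, φ (m none) * (2 * m none + 1 + l) * ‖a m‖ * shiftedWeight T ρ l m := by
  have hinj : Function.Injective
      fun m : Option (Fin n) →₀ ℕ => m + Finsupp.single (some j) 1 := add_left_injective _
  set g : (Option (Fin n) →₀ ℕ) → ℝ :=
    fun m => φ (m none) * (2 * m none + 1 + l) * ‖a m‖ * shiftedWeight T ρ l m with hg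
  have hg0 : ∀ m, 0 ≤ g m := fun m =>
    mul_nonneg (mul_nonneg (mul_nonneg (hφ _) (by positivity)) (norm_nonneg _))
      (shiftedWeight_pos hT hρ l m).le
  have hle : ∀ m, φ (m none) * ‖coeffDeriv j a m‖ * shiftedWeight T ρ (l + 1) m ≤
      ρ⁻¹ * g (m + Finsupp.single (some j) 1) := by
    intro m
    have e := shiftedWeight_add_single_some (T := T) hρ l j m
    have h1 : (m (some j) : ℝ) + 1 ≤ xdeg m + 1 := by
      have : m (some j) ≤ xdeg m :=
        Finset.single_le_sum (f := fun j => m (some j)) (fun _ _ => Nat.zero_le _)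
          (Finset.mem_univ j)
      gcongr
    have h2 : ‖coeffDeriv j a m‖ = (m (some j) + 1) * ‖a (m + Finsupp.single (some j) 1)‖ := by
      rw [coeffDeriv_apply, norm_mul]
      congr 1
      exact_mod_cast Complex.norm_natCast (m (some j) + 1)
    have h3 : (m + Finsupp.single (some j) 1 : Option (Fin n) →₀ ℕ) none = m none := by simp
    rw [h2, hg]
    simp only [h3]
    calc _ = φ (m none) * ‖a (m + Finsupp.single (some j) 1)‖ * ((m (some j) + 1) *
          shiftedWeight T ρ (l + 1) m) := by ring
      _ ≤ φ (m none) * ‖a (m + Finsupp.single (some j) 1)‖ * ((xdeg m + 1) *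
          shiftedWeight T ρ (l + 1) m) := by
        refine mul_le_mul_of_nonneg_left (mul_le_mul_of_nonneg_right h1
          (shiftedWeight_pos hT hρ _ m).le) (mul_nonneg (hφ _) (norm_nonneg _))
      _ = _ := by rw [e]; ring
  have hs : Summable fun m => ρ⁻¹ * g (m + Finsupp.single (some j) 1) :=
    (h.comp_injective hinj).mul_left _
  have hs' := hs.of_nonneg_of_le (fun m => mul_nonneg (mul_nonneg (hφ _) (norm_nonneg _))
    (shiftedWeight_pos hT hρ _ m).le) hle
  refine ⟨hs', (hs'.tsum_le_tsum hle hs).trans ?_⟩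
  rw [tsum_mul_left]
  exact mul_le_mul_of_nonneg_left (tsum_comp_le_tsum_of_inj h hg0 hinj) (by positivity)

/-- An operator on coefficients which loses at most `l` derivatives, measured by the shifted
weights. -/
def LosesDerivatives (T ρ : ℝ) (l : ℕ)
    (D : ((Option (Fin n) →₀ ℕ) → ℂ) →ₗ[ℂ] ((Option (Fin n) →₀ ℕ) → ℂ)) : Prop :=
  ∀ (φ : ℕ → ℝ) (a : (Option (Fin n) →₀ ℕ) → ℂ), (∀ k, 0 ≤ φ k) →
    (Summable fun m => φ (m none) * ((2 * m none + 1).ascFactorial l : ℝ) * ‖a m‖ *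
      shiftedWeight T ρ 0 m) →
    (Summable fun m => φ (m none) * ‖D a m‖ * shiftedWeight T ρ l m) ∧
    ∑' m, φ (m none) * ‖D a m‖ * shiftedWeight T ρ l m ≤
      ρ⁻¹ ^ l * ∑' m, φ (m none) * ((2 * m none + 1).ascFactorial l : ℝ) * ‖a m‖ *
        shiftedWeight T ρ 0 m

theorem losesDerivatives_id : LosesDerivatives (n := n) T ρ 0 LinearMap.id := by
  intro φ a _ h
  simp only [Nat.ascFactorial_zero, Nat.cast_one, mul_one] at h ⊢
  exact ⟨h, by simp⟩

/-- The new factor 2k + 1 + l is put into φ; the definition quantifies over φ to make this induction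
possible. -/
theorem LosesDerivatives.coeffDeriv_comp (hT : 0 < T) (hρ : 0 < ρ) {l : ℕ}
    {D : ((Option (Fin n) →₀ ℕ) → ℂ) →ₗ[ℂ] ((Option (Fin n) →₀ ℕ) → ℂ)}
    (hD : LosesDerivatives T ρ l D) (j : Fin n) :
    LosesDerivatives T ρ (l + 1) ((coeffDeriv j).comp D) := by
  intro φ a hφ h
  have e : ∀ m : Option (Fin n) →₀ ℕ,
      φ (m none) * ((2 * m none + 1).ascFactorial (l + 1) : ℝ) * ‖a m‖ * shiftedWeight T ρ 0 m =
      φ (m none) * (2 * m none + 1 + l) * ((2 * m none + 1).ascFactorial l : ℝ) * ‖a m‖ *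
        shiftedWeight T ρ 0 m := by
    intro m
    rw [Nat.ascFactorial_succ]
    push_cast
    ring
  simp only [e] at h ⊢
  have h1 := hD (fun k => φ k * (2 * k + 1 + l)) a
    (fun k => mul_nonneg (hφ k) (by positivity)) h
  have h2 := summable_coeffDeriv hT hρ j l (D a) hφ h1.1
  refine ⟨h2.1, h2.2.trans ?_⟩
  rw [pow_succ', mul_assoc]
  exact mul_le_mul_of_nonneg_left h1.2 (by positivity)

/-- Multiplication by `t` followed by an operator losing at most `l ≤ 2` derivatives. -/
theorem exists_mul_t_operator (hT : 0 < T) (hρ : 0 < ρ) {l : ℕ} (hl : l ≤ 2)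
    {D : ((Option (Fin n) →₀ ℕ) → ℂ) →ₗ[ℂ] ((Option (Fin n) →₀ ℕ) → ℂ)}
    (hD : LosesDerivatives T ρ l D) {μ : ℕ → ℂ}
    (hμ : ∀ k, ((2 * k + 1).ascFactorial l : ℝ) * ‖μ k‖ ≤ 4) :
    ∃ S : weightedSeries (majorantWeight n hT hρ) →ₗ[ℂ] weightedSeries (majorantWeight n hT hρ),
      (∀ H, ‖S H‖ ≤ 4 * T * ρ⁻¹ ^ l * ‖H‖) ∧
      ∀ H m, wcoeff (m + Finsupp.single none 1) (S H) = D (fun m => μ (m none) * wcoeff m H) m ∧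
        (m none = 0 → wcoeff m (S H) = 0) := by
  classical
  set ω := majorantWeight n hT hρ
  let a : weightedSeries ω → (Option (Fin n) →₀ ℕ) → ℂ := fun H m => μ (m none) * wcoeff m H
  have hle : ∀ H m, (1 : ℝ) * ((2 * m none + 1).ascFactorial l : ℝ) * ‖a H m‖ *
      shiftedWeight T ρ 0 m ≤ 4 * (‖wcoeff m H‖ * ω.val m) := by
    intro H m
    have h1 : ‖a H m‖ = ‖μ (m none)‖ * ‖wcoeff m H‖ := norm_mul _ _
    rw [h1]
    calc _ = ((2 * m none + 1).ascFactorial l : ℝ) * ‖μ (m none)‖ *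
          (‖wcoeff m H‖ * shiftedWeight T ρ 0 m) := by ring
      _ ≤ 4 * (‖wcoeff m H‖ * shiftedWeight T ρ 0 m) :=
        mul_le_mul_of_nonneg_right (hμ _) (mul_nonneg (norm_nonneg _) (ω.pos m).le)
  have hs : ∀ H, Summable fun m => (1 : ℝ) * ((2 * m none + 1).ascFactorial l : ℝ) * ‖a H m‖ *
      shiftedWeight T ρ 0 m := fun H =>
    ((summable_wcoeff H).mul_left 4).of_nonneg_of_le (fun m => mul_nonneg (by positivity)
      (ω.pos m).le) (hle H)
  have hD' := fun H => hD (fun _ => 1) (a H) (fun _ => zero_le_one) (hs H)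
  have hinj : Function.Injective
      fun m : Option (Fin n) →₀ ℕ => m + Finsupp.single none 1 := add_left_injective _
  -- A product with t has no terms of t-degree 0; the case split also guards the truncated
  -- subtraction.
  let s : weightedSeries ω → (Option (Fin n) →₀ ℕ) → ℂ :=
    fun H m => if m none = 0 then 0 else D (a H) (m - Finsupp.single none 1)
  have hs1 : ∀ H m, s H (m + Finsupp.single none 1) = D (a H) m := by
    intro H m
    simp [s]
  have hs0 : ∀ H m, m none = 0 → s H m = 0 := fun H m hm => if_pos hm
  have hrange : ∀ m : Option (Fin n) →₀ ℕ,
      m ∉ Set.range (fun m : Option (Fin n) →₀ ℕ => m + Finsupp.single none 1) → m none = 0 := by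
    intro m hm
    by_contra h
    refine hm ⟨m - Finsupp.single none 1, ?_⟩
    refine tsub_add_cancel_of_le ?_
    rw [Finsupp.single_le_iff]
    omega
  have hterm : ∀ H m, ‖s H (m + Finsupp.single none 1)‖ * ω.val (m + Finsupp.single none 1) ≤
      T * (1 * ‖D (a H) m‖ * shiftedWeight T ρ l m) := by
    intro H m
    rw [hs1, one_mul]
    have := shiftedWeight_add_single_none_le hT hρ hl m
    calc _ ≤ ‖D (a H) m‖ * (T * shiftedWeight T ρ l m) :=
          mul_le_mul_of_nonneg_left this (norm_nonneg _)
      _ = _ := by ring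
  have hsum1 : ∀ H, Summable fun m => ‖s H (m + Finsupp.single none 1)‖ *
      ω.val (m + Finsupp.single none 1) := fun H =>
    ((hD' H).1.mul_left T).of_nonneg_of_le
      (fun m => mul_nonneg (norm_nonneg _) (ω.pos _).le) (hterm H)
  have hsupp : ∀ H, ∀ m ∉ Set.range (fun m : Option (Fin n) →₀ ℕ => m + Finsupp.single none 1),
      ‖s H m‖ * ω.val m = 0 := by
    intro H m hm
    rw [hs0 H m (hrange m hm), norm_zero, zero_mul]
  have hsum : ∀ H, Summable fun m => ‖s H m‖ * ω.val m := fun H =>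
    (hinj.summable_iff (hsupp H)).1 (hsum1 H)
  refine ⟨{ toFun := fun H => wmk (s H) (hsum H), map_add' := ?_, map_smul' := ?_ }, ?_, ?_⟩
  · intro H H'
    refine wcoeff_ext fun m => ?_
    rw [map_add, wcoeff_wmk, wcoeff_wmk, wcoeff_wmk]
    have : a (H + H') = a H + a H' := by
      funext m
      simp only [a, Pi.add_apply, map_add, mul_add]
    simp only [s, this, map_add, Pi.add_apply]
    split_ifs <;> simp
  · intro c H
    refine wcoeff_ext fun m => ?_
    rw [RingHom.id_apply, map_smul, wcoeff_wmk, wcoeff_wmk]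
    have : a (c • H) = c • a H := by
      funext m
      simp only [a, Pi.smul_apply, map_smul, smul_eq_mul]
      ring
    simp only [s, this, map_smul, Pi.smul_apply]
    split_ifs <;> simp
  · intro H
    change ∑' m, ‖s H m‖ * ω.val m ≤ _
    have h1 : ∑' m, ‖s H m‖ * ω.val m = ∑' m, ‖s H (m + Finsupp.single none 1)‖ *
        ω.val (m + Finsupp.single none 1) := by
      refine (hinj.tsum_eq (f := fun m => ‖s H m‖ * ω.val m) fun m hm => ?_).symm
      by_contra h
      exact hm (hsupp H m h)
    rw [h1]
    refine ((hsum1 H).tsum_le_tsum (hterm H) ((hD' H).1.mul_left T)).trans ?_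
    rw [tsum_mul_left]
    have h2 : ∑' m, (1 : ℝ) * ((2 * m none + 1).ascFactorial l : ℝ) * ‖a H m‖ *
        shiftedWeight T ρ 0 m ≤ 4 * ‖H‖ := by
      rw [wnorm_def, ← tsum_mul_left]
      exact (hs H).tsum_le_tsum (hle H) ((summable_wcoeff H).mul_left 4)
    calc _ ≤ T * (ρ⁻¹ ^ l * (4 * ‖H‖)) := by
          refine mul_le_mul_of_nonneg_left ((hD' H).2.trans ?_) hT.le
          exact mul_le_mul_of_nonneg_left h2 (by positivity)
      _ = _ := by ring
  · intro H m
    exact ⟨hs1 H m, hs0 H m⟩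

/-- Multiplication of the coefficients by a bounded sequence. -/
theorem exists_multiplier {σ : Type*} (ω : Weight σ) {μ : (σ →₀ ℕ) → ℂ} (hμ : ∀ m, ‖μ m‖ ≤ 1) :
    ∃ S : weightedSeries ω →ₗ[ℂ] weightedSeries ω, (∀ H, ‖S H‖ ≤ ‖H‖) ∧
      ∀ H m, wcoeff m (S H) = μ m * wcoeff m H := by
  have hle : ∀ (H : weightedSeries ω) m, ‖μ m * wcoeff m H‖ * ω.val m ≤ ‖wcoeff m H‖ * ω.val m := by
    intro H m
    rw [norm_mul]
    exact mul_le_mul_of_nonneg_right (mul_le_of_le_one_left (norm_nonneg _) (hμ m)) (ω.pos m).le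
  have hs : ∀ H : weightedSeries ω, Summable fun m => ‖μ m * wcoeff m H‖ * ω.val m := fun H =>
    (summable_wcoeff H).of_nonneg_of_le (fun m => mul_nonneg (norm_nonneg _) (ω.pos m).le) (hle H)
  refine ⟨{ toFun := fun H => wmk _ (hs H), map_add' := ?_, map_smul' := ?_ }, ?_, ?_⟩
  · intro H H'
    refine wcoeff_ext fun m => ?_
    rw [map_add, wcoeff_wmk, wcoeff_wmk, wcoeff_wmk, map_add, mul_add]
  · intro c H
    refine wcoeff_ext fun m => ?_
    rw [RingHom.id_apply, map_smul, wcoeff_wmk, wcoeff_wmk, map_smul, smul_eq_mul, smul_eq_mul]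
    ring
  · intro H
    exact (hs H).tsum_le_tsum (hle H) (summable_wcoeff H)
  · intro H m
    rfl

theorem monEval_eq_prod {σ : Type*} [Fintype σ] (y : σ → ℂ) (m : σ →₀ ℕ) :
    monEval y m = ∏ i, y i ^ m i :=
  Finsupp.prod_fintype _ _ fun _ => pow_zero _

/-- The radii T/4 and ρ/2 come from binom(2k+b, b) ≤ 2^{2k+b} = 4^k 2^b. -/
theorem isEvalPoint_majorantWeight (hT : 0 < T) (hρ : 0 < ρ) {y : Option (Fin n) → ℂ}
    (ht : ‖y none‖ ≤ T / 4) (hx : ∀ j, ‖y (some j)‖ ≤ ρ / 2) :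
    IsEvalPoint (majorantWeight n hT hρ) y := by
  intro m
  rw [monEval_eq_prod, Fintype.prod_option, norm_mul, norm_prod]
  simp only [norm_pow]
  have h1 : ∏ j, ‖y (some j)‖ ^ m (some j) ≤ (ρ / 2) ^ xdeg m := by
    rw [xdeg, ← Finset.prod_pow_eq_pow_sum]
    exact Finset.prod_le_prod (fun _ _ => by positivity) fun j _ =>
      pow_le_pow_left₀ (norm_nonneg _) (hx j) _
  have h2 : ((2 * m none + 0 + xdeg m).choose (xdeg m) : ℝ) ≤ 4 ^ m none * 2 ^ xdeg m := by
    have := Nat.choose_le_two_pow (2 * m none + 0 + xdeg m) (xdeg m)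
    calc _ ≤ ((2 ^ (2 * m none + 0 + xdeg m) : ℕ) : ℝ) := by exact_mod_cast this
      _ = _ := by push_cast; rw [pow_add, add_zero, pow_mul]; norm_num
  rw [val_majorantWeight, shiftedWeight]
  calc _ ≤ (T / 4) ^ m none * (ρ / 2) ^ xdeg m := by gcongr
    _ = T ^ m none * ρ ^ xdeg m / (4 ^ m none * 2 ^ xdeg m) := by
      rw [div_pow, div_pow, div_mul_div_comm]
    _ ≤ _ := div_le_div_of_nonneg_left (by positivity) (choose_shift_pos _ _ _) h2

end Majorant

end Fuchs

namespace Fuchs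

/-! ### Termwise differentiation and analyticity of power series -/

section Termwise

variable {σ : Type*} [Fintype σ] {r : ℝ} {a : (σ →₀ ℕ) → ℂ}

/-- Absolute convergence of the power series with coefficients `a` on the polydisc of radius `r`. -/
def ConvergesOn (r : ℝ) (a : (σ →₀ ℕ) → ℂ) : Prop :=
  ∀ y : σ → ℂ, (∀ i, ‖y i‖ < r) → Summable fun m => ‖a m * monEval y m‖

theorem monEval_update [DecidableEq σ] (y : σ → ℂ) (i : σ) (ζ : ℂ) (m : σ →₀ ℕ) :
    monEval (Function.update y i ζ) m = ζ ^ m i * monEval y (m.erase i) := by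
  rw [monEval_eq_prod, monEval_eq_prod, ← Finset.mul_prod_erase _ _ (Finset.mem_univ i),
    ← Finset.mul_prod_erase _ (fun j => y j ^ (m.erase i) j) (Finset.mem_univ i)]
  simp only [Function.update_self, Finsupp.erase_same, pow_zero, one_mul]
  congr 1
  refine Finset.prod_congr rfl fun j hj => ?_
  have := Finset.ne_of_mem_erase hj
  rw [Function.update_of_ne this, Finsupp.erase_ne this]

theorem hasDerivAt_monEval [DecidableEq σ] (y : σ → ℂ) (i : σ) (ζ : ℂ) (m : σ →₀ ℕ) :
    HasDerivAt (fun ζ => monEval (Function.update y i ζ) m)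
      (m i * ζ ^ (m i - 1) * monEval y (m.erase i)) ζ := by
  simp only [monEval_update]
  exact (hasDerivAt_pow _ _).mul_const _

/-- With i-th coordinate ζ, |ζ| < r' < r, the terms are dominated by those with coordinate r', still
in the polydisc, so the series converges locally uniformly. -/
theorem ConvergesOn.hasSum_deriv [DecidableEq σ] (ha : ConvergesOn r a) {y : σ → ℂ}
    (hy : ∀ i, ‖y i‖ < r) (i : σ) :
    HasSum (fun m => a m * (m i * y i ^ (m i - 1) * monEval y (m.erase i)))
      (deriv (fun ζ => ∑' m, a m * monEval (Function.update y i ζ) m) (y i)) := by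
  obtain ⟨r', h1, h2⟩ := exists_between (hy i)
  have hr' : 0 ≤ r' := (norm_nonneg _).trans h1.le
  have hy' : ∀ k, ‖Function.update y i (r' : ℂ) k‖ < r := by
    intro k
    by_cases hk : k = i
    · subst hk
      rw [Function.update_self, Complex.norm_real, Real.norm_of_nonneg hr']
      exact h2
    · rw [Function.update_of_ne hk]
      exact hy k
  have hd : ∀ m ζ, HasDerivAt (fun ζ => a m * monEval (Function.update y i ζ) m)
      (a m * (m i * ζ ^ (m i - 1) * monEval y (m.erase i))) ζ :=
    fun m ζ => (hasDerivAt_monEval y i ζ m).const_mul _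
  have := Complex.hasSum_deriv_of_summable_norm (ha _ hy')
    (fun m ζ _ => (hd m ζ).differentiableAt.differentiableWithinAt) Metric.isOpen_ball
    (fun m ζ (hζ : ζ ∈ Metric.ball 0 r') => by
      rw [monEval_update, monEval_update, norm_mul, norm_mul, norm_mul, norm_mul, norm_pow,
        norm_pow, Complex.norm_real, Real.norm_of_nonneg hr']
      have := (mem_ball_zero_iff.1 hζ).le
      gcongr) (mem_ball_zero_iff.2 h1)
  simpa only [(hd _ _).deriv] using this

theorem ConvergesOn.hasSum_shift [DecidableEq σ] (ha : ConvergesOn r a) {y : σ → ℂ}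
    (hy : ∀ i, ‖y i‖ < r) (i : σ) :
    HasSum (fun m => (m i + 1) * a (m + Finsupp.single i 1) * monEval y m)
      (deriv (fun ζ => ∑' m, a m * monEval (Function.update y i ζ) m) (y i)) := by
  have hinj : Function.Injective fun m : σ →₀ ℕ => m + Finsupp.single i 1 := add_left_injective _
  have h := (hinj.hasSum_iff (fun m hm => ?_)).2 (ha.hasSum_deriv hy i)
  · refine h.congr_fun fun m => ?_
    have h1 : (m + Finsupp.single i 1 : σ →₀ ℕ).erase i = m.erase i := by
      ext j
      by_cases hj : j = i
      · subst hj; simp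
      · simp [Finsupp.erase_ne hj]
    have h2 : (m + Finsupp.single i 1 : σ →₀ ℕ) i = m i + 1 := by simp
    have h3 := monEval_update y i (y i) m
    rw [Function.update_eq_self] at h3
    simp only [Function.comp_apply, h1, h2, Nat.add_sub_cancel, h3]
    push_cast
    ring
  · have hm0 : m i = 0 := by
      by_contra h
      refine hm ⟨m - Finsupp.single i 1, tsub_add_cancel_of_le ?_⟩
      rw [Finsupp.single_le_iff]
      omega
    rw [hm0]
    simp

theorem ConvergesOn.hasSum_mul [DecidableEq σ] (ha : ConvergesOn r a) {y : σ → ℂ}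
    (hy : ∀ i, ‖y i‖ < r) (i : σ) :
    HasSum (fun m => m i * a m * monEval y m)
      (y i * deriv (fun ζ => ∑' m, a m * monEval (Function.update y i ζ) m) (y i)) := by
  refine ((ha.hasSum_deriv hy i).mul_left (y i)).congr_fun fun m => ?_
  have h3 := monEval_update y i (y i) m
  rw [Function.update_eq_self] at h3
  rw [h3]
  rcases Nat.eq_zero_or_pos (m i) with h | h
  · simp [h]
  · obtain ⟨k, hk⟩ : ∃ k, m i = k + 1 := ⟨m i - 1, by omega⟩
    rw [hk, Nat.add_sub_cancel, pow_succ]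
    ring

/-- The word in which the letter `i` occurs `m i` times. -/
noncomputable def expWord (m : σ →₀ ℕ) : List σ := (Finsupp.toMultiset m).toList

omit [Fintype σ] in
theorem prod_map_expWord (y : σ → ℂ) (m : σ →₀ ℕ) : ((expWord m).map y).prod = monEval y m := by
  rw [← Multiset.prod_coe, ← Multiset.map_coe, expWord, Multiset.coe_toList,
    Finsupp.toMultiset_map, Finsupp.prod_toMultiset,
    Finsupp.prod_mapDomain_index (fun _ => pow_zero _) fun _ _ _ => pow_add _ _ _]
  rfl

/-- Several indices may carry the same word; adding coefficients along the fibres of W reduces to a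
series indexed by words. -/
theorem analyticOnNhd_wordSum {I : Type*} {c : I → ℂ} {W : I → List σ} (hr : 0 < r)
    (hc : Summable fun i => ‖c i‖ * r ^ (W i).length) :
    AnalyticOnNhd ℂ (fun y : σ → ℂ => wordSum c W y) (Metric.ball 0 r) := by
  have hlen : ∀ v (b : W ⁻¹' {v}), W b.1 = v := fun v b => b.2
  have hfib : ∀ v, Summable fun b : W ⁻¹' {v} => ‖c b‖ := by
    intro v
    have := (hc.subtype (W ⁻¹' {v})).mul_right (r ^ v.length)⁻¹
    refine this.congr fun b => ?_
    simp only [Function.comp_apply, hlen v b]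
    rw [mul_assoc, mul_inv_cancel₀ (by positivity), mul_one]
  have hs : Summable fun v => ‖∑' b : W ⁻¹' {v}, c b‖ * r ^ v.length := by
    refine (hc.hasSum.tsum_fiberwise W).summable.of_nonneg_of_le (fun v => by positivity)
      fun v => ?_
    simp only [hlen v]
    rw [tsum_mul_right]
    exact mul_le_mul_of_nonneg_right (norm_tsum_le_tsum_norm (hfib v)) (by positivity)
  refine (analyticOnNhd_of_words hr hs).congr Metric.isOpen_ball fun y hy => ?_
  have h := (summable_wordSum hc hr.le fun j =>
    (norm_le_pi_norm y j).trans (mem_ball_zero_iff.1 hy).le).hasSum.tsum_fiberwise W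
  refine Eq.trans (tsum_congr fun v => ?_) h.tsum_eq
  simp only [hlen v, smul_eq_mul]
  rw [tsum_mul_right]

theorem ConvergesOn.analyticOnNhd (ha : ConvergesOn r a) :
    AnalyticOnNhd ℂ (fun y : σ → ℂ => ∑' m, a m * monEval y m) (Metric.ball 0 r) := by
  intro y hy
  obtain ⟨r', h1, h2⟩ := exists_between (mem_ball_zero_iff.1 hy)
  have hr' : 0 < r' := (norm_nonneg _).trans_lt h1
  have hs := ha (fun _ => (r' : ℂ)) fun _ => by
    rwa [Complex.norm_real, Real.norm_of_nonneg hr'.le]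
  have hs' : Summable fun m => ‖a m‖ * r' ^ (expWord m).length := by
    refine hs.congr fun m => ?_
    rw [norm_mul, ← prod_map_expWord, List.map_const', List.prod_replicate, norm_pow,
      Complex.norm_real, Real.norm_of_nonneg hr'.le]
  refine (analyticOnNhd_wordSum hr' hs' y (mem_ball_zero_iff.2 h1)).congr ?_
  refine Filter.Eventually.of_forall fun z => ?_
  simp only [wordSum, prod_map_expWord, smul_eq_mul]

end Termwise

/-! ### Power series in (t, x) and the operators ∂/∂x_j and t∂/∂t -/

section PowerSeries

variable {n : ℕ} {r : ℝ} {a : (Option (Fin n) →₀ ℕ) → ℂ}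

/-- The coordinates of a point `(t, x)`, as a family indexed by `Option (Fin n)`. -/
def coords (p : ℂ × (Fin n → ℂ)) : Option (Fin n) → ℂ := fun o => o.elim p.1 p.2

theorem norm_coords_lt {p : ℂ × (Fin n → ℂ)} (hp : ‖p‖ < r) : ∀ i, ‖coords p i‖ < r
  | none => (norm_fst_le p).trans_lt hp
  | some j => ((norm_le_pi_norm p.2 j).trans (norm_snd_le p)).trans_lt hp

theorem analyticAt_coords (p : ℂ × (Fin n → ℂ)) : AnalyticAt ℂ coords p := by
  rw [analyticAt_pi_iff]
  rintro (_ | j)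
  · exact analyticAt_fst
  · exact (analyticAt_pi_iff.1 analyticAt_snd) j

/-- The sum of the power series in `(t, x)` with the coefficients `a`. -/
noncomputable def psum (a : (Option (Fin n) →₀ ℕ) → ℂ) (p : ℂ × (Fin n → ℂ)) : ℂ :=
  ∑' m, a m * monEval (coords p) m

theorem ConvergesOn.analyticAt_psum (ha : ConvergesOn r a) {p : ℂ × (Fin n → ℂ)} (hp : ‖p‖ < r) :
    AnalyticAt ℂ (psum a) p := by
  have hr : 0 < r := (norm_nonneg _).trans_lt hp
  refine AnalyticAt.fun_comp (g := fun y => ∑' m, a m * monEval y m) (ha.analyticOnNhd _ ?_)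
    (analyticAt_coords p)
  rw [mem_ball_zero_iff, pi_norm_lt_iff hr]
  exact norm_coords_lt hp

theorem ConvergesOn.coeffDeriv (ha : ConvergesOn r a) (j : Fin n) :
    ConvergesOn r (coeffDeriv j a) := fun _ hy => (ha.hasSum_shift hy (some j)).summable.norm

theorem ConvergesOn.dxj_psum (ha : ConvergesOn r a) (j : Fin n) {p : ℂ × (Fin n → ℂ)}
    (hp : ‖p‖ < r) : dxj j (psum a) p = psum (Fuchs.coeffDeriv j a) p := by
  have h := (ha.hasSum_shift (norm_coords_lt hp) (some j)).tsum_eq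
  rw [psum, dxj]
  refine Eq.trans ?_ h.symm
  have e : ∀ ζ, coords (p.1, Function.update p.2 j ζ) = Function.update (coords p) (some j) ζ := by
    intro ζ
    funext o
    rcases o with _ | i
    · rfl
    · by_cases hi : i = j
      · subst hi; simp [coords]
      · simp [coords, hi]
  simp only [psum, e]
  rfl

theorem ConvergesOn.tdeg_mul (ha : ConvergesOn r a) : ConvergesOn r fun m => m none * a m :=
  fun _ hy => (ha.hasSum_mul hy none).summable.norm

theorem ConvergesOn.euler_psum (ha : ConvergesOn r a) {p : ℂ × (Fin n → ℂ)}
    (hp : ‖p‖ < r) : euler (psum a) p = psum (fun m => m none * a m) p := by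
  have h := (ha.hasSum_mul (norm_coords_lt hp) none).tsum_eq
  rw [psum, euler]
  refine Eq.trans ?_ h.symm
  have e : ∀ ζ, coords (ζ, p.2) = Function.update (coords p) none ζ := by
    intro ζ
    funext o
    rcases o with _ | i
    · rfl
    · simp [coords]
  change p.1 * deriv (fun ζ => ∑' m, a m * monEval (coords (ζ, p.2)) m) p.1 = _
  have e' : (fun ζ => ∑' m, a m * monEval (coords (ζ, p.2)) m) =
      fun ζ => ∑' m, a m * monEval (Function.update (coords p) none ζ) m :=
    funext fun ζ => by rw [e]
  rw [e']
  rfl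

/-- Term by term differentiation with respect to `x`. -/
theorem exists_dx_psum {T ρ : ℝ} (hT : 0 < T) (hρ : 0 < ρ) (r : ℝ) (α : Fin n → ℕ) :
    ∃ D : ((Option (Fin n) →₀ ℕ) → ℂ) →ₗ[ℂ] ((Option (Fin n) →₀ ℕ) → ℂ),
      LosesDerivatives T ρ (∑ j, α j) D ∧ ∀ a, ConvergesOn r a → ConvergesOn r (D a) ∧
        ∀ p, ‖p‖ < r → dx α (psum a) p = psum (D a) p := by
  obtain ⟨D, hD, h⟩ := dx_induction (κ := {a : (Option (Fin n) →₀ ℕ) → ℂ // ConvergesOn r a})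
    (fun l F => ∃ D : ((Option (Fin n) →₀ ℕ) → ℂ) →ₗ[ℂ] ((Option (Fin n) →₀ ℕ) → ℂ),
      LosesDerivatives T ρ l D ∧ ∀ a, ConvergesOn r (D a.1) ∧
        ∀ p, ‖p‖ < r → F a p = psum (D a.1) p)
    (fun l j F ⟨D, hD, h⟩ => by
      refine ⟨(coeffDeriv j).comp D, hD.coeffDeriv_comp hT hρ j, fun a => ⟨(h a).1.coeffDeriv j,
        fun p hp => ?_⟩⟩
      have hev : F a =ᶠ[𝓝 p] psum (D a.1) :=
        (continuous_norm.continuousAt.eventually_lt_const hp).mono fun q hq => (h a).2 q hq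
      exact (dxj_congr j hev).self_of_nhds.trans ((h a).1.dxj_psum j hp))
    (fun a => psum a.1)
    ⟨LinearMap.id, losesDerivatives_id, fun a => ⟨a.2, fun p _ => rfl⟩⟩ α
  exact ⟨D, hD, fun a ha => h ⟨a, ha⟩⟩

end PowerSeries

end Fuchs

/-! ### Division by a coordinate and second-order expansion of F(t, x, tz) -/

namespace Fuchs

/-- An analytic function vanishing for `y i₀ = 0` is divisible by `y i₀`. -/
theorem exists_eq_mul_of_eq_zero {ι : Type*} [Fintype ι] {f : (ι → ℂ) → ℂ}
    (hf : AnalyticAt ℂ f 0) (i₀ : ι) (h : ∀ᶠ y in 𝓝 (0 : ι → ℂ), y i₀ = 0 → f y = 0) :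
    ∃ g : (ι → ℂ) → ℂ, AnalyticAt ℂ g 0 ∧ ∀ᶠ y in 𝓝 (0 : ι → ℂ), f y = y i₀ * g y := by
  classical
  obtain ⟨c, r, hr, hc, hf'⟩ := analyticAt_exists_words hf
  -- Division by y i₀ removes one letter i₀. Different words may become equal, which a family of
  -- words indexed by a separate type allows.
  let W : {w : List ι // i₀ ∈ w} → List ι := fun w => w.1.erase i₀
  have hW : Summable fun w : {w : List ι // i₀ ∈ w} => ‖c w‖ * r ^ (W w).length := by
    refine ((hc.subtype {w | i₀ ∈ w}).mul_left r⁻¹).congr fun w => ?_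
    have h1 : w.1.length = (W w).length + 1 := by
      have := List.length_erase_add_one w.2
      exact this.symm
    simp only [Function.comp_apply, h1, pow_succ]
    field_simp
  refine ⟨fun y => wordSum (fun w : {w : List ι // i₀ ∈ w} => c w) W y,
    analyticOnNhd_wordSum hr hW 0 (Metric.mem_ball_self hr), ?_⟩
  have hcont : ContinuousAt (fun y : ι → ℂ => Function.update y i₀ 0) 0 := by fun_prop
  have h0 : Function.update (0 : ι → ℂ) i₀ (0 : ℂ) = 0 := Function.update_eq_self i₀ (0 : ι → ℂ)
  have h1 : ∀ᶠ y in 𝓝 (0 : ι → ℂ), f (Function.update y i₀ 0) = 0 := by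
    have := hcont.eventually (p := fun y => y i₀ = 0 → f y = 0) (by rw [← h0] at h; exact h)
    filter_upwards [this] with y hy
    exact hy (Function.update_self ..)
  have hball : ∀ᶠ y in 𝓝 (0 : ι → ℂ), ‖y‖ < r :=
    continuous_norm.continuousAt.eventually_lt_const (by simpa using hr)
  have hball' : ∀ᶠ y in 𝓝 (0 : ι → ℂ), ‖Function.update y i₀ 0‖ < r :=
    hcont.eventually (p := fun y => ‖y‖ < r) (by rw [← h0] at hball; exact hball)
  filter_upwards [h1, hball, hball'] with y hy1 hy2 hy3
  -- Subtracting the vanishing value at y i₀ = 0 cancels the words without i₀ and leaves the others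
  -- unchanged.
  have hs := (hf' y hy2).sub (hf' _ hy3)
  rw [hy1, sub_zero] at hs
  have hmap : ∀ w : List ι, i₀ ∉ w →
      (w.map (Function.update y i₀ 0)).prod = (w.map y).prod := by
    intro w hw
    congr 1
    refine List.map_congr_left fun a ha => Function.update_of_ne ?_ _ _
    rintro rfl
    exact hw ha
  have hzero : ∀ w : List ι, i₀ ∈ w → (w.map (Function.update y i₀ 0)).prod = 0 := by
    intro w hw
    exact List.prod_eq_zero (List.mem_map.2 ⟨i₀, hw, Function.update_self ..⟩)
  have hs2 : HasSum (fun w : {w : List ι // i₀ ∈ w} => c w * (w.1.map y).prod) (f y) := by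
    have := (Subtype.val_injective (p := fun w : List ι => i₀ ∈ w)).hasSum_iff
      (f := fun w => c w * (w.map y).prod - c w * (w.map (Function.update y i₀ 0)).prod)
      (a := f y) fun w hw => ?_
    · refine (this.2 hs).congr_fun fun w => ?_
      simp only [Function.comp_apply, hzero w.1 w.2, mul_zero, sub_zero]
    · rw [Subtype.range_coe_subtype, Set.mem_ofPred_eq] at hw
      simp only [hmap w hw, sub_self]
  rw [wordSum, ← tsum_mul_left, ← hs2.tsum_eq]
  refine tsum_congr fun w => ?_
  rw [← List.prod_map_erase y w.2, smul_eq_mul]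
  ring

section Remainder

variable {n : ℕ} {F : JetSpace n → ℂ}

/-- The coordinates of `(t, x)` in a family `y` which stands for `(t, x, ζ)`. -/
def baseOf {X : Type*} (y : Option (Fin n ⊕ X) → ℂ) : ℂ × (Fin n → ℂ) :=
  (y none, fun j => y (some (.inl j)))

/-- The coordinates of `ζ` in a family `y` which stands for `(t, x, ζ)`. -/
def fiberOf {X : Type*} (y : Option (Fin n ⊕ X) → ℂ) : X → ℂ := fun q => y (some (.inr q))

theorem analyticAt_eval {ι : Type*} [Fintype ι] (i : ι) (y : ι → ℂ) :
    AnalyticAt ℂ (fun y : ι → ℂ => y i) y :=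
  (ContinuousLinearMap.proj (R := ℂ) (φ := fun _ : ι => ℂ) i).analyticAt y

theorem analyticAt_baseOf {X : Type*} [Fintype X] (y : Option (Fin n ⊕ X) → ℂ) :
    AnalyticAt ℂ (baseOf (n := n) (X := X)) y :=
  (analyticAt_eval _ _).prod (analyticAt_pi_iff.2 fun _ => analyticAt_eval _ _)

theorem analyticAt_fiberOf {X : Type*} [Fintype X] (y : Option (Fin n ⊕ X) → ℂ) :
    AnalyticAt ℂ (fiberOf (n := n) (X := X)) y :=
  analyticAt_pi_iff.2 fun _ => analyticAt_eval _ _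

theorem baseOf_update {X : Type*} [DecidableEq X] (y : Option (Fin n ⊕ X) → ℂ) (ζ : ℂ) :
    baseOf (Function.update y none ζ) = (ζ, (baseOf y).2) := by
  simp [baseOf]

theorem fiberOf_update {X : Type*} [DecidableEq X] (y : Option (Fin n ⊕ X) → ℂ) (ζ : ℂ) :
    fiberOf (Function.update y none ζ) = fiberOf y := by
  funext q
  simp [fiberOf]

/-- The partial derivative `∂F/∂t` at `(0, x, 0)`. -/
noncomputable def dt (F : JetSpace n → ℂ) (x : Fin n → ℂ) : ℂ := fderiv ℂ F (0, x, 0) (1, 0, 0)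

/-- The linear part of `F(t, x, t z) / t` at `t = 0`. -/
noncomputable def linPart (F : JetSpace n → ℂ) (x : Fin n → ℂ) (z : Lam n → ℂ) : ℂ :=
  dt F x + (dz (idx10 n) F (0, x, 0) * z (idx10 n) + dz (idx00 n) F (0, x, 0) * z (idx00 n))

theorem analyticAt_dt {x₀ : Fin n → ℂ} (hF : AnalyticAt ℂ F (0, x₀, 0)) :
    AnalyticAt ℂ (dt F) x₀ := by
  have hι : AnalyticAt ℂ (fun x : Fin n → ℂ => ((0, x, 0) : JetSpace n)) x₀ :=
    analyticAt_const.prod (analyticAt_id.prod analyticAt_const)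
  exact ((ContinuousLinearMap.apply ℂ ℂ ((1, 0, 0) : JetSpace n)).analyticAt _).fun_comp
    (AnalyticAt.fun_comp (f := fun x : Fin n → ℂ => ((0, x, 0) : JetSpace n)) hF.fderiv hι)

theorem analyticAt_linPart {X : Type*} [NormedAddCommGroup X] [NormedSpace ℂ X] {y₀ : X}
    {ξ : X → Fin n → ℂ} {z : X → Lam n → ℂ} (hF : AnalyticAt ℂ F (0, ξ y₀, 0))
    (hξ : AnalyticAt ℂ ξ y₀) (hz : AnalyticAt ℂ z y₀) :
    AnalyticAt ℂ (fun y => linPart F (ξ y) (z y)) y₀ := by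
  have hz' := fun q => (analyticAt_pi_iff.1 hz) q
  have hc := fun q => (analyticAt_dz q hF).fun_comp hξ
  exact ((analyticAt_dt hF).fun_comp hξ).add
    (((hc _).mul (hz' _)).add ((hc _).mul (hz' _)))

/-- The index set of the variables `(t, x, z)`. -/
abbrev JetIndex (n : ℕ) : Type := Option (Fin n ⊕ Lam n)

/-- The expansion of `F(t, x, t z)` to the second order in `t`, where `z = Z(t, x) + ζ`. -/
theorem exists_remainder (hF : AnalyticAt ℂ F (0, 0, 0))
    (hA2 : ∀ᶠ x in 𝓝 (0 : Fin n → ℂ), F (0, x, 0) = 0)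
    (hA3 : ∀ᶠ x in 𝓝 (0 : Fin n → ℂ), ∀ q : Lam n, 0 < ∑ j, q.1.2 j → dz q F (0, x, 0) = 0)
    {Z : ℂ × (Fin n → ℂ) → Lam n → ℂ} (hZ : AnalyticAt ℂ Z (0, 0)) :
    ∃ K : (JetIndex n → ℂ) → ℂ, AnalyticAt ℂ K 0 ∧
      ∀ᶠ y in 𝓝 (0 : JetIndex n → ℂ),
        F (y none, (baseOf y).2, y none • (Z (baseOf y) + fiberOf y)) =
          y none * linPart F (baseOf y).2 (Z (baseOf y) + fiberOf y) + y none ^ 2 * K y := by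
  classical
  let z : (JetIndex n → ℂ) → Lam n → ℂ := fun y => Z (baseOf y) + fiberOf y
  let G : (JetIndex n → ℂ) → ℂ := fun y =>
    F (y none, (baseOf y).2, y none • z y) - y none * linPart F (baseOf y).2 (z y)
  have hb0 : baseOf (0 : JetIndex n → ℂ) = (0, 0) := rfl
  have ht : AnalyticAt ℂ (fun y : JetIndex n → ℂ => y none) 0 := analyticAt_eval _ _
  have hx : AnalyticAt ℂ (fun y : JetIndex n → ℂ => (baseOf y).2) 0 :=
    analyticAt_snd.fun_comp (analyticAt_baseOf _)
  have hz : AnalyticAt ℂ z 0 :=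
    (AnalyticAt.fun_comp (by rwa [hb0]) (analyticAt_baseOf _)).add (analyticAt_fiberOf _)
  have hG : AnalyticAt ℂ G 0 := by
    refine AnalyticAt.sub ?_ (ht.mul (analyticAt_linPart hF hx hz))
    refine AnalyticAt.fun_comp (g := F) (f := fun y : JetIndex n → ℂ => (y none, (baseOf y).2, y none • z y)) ?_
      (ht.prod (hx.prod (ht.smul hz)))
    have e : (0 : JetIndex n → ℂ) none • z 0 = 0 := zero_smul ℂ (z 0)
    rw [e]
    exact hF
  have hA2' : ∀ᶠ y in 𝓝 (0 : JetIndex n → ℂ), F (0, (baseOf y).2, 0) = 0 :=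
    hx.continuousAt.eventually hA2
  have hA3' : ∀ᶠ y in 𝓝 (0 : JetIndex n → ℂ), ∀ q : Lam n, 0 < ∑ j, q.1.2 j →
      dz q F (0, (baseOf y).2, 0) = 0 := hx.continuousAt.eventually hA3
  have hF' : ∀ᶠ y in 𝓝 (0 : JetIndex n → ℂ), AnalyticAt ℂ F (0, (baseOf y).2, 0) := by
    have hc : ContinuousAt (fun y : JetIndex n → ℂ => ((0, (baseOf y).2, 0) : JetSpace n)) 0 :=
      continuousAt_const.prodMk (hx.continuousAt.prodMk continuousAt_const)
    exact hc.eventually hF.eventually_analyticAt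
  have hZ' : ∀ᶠ y in 𝓝 (0 : JetIndex n → ℂ), AnalyticAt ℂ Z (baseOf y) :=
    (analyticAt_baseOf (0 : JetIndex n → ℂ)).continuousAt.eventually hZ.eventually_analyticAt
  obtain ⟨g, hg, hGg⟩ := exists_eq_mul_of_eq_zero hG none (by
    filter_upwards [hA2'] with y hy h0
    simp only [G, h0, zero_smul, hy, zero_mul, sub_zero])
  -- The second division needs g = 0 at t = 0. There g is ∂G/∂t, and the chain rule together with
  -- (A₃) shows that the derivative of F(t, x, tz) equals the linear part subtracted in G.
  obtain ⟨K, hK, hgK⟩ := exists_eq_mul_of_eq_zero hg none (by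
    filter_upwards [hGg.eventually_nhds, hA3', hF', hZ', hg.eventually_analyticAt]
      with y hy hy3 hyF hyZ hyg h0
    have hup : Function.update y none 0 = y := by rw [← h0, Function.update_eq_self]
    have hbase : baseOf y = (0, (baseOf y).2) := by rw [← h0]; rfl
    have hcu : ∀ ζ, ContinuousAt (fun ζ : ℂ => Function.update y none ζ) ζ := by
      intro ζ; fun_prop
    have hd1 : HasDerivAt (fun ζ : ℂ => G (Function.update y none ζ)) (g y) 0 := by
      have hgd : DifferentiableAt ℂ (fun ζ : ℂ => g (Function.update y none ζ)) 0 := by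
        refine DifferentiableAt.comp (g := g) (0 : ℂ) ?_ (hasDerivAt_update y none 0).differentiableAt
        rw [hup]; exact hyg.differentiableAt
      have h1 := (hasDerivAt_id (0 : ℂ)).mul hgd.hasDerivAt
      simp only [hup, id_eq, zero_mul, add_zero, one_mul] at h1
      refine h1.congr_of_eventuallyEq ?_
      have := (hcu 0).eventually (p := fun y => G y = y none * g y) (by
        change ∀ᶠ y in 𝓝 (Function.update y none 0), _
        rwa [hup])
      filter_upwards [this] with ζ hζ
      rw [hζ, Function.update_self]
      rfl
    have hd2 : HasDerivAt (fun ζ : ℂ => G (Function.update y none ζ)) 0 0 := by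
      have hb : HasDerivAt (fun ζ : ℂ => (ζ, (baseOf y).2)) (1, 0) 0 :=
        (hasDerivAt_id _).prodMk (hasDerivAt_const _ _)
      have hzd : DifferentiableAt ℂ (fun ζ : ℂ => Z (ζ, (baseOf y).2) + fiberOf y) 0 := by
        refine DifferentiableAt.add_const _ (DifferentiableAt.comp (g := Z) (0 : ℂ) ?_
          hb.differentiableAt)
        rw [← hbase]; exact hyZ.differentiableAt
      have hsm := (hasDerivAt_id (0 : ℂ)).smul hzd.hasDerivAt
      simp only [id_eq, zero_smul, zero_add, one_smul] at hsm
      have hcurve : HasDerivAt (fun ζ : ℂ => ((ζ, (baseOf y).2, ζ • (Z (ζ, (baseOf y).2) + fiberOf y)) :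
          JetSpace n)) (1, 0, z y) 0 := by
        refine (hasDerivAt_id _).prodMk ((hasDerivAt_const _ _).prodMk ?_)
        simp only [z]
        rw [hbase]
        exact hsm
      have hFc : HasDerivAt (fun ζ : ℂ => F (ζ, (baseOf y).2, ζ • (Z (ζ, (baseOf y).2) + fiberOf y)))
          (fderiv ℂ F (0, (baseOf y).2, 0) (1, 0, z y)) 0 := by
        refine HasFDerivAt.comp_hasDerivAt (l := F) (0 : ℂ) ?_ hcurve
        rw [zero_smul]
        exact hyF.differentiableAt.hasFDerivAt
      have hlin : DifferentiableAt ℂ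
          (fun ζ : ℂ => linPart F (baseOf y).2 (Z (ζ, (baseOf y).2) + fiberOf y)) 0 := by
        have hq := fun q => differentiableAt_pi.1 hzd q
        unfold linPart
        exact ((((hq _).const_mul _).add ((hq _).const_mul _)).const_add _)
      have hl := (hasDerivAt_id (0 : ℂ)).mul hlin.hasDerivAt
      simp only [id_eq, zero_mul, add_zero, one_mul] at hl
      have h2 := hFc.sub hl
      have hval : fderiv ℂ F (0, (baseOf y).2, 0) (1, 0, z y) =
          linPart F (baseOf y).2 (Z (0, (baseOf y).2) + fiberOf y) := by
        have e : ((1, 0, z y) : JetSpace n) = (1, 0, 0) + (0, 0, z y) := by simp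
        rw [e, map_add, fderiv_apply_jet hyF, sum_dz_mul hy3, linPart, dt, ← hbase]
      rw [hval, sub_self] at h2
      refine h2.congr_of_eventuallyEq (Filter.Eventually.of_forall fun ζ => ?_)
      simp only [G, z, Function.update_self, baseOf_update, fiberOf_update]
      rfl
    exact hd1.unique hd2)
  refine ⟨K, hK, ?_⟩
  filter_upwards [hGg, hgK] with y h1 h2
  rw [h2] at h1
  simp only [G, z] at h1
  linear_combination h1

end Remainder

end Fuchs

namespace Fuchs

/-! ### The contraction for the transformed equation -/

section FixedPoint

variable {n : ℕ}

/-- Each root λ has Re λ < 0, so |x - λ| ≥ x - Re λ ≥ x for real x ≥ 0. -/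
theorem sq_le_norm_charPoly {c₁ c₀ : ℂ}
    (hroot : ∀ lam : ℂ, lam ^ 2 - (c₁ * lam + c₀) = 0 → lam.re < 0) {x : ℝ} (hx : 0 ≤ x) :
    x ^ 2 ≤ ‖(x : ℂ) ^ 2 - (c₁ * x + c₀)‖ := by
  obtain ⟨d, hd⟩ := IsAlgClosed.exists_pow_nat_eq (c₁ ^ 2 + 4 * c₀) (n := 2) (by norm_num)
  have h : ∀ l : ℂ, l.re < 0 → x ≤ ‖(x : ℂ) - l‖ := fun l hl => by
    refine le_trans ?_ (Complex.re_le_norm _)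
    rw [Complex.sub_re, Complex.ofReal_re]
    linarith
  have h1 := h ((c₁ + d) / 2) (hroot _ (by linear_combination hd / 4))
  have h2 := h ((c₁ - d) / 2) (hroot _ (by linear_combination hd / 4))
  have e : (x : ℂ) ^ 2 - (c₁ * x + c₀) = (x - (c₁ + d) / 2) * (x - (c₁ - d) / 2) := by
    linear_combination hd / 4
  rw [e, norm_mul, sq]
  exact mul_le_mul h1 h2 hx (norm_nonneg _)

/-- The factors `(k + 2)^i / ((k + 2)² - c₁ (k + 2) - c₀)`. -/
noncomputable def charFactor (c₁ c₀ : ℂ) (i k : ℕ) : ℂ :=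
  ((k : ℂ) + 2) ^ i / (((k : ℂ) + 2) ^ 2 - (c₁ * ((k : ℂ) + 2) + c₀))

theorem sq_le_norm_charPoly_nat {c₁ c₀ : ℂ}
    (hroot : ∀ lam : ℂ, lam ^ 2 - (c₁ * lam + c₀) = 0 → lam.re < 0) (k : ℕ) :
    ((k : ℝ) + 2) ^ 2 ≤ ‖((k : ℂ) + 2) ^ 2 - (c₁ * ((k : ℂ) + 2) + c₀)‖ := by
  have := sq_le_norm_charPoly hroot (x := (k : ℝ) + 2) (by positivity)
  push_cast at this
  exact this

theorem norm_charFactor_le {c₁ c₀ : ℂ}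
    (hroot : ∀ lam : ℂ, lam ^ 2 - (c₁ * lam + c₀) = 0 → lam.re < 0) (i k : ℕ) :
    ‖charFactor c₁ c₀ i k‖ ≤ ((k : ℝ) + 2) ^ i / ((k : ℝ) + 2) ^ 2 := by
  have hk : ‖(k : ℂ) + 2‖ = (k : ℝ) + 2 := by exact_mod_cast Complex.norm_natCast (k + 2)
  rw [charFactor, norm_div, norm_pow, hk]
  exact div_le_div_of_nonneg_left (by positivity) (by positivity)
    (sq_le_norm_charPoly_nat hroot k)

theorem norm_charFactor_le_one {c₁ c₀ : ℂ}
    (hroot : ∀ lam : ℂ, lam ^ 2 - (c₁ * lam + c₀) = 0 → lam.re < 0) {i : ℕ} (hi : i ≤ 2) (k : ℕ) :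
    ‖charFactor c₁ c₀ i k‖ ≤ 1 := by
  refine (norm_charFactor_le hroot i k).trans ?_
  rw [div_le_one (by positivity)]
  have : (0 : ℝ) ≤ k := Nat.cast_nonneg k
  exact pow_le_pow_right₀ (by linarith) hi

/-- The balance of orders: l x-derivatives cost about (2k)^l and i operators t∂/∂t + 2 cost (k+2)^i,
while the characteristic polynomial gains (k+2)². -/
theorem ascFactorial_mul_norm_charFactor_le {c₁ c₀ : ℂ}
    (hroot : ∀ lam : ℂ, lam ^ 2 - (c₁ * lam + c₀) = 0 → lam.re < 0) {i l : ℕ} (hi : i + l ≤ 2)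
    (k : ℕ) : ((2 * k + 1).ascFactorial l : ℝ) * ‖charFactor c₁ c₀ i k‖ ≤ 4 := by
  have h1 : (2 * k + 1).ascFactorial l ≤ (2 * (k + 2)) ^ l :=
    (Nat.ascFactorial_le_pow_add (2 * k) l).trans (Nat.pow_le_pow_left (by omega) _)
  have h1' : ((2 * k + 1).ascFactorial l : ℝ) ≤ (2 * ((k : ℝ) + 2)) ^ l := by exact_mod_cast h1
  have hk : (1 : ℝ) ≤ (k : ℝ) + 2 := by
    have : (0 : ℝ) ≤ k := Nat.cast_nonneg k
    linarith
  calc _ ≤ (2 * ((k : ℝ) + 2)) ^ l * (((k : ℝ) + 2) ^ i / ((k : ℝ) + 2) ^ 2) := by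
        gcongr
        exact norm_charFactor_le hroot i k
    _ = 2 ^ l * (((k : ℝ) + 2) ^ (i + l) / ((k : ℝ) + 2) ^ 2) := by
        rw [mul_pow, pow_add]; ring
    _ ≤ 2 ^ 2 * 1 := by
        gcongr
        · norm_num
        · omega
        · rw [div_le_one (by positivity)]
          exact pow_le_pow_right₀ hk hi
    _ = 4 := by norm_num

theorem charFactor_eq_mul (c₁ c₀ : ℂ) (i k : ℕ) :
    charFactor c₁ c₀ i k = ((k : ℂ) + 2) ^ i * charFactor c₁ c₀ 0 k := by
  rw [charFactor, charFactor]; ring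

theorem charFactor_sub {c₁ c₀ : ℂ}
    (hroot : ∀ lam : ℂ, lam ^ 2 - (c₁ * lam + c₀) = 0 → lam.re < 0) (k : ℕ) :
    charFactor c₁ c₀ 2 k - (c₁ * charFactor c₁ c₀ 1 k + c₀ * charFactor c₁ c₀ 0 k) = 1 := by
  have h : ((k : ℂ) + 2) ^ 2 - (c₁ * ((k : ℂ) + 2) + c₀) ≠ 0 := by
    have := sq_le_norm_charPoly_nat hroot k
    rw [← norm_pos_iff]
    exact lt_of_lt_of_le (by positivity) this
  simp only [charFactor]
  rw [← mul_div_assoc, ← mul_div_assoc, ← add_div, ← sub_div, div_eq_one_iff_eq h]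
  ring

theorem monEval_single {σ : Type*} (y : σ → ℂ) (i : σ) :
    monEval y (Finsupp.single i 1) = y i := by
  simp [monEval]

theorem IsEvalPoint.eval_eq_mul_psum {ω : Weight (Option (Fin n))} {p : ℂ × (Fin n → ℂ)}
    (hp : IsEvalPoint ω (coords p)) {f : weightedSeries ω} {a : (Option (Fin n) →₀ ℕ) → ℂ}
    (h : ∀ m, wcoeff (m + Finsupp.single none 1) f = a m ∧ (m none = 0 → wcoeff m f = 0)) :
    hp.eval f = p.1 * psum a p := by
  have hinj : Function.Injective
      fun m : Option (Fin n) →₀ ℕ => m + Finsupp.single none 1 := add_left_injective _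
  rw [hp.eval_def, psum, ← tsum_mul_left]
  refine (hinj.tsum_eq (f := fun m => wcoeff m f * monEval (coords p) m) fun m hm => ?_).symm.trans
    (tsum_congr fun m => ?_)
  · by_cases h0 : m none = 0
    · exact absurd (by simp only [(h m).2 h0, zero_mul]) hm
    · refine ⟨m - Finsupp.single none 1, tsub_add_cancel_of_le ?_⟩
      rw [Finsupp.single_le_iff]
      omega
  · simp only [(h m).1, monEval_add, monEval_single, coords]
    ring_nf
    rfl

theorem eventually_mul_le (c : ℝ) {e : ℝ} (he : 0 < e) : ∀ᶠ T : ℝ in 𝓝[>] 0, T * c ≤ e := by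
  have : Tendsto (fun T : ℝ => T * c) (𝓝[>] 0) (𝓝 0) := by
    have h : Tendsto (fun T : ℝ => T * c) (𝓝 0) (𝓝 (0 * c)) := tendsto_id.mul_const c
    rw [zero_mul] at h
    exact h.mono_left nhdsWithin_le_nhds
  exact (this.eventually_lt_const he).mono fun _ h => h.le

theorem wordSum_norm_le_of_nil {ι A : Type*} [NormedCommRing A] [NormOneClass A]
    [NormedAlgebra ℂ A] {c : List ι → ℂ} {r ρ : ℝ} (hr : 0 < r)
    (hρ : 0 ≤ ρ) (hρr : ρ ≤ r) (hc : Summable fun w => ‖c w‖ * r ^ w.length) (h0 : c [] = 0)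
    {Y : ι → A} (hY : ∀ j, ‖Y j‖ ≤ ρ) :
    ‖wordSum c id Y‖ ≤ ρ * (r⁻¹ * ∑' w, ‖c w‖ * r ^ w.length) := by
  have hle : ∀ w, ‖c w‖ * ρ ^ w.length ≤ ρ / r * (‖c w‖ * r ^ w.length) := by
    rintro (_ | ⟨a, w⟩)
    · simp [h0]
    · rw [List.length_cons, pow_succ, pow_succ]
      have : ρ ^ w.length ≤ r ^ w.length := pow_le_pow_left₀ hρ hρr _
      calc _ ≤ ‖c (a :: w)‖ * (r ^ w.length * ρ) := by gcongr
        _ = _ := by field_simp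
  have hs : Summable fun w => ‖c w‖ * ρ ^ w.length :=
    (hc.mul_left (ρ / r)).of_nonneg_of_le (fun w => by positivity) hle
  refine (norm_wordSum_le hs hρ hY).trans ((hs.tsum_le_tsum hle (hc.mul_left _)).trans_eq ?_)
  rw [tsum_mul_left]
  ring

/-- The values of the variables `(t, x, z)` at `p = (t, x)`, where `z = (z_q)` is given. -/
def jetPoint {A X : Type*} (τ : A) (ξ : Fin n → A) (z : X → A) : Option (Fin n ⊕ X) → A :=
  fun o => o.elim τ (Sum.elim ξ z)

/-- Existence for the transformed equation, by the contraction principle in a weighted algebra of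
power series. -/
theorem exists_coefficients {c₁ c₀ : ℂ}
    (hroot : ∀ lam : ℂ, lam ^ 2 - (c₁ * lam + c₀) = 0 → lam.re < 0)
    {c : List (JetIndex n) → ℂ} {r : ℝ} (hr : 0 < r) (hc : Summable fun w => ‖c w‖ * r ^ w.length)
    {b₁ b₀ : List (Fin n) → ℂ} {rb : ℝ} (hrb : 0 < rb)
    (hb₁ : Summable fun w => ‖b₁ w‖ * rb ^ w.length) (hb₁0 : b₁ [] = 0)
    (hb₀ : Summable fun w => ‖b₀ w‖ * rb ^ w.length) (hb₀0 : b₀ [] = 0) :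
    ∃ (R : ℝ) (v : ℕ → (Option (Fin n) →₀ ℕ) → ℂ), 0 < R ∧
      (∀ i m, v i m = ((m none : ℂ) + 2) ^ i * v 0 m) ∧ (∀ i ≤ 2, ConvergesOn R (v i)) ∧
      ∀ p : ℂ × (Fin n → ℂ), ‖p‖ < R →
        psum (v 2) p = c₁ * psum (v 1) p + c₀ * psum (v 0) p +
          wordSum c id (jetPoint p.1 p.2 fun q : Lam n => p.1 * dx q.1.2 (psum (v q.1.1)) p) +
          wordSum b₁ id p.2 * psum (v 1) p + wordSum b₀ id p.2 * psum (v 0) p := by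
  set s : ℝ := r / 2 with hs_def
  have hs : 0 < s := by positivity
  have hsr : s < r := half_lt_self hr
  set A : ℝ := ∑' w, ‖c w‖ * r ^ w.length with hA_def
  have hA : 0 ≤ A := tsum_nonneg fun w => by positivity
  set L : ℝ := ∑' w, ‖c w‖ * (w.length * s ^ w.length) with hL_def
  have hL : 0 ≤ L := tsum_nonneg fun w => by positivity
  -- The nonlinear term is at most A and the terms with β₁, β₀ at most B/4, so the ball of radius B
  -- is mapped into itself.
  set B : ℝ := 2 * A + 1 with hB_def
  set E₁ : ℝ := rb⁻¹ * ∑' w, ‖b₁ w‖ * rb ^ w.length with hE₁_def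
  set E₀ : ℝ := rb⁻¹ * ∑' w, ‖b₀ w‖ * rb ^ w.length with hE₀_def
  -- ρ is fixed before T, since the conditions on T involve ρ⁻². Small ρ makes c₁(x) - c₁(0) and
  -- c₀(x) - c₀(0) small; small T then handles the nonlinear term.
  obtain ⟨ρ, ⟨⟨⟨⟨hρ1, hρs⟩, hρb⟩, hρE₁⟩, hρE₀⟩, hρ⟩ :=
    (((((eventually_mul_le 1 one_pos).and (eventually_mul_le 1 hs)).and
      (eventually_mul_le 1 hrb)).and
      (eventually_mul_le E₁ (e := 1 / 8) (by norm_num))).and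
      (eventually_mul_le E₀ (e := 1 / 8) (by norm_num))).and self_mem_nhdsWithin |>.exists
  rw [mul_one] at hρ1 hρs hρb
  replace hρ : 0 < ρ := hρ
  obtain ⟨T, ⟨⟨hTs, hTB⟩, hTL⟩, hT⟩ :=
    (((eventually_mul_le 1 hs).and (eventually_mul_le (4 * ρ⁻¹ ^ 2 * B) hs)).and
      (eventually_mul_le (L * (4 * ρ⁻¹ ^ 2 / s)) (e := 1 / 4) (by norm_num))).and
      self_mem_nhdsWithin |>.exists
  rw [mul_one] at hTs
  replace hT : 0 < T := hT
  set R : ℝ := min (T / 4) (ρ / 2) with hR_def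
  have hR : 0 < R := by positivity
  set ω := majorantWeight n hT hρ with hω_def
  have hev : ∀ y : Option (Fin n) → ℂ, (∀ i, ‖y i‖ < R) → IsEvalPoint ω y := fun y hy =>
    isEvalPoint_majorantWeight hT hρ ((hy none).le.trans (min_le_left _ _))
      fun j => (hy (some j)).le.trans (min_le_right _ _)
  have hconv : ∀ f : weightedSeries ω, ConvergesOn R fun m => wcoeff m f :=
    fun f y hy => (hev y hy).summable f
  have hM : ∀ i : ℕ, ∃ S : weightedSeries ω →ₗ[ℂ] weightedSeries ω, (i ≤ 2 → ∀ H, ‖S H‖ ≤ ‖H‖) ∧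
      (i ≤ 2 → ∀ H m, wcoeff m (S H) = charFactor c₁ c₀ i (m none) * wcoeff m H) := by
    intro i
    by_cases hi : i ≤ 2
    · obtain ⟨S, h1, h2⟩ := exists_multiplier ω
        (μ := fun m => charFactor c₁ c₀ i (m none)) fun m => norm_charFactor_le_one hroot hi _
      exact ⟨S, fun _ => h1, fun _ => h2⟩
    · exact ⟨0, fun h => absurd h hi, fun h => absurd h hi⟩
  choose M hM1 hM2 using hM
  have hD := fun q : Lam n => exists_dx_psum hT hρ R q.1.2
  choose D hD1 hD2 using hD
  have hS := fun q : Lam n => exists_mul_t_operator hT hρ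
    (l := ∑ j, q.1.2 j) (by have := q.2.1; omega) (hD1 q)
    (ascFactorial_mul_norm_charFactor_le hroot q.2.1)
  choose S hS1 hS2 using hS
  have hS1' : ∀ q H, ‖S q H‖ ≤ 4 * T * ρ⁻¹ ^ 2 * ‖H‖ := by
    intro q H
    refine (hS1 q H).trans ?_
    have h1 : 1 ≤ ρ⁻¹ := (one_le_inv₀ hρ).2 hρ1
    have h2 : ∑ j, q.1.2 j ≤ 2 := by have := q.2.1; omega
    gcongr
  let Xt : weightedSeries ω := wmonomial (Finsupp.single none 1) 1
  let Xx : Fin n → weightedSeries ω := fun j => wmonomial (Finsupp.single (some j) 1) 1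
  have hXt : ‖Xt‖ = T := by
    simp only [Xt]
    rw [norm_wmonomial, hω_def, val_majorantWeight, shiftedWeight_single_none]; simp
  have hXx : ∀ j, ‖Xx j‖ = ρ := fun j => by
    simp only [Xx]
    rw [norm_wmonomial, hω_def, val_majorantWeight, shiftedWeight_single_some]; simp
  let Y : weightedSeries ω → JetIndex n → weightedSeries ω :=
    fun H => jetPoint Xt Xx fun q => S q H
  have hY : ∀ H, ‖H‖ ≤ B → ∀ j, ‖Y H j‖ ≤ s := by
    rintro H hH (_ | j | q)
    · exact hXt.le.trans hTs
    · exact (hXx j).le.trans hρs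
    · refine (hS1' q H).trans ?_
      calc _ ≤ 4 * T * ρ⁻¹ ^ 2 * B := by gcongr
        _ = T * (4 * ρ⁻¹ ^ 2 * B) := by ring
        _ ≤ s := hTB
  have hYd : ∀ H H' j, ‖Y H j - Y H' j‖ ≤ 4 * T * ρ⁻¹ ^ 2 * ‖H - H'‖ := by
    have h0 : ∀ H H' : weightedSeries ω, 0 ≤ 4 * T * ρ⁻¹ ^ 2 * ‖H - H'‖ :=
      fun H H' => by positivity
    rintro H H' (_ | j | q)
    · change ‖Xt - Xt‖ ≤ _
      rw [sub_self, norm_zero]; exact h0 H H'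
    · change ‖Xx j - Xx j‖ ≤ _
      rw [sub_self, norm_zero]; exact h0 H H'
    · change ‖S q H - S q H'‖ ≤ _
      rw [← map_sub]
      exact hS1' q _
  let β₁ : weightedSeries ω := wordSum b₁ id Xx
  let β₀ : weightedSeries ω := wordSum b₀ id Xx
  have hβ₁ : ‖β₁‖ ≤ 1 / 8 :=
    (wordSum_norm_le_of_nil hrb hρ.le hρb hb₁ hb₁0 fun j => (hXx j).le).trans hρE₁
  have hβ₀ : ‖β₀‖ ≤ 1 / 8 :=
    (wordSum_norm_le_of_nil hrb hρ.le hρb hb₀ hb₀0 fun j => (hXx j).le).trans hρE₀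
  -- The unknown H is the characteristic operator applied to f, so that `M 0 H` is f, `M 1 H` is
  -- (t∂/∂t + 2)f, and no derivative is lost in solving for f.
  let Φ : weightedSeries ω → weightedSeries ω :=
    fun H => wordSum c id (Y H) + β₁ * M 1 H + β₀ * M 0 H
  have hβM : ∀ H, ‖β₁ * M 1 H + β₀ * M 0 H‖ ≤ 1 / 4 * ‖H‖ := by
    intro H
    have h1 : ‖β₁ * M 1 H‖ ≤ 1 / 8 * ‖H‖ := (norm_mul_le _ _).trans
      (mul_le_mul hβ₁ (hM1 1 (by norm_num) H) (norm_nonneg _) (by norm_num))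
    have h0 : ‖β₀ * M 0 H‖ ≤ 1 / 8 * ‖H‖ := (norm_mul_le _ _).trans
      (mul_le_mul hβ₀ (hM1 0 (by norm_num) H) (norm_nonneg _) (by norm_num))
    refine (norm_add_le _ _).trans ?_
    linarith
  have hmaps : Set.MapsTo Φ (Metric.closedBall 0 B) (Metric.closedBall 0 B) := by
    intro H hH
    rw [mem_closedBall_zero_iff] at hH ⊢
    have h1 : ‖wordSum c id (Y H)‖ ≤ A :=
      norm_wordSum_le hc hr.le fun j => (hY H hH j).trans hsr.le
    have e : Φ H = wordSum c id (Y H) + (β₁ * M 1 H + β₀ * M 0 H) := add_assoc _ _ _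
    rw [e]
    refine (norm_add_le _ _).trans ?_
    have h2 := hβM H
    linarith
  have hcontr : ContractingWith (1 / 2) (hmaps.restrict Φ _ _) := by
    refine ⟨by rw [← NNReal.coe_lt_coe]; norm_num, LipschitzWith.of_dist_le_mul ?_⟩
    rintro ⟨H, hH⟩ ⟨H', hH'⟩
    rw [mem_closedBall_zero_iff] at hH hH'
    rw [Subtype.dist_eq, Subtype.dist_eq, dist_eq_norm, dist_eq_norm]
    change ‖Φ H - Φ H'‖ ≤ _ * ‖H - H'‖
    have e : Φ H - Φ H' = (wordSum c id (Y H) - wordSum c id (Y H')) +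
        (β₁ * M 1 (H - H') + β₀ * M 0 (H - H')) := by
      simp only [Φ, map_sub]
      ring
    have h1 := norm_wordSum_sub_le (W := id) hr hs hsr hc (hY H hH) (hY H' hH') (hYd H H')
    have h2 := hβM (H - H')
    have h3 : L * (4 * T * ρ⁻¹ ^ 2 * ‖H - H'‖ / s) ≤ 1 / 4 * ‖H - H'‖ := by
      calc _ = T * (L * (4 * ρ⁻¹ ^ 2 / s)) * ‖H - H'‖ := by ring
        _ ≤ _ := by gcongr
    rw [e]
    refine (norm_add_le _ _).trans ?_
    have h4 := h1.trans h3
    push_cast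
    linarith
  obtain ⟨H, hHB, hfix, -⟩ := hcontr.exists_fixedPoint' Metric.isClosed_closedBall.isComplete hmaps
    (x := 0) (by rw [mem_closedBall_zero_iff, norm_zero]; positivity) (edist_ne_top _ _)
  rw [mem_closedBall_zero_iff] at hHB
  let v : ℕ → (Option (Fin n) →₀ ℕ) → ℂ := fun i m => charFactor c₁ c₀ i (m none) * wcoeff m H
  have hvM : ∀ i ≤ 2, v i = fun m => wcoeff m (M i H) := fun i hi =>
    funext fun m => (hM2 i hi H m).symm
  have hvconv : ∀ i ≤ 2, ConvergesOn R (v i) := fun i hi => by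
    rw [hvM i hi]; exact hconv _
  refine ⟨R, v, hR, fun i m => ?_, hvconv, fun p hp => ?_⟩
  · simp only [v]
    rw [charFactor_eq_mul, mul_assoc]
  · have hpe : IsEvalPoint ω (coords p) := hev _ (norm_coords_lt hp)
    have hMe : ∀ i ≤ 2, hpe.eval (M i H) = psum (v i) p := fun i hi => by
      rw [hvM i hi]; rfl
    have hXte : hpe.eval Xt = p.1 := by
      simp only [Xt, hpe.eval_wmonomial, monEval_single, one_mul]; rfl
    have hXxe : ∀ j, hpe.eval (Xx j) = p.2 j := fun j => by
      simp only [Xx, hpe.eval_wmonomial, monEval_single, one_mul]; rfl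
    have hSe : ∀ q, hpe.eval (S q H) = p.1 * dx q.1.2 (psum (v q.1.1)) p := by
      intro q
      have hq : q.1.1 ≤ 2 := by have := q.2.2; omega
      rw [(hD2 q (v q.1.1) (hvconv _ hq)).2 p hp]
      exact hpe.eval_eq_mul_psum (hS2 q H)
    have hYe : (fun j => hpe.eval (Y H j)) =
        jetPoint p.1 p.2 fun q : Lam n => p.1 * dx q.1.2 (psum (v q.1.1)) p := by
      funext o
      rcases o with _ | j | q
      · exact hXte
      · exact hXxe j
      · exact hSe q
    have hXxe' : (fun j => hpe.eval (Xx j)) = p.2 := funext hXxe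
    have hK := map_wordSum (W := id) hpe.eval hc hr.le fun j => (hY H hHB j).trans hsr.le
    have h1 := map_wordSum (W := id) hpe.eval hb₁ hrb.le fun j => (hXx j).le.trans hρb
    have h0 := map_wordSum (W := id) hpe.eval hb₀ hrb.le fun j => (hXx j).le.trans hρb
    rw [hYe] at hK
    rw [hXxe'] at h1 h0
    have hH : H = M 2 H - (c₁ • M 1 H + c₀ • M 0 H) := by
      refine wcoeff_ext fun m => ?_
      rw [map_sub, map_add, map_smul, map_smul, hM2 2 le_rfl, hM2 1 (by norm_num),
        hM2 0 (by norm_num), smul_eq_mul, smul_eq_mul]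
      linear_combination (-wcoeff m H) * charFactor_sub hroot (m none)
    have heq := congrArg hpe.eval hfix
    rw [hH] at heq
    have e1 : hpe.eval (Φ H) = hpe.eval (wordSum c id (Y H)) +
        hpe.eval β₁ * hpe.eval (M 1 H) + hpe.eval β₀ * hpe.eval (M 0 H) := by
      simp only [Φ, map_add, map_mul]
    rw [← hH, e1, hK, h1, h0, hMe 1 (by norm_num), hMe 0 (by norm_num)] at heq
    have e2 := congrArg hpe.eval hH
    rw [map_sub, map_add, map_smul, map_smul, hMe 2 le_rfl, hMe 1 (by norm_num),
      hMe 0 (by norm_num), smul_eq_mul, smul_eq_mul] at e2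
    linear_combination (-e2) - heq

end FixedPoint

end Fuchs

namespace Fuchs

/-! ### Construction of the regular solution tU + t²f -/

section Existence

variable {n : ℕ} {F : JetSpace n → ℂ}

theorem isLocalOp_fst_mul :
    IsLocalOp fun (f : ℂ × (Fin n → ℂ) → ℂ) p => p.1 * f p where
  analyticAt h := analyticAt_fst.mul h
  congr h := h.mono fun p hp => congrArg (p.1 * ·) hp
  add {f g p} _ _ := mul_add p.1 (f p) (g p)
  smul {f p} c _ := by simp only [Pi.smul_apply, smul_eq_mul]; ring
  comm j _ := deriv_const_mul_field _

theorem eq_nil_of_hasSum_words {ι : Type*} {c : List ι → ℂ} {s : ℂ}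
    (h : HasSum (fun w => c w * (w.map (0 : ι → ℂ)).prod) s) : c [] = s := by
  refine HasSum.unique ?_ h
  have := hasSum_single (f := fun w => c w * (w.map (0 : ι → ℂ)).prod) [] (by
    rintro (_ | ⟨a, w⟩) hw
    · exact absurd rfl hw
    · simp)
  simpa using this

theorem summable_words_of_le {ι : Type*} {c : List ι → ℂ} {r r' : ℝ} (hr : 0 ≤ r') (h : r' ≤ r)
    (hc : Summable fun w => ‖c w‖ * r ^ w.length) : Summable fun w => ‖c w‖ * r' ^ w.length :=
  hc.of_nonneg_of_le (fun w => by positivity) fun w => by gcongr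

/-- The function `t U(t, x) + t² f(t, x)`. -/
def expansion (U f : ℂ × (Fin n → ℂ) → ℂ) (p : ℂ × (Fin n → ℂ)) : ℂ := p.1 * U p + p.1 * (p.1 * f p)

theorem analyticAt_expansion {U f : ℂ × (Fin n → ℂ) → ℂ} {p : ℂ × (Fin n → ℂ)}
    (hU : AnalyticAt ℂ U p) (hf : AnalyticAt ℂ f p) : AnalyticAt ℂ (expansion U f) p :=
  (analyticAt_fst.mul hU).add (analyticAt_fst.mul (analyticAt_fst.mul hf))

theorem dx_expansion {U f : ℂ × (Fin n → ℂ) → ℂ} {p : ℂ × (Fin n → ℂ)}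
    (hU : AnalyticAt ℂ U p) (hf : AnalyticAt ℂ f p) (α : Fin n → ℕ) :
    dx α (expansion U f) p = p.1 * (dx α U p + p.1 * dx α f p) := by
  have h1 := isLocalOp_fst_mul.comm_dx hU α
  have h2 := isLocalOp_fst_mul.comm_dx (isLocalOp_fst_mul.analyticAt hf) α
  have h3 := isLocalOp_fst_mul.comm_dx hf α
  have h4 := (isLocalOp_dx α).add (isLocalOp_fst_mul.analyticAt hU)
    (isLocalOp_fst_mul.analyticAt (isLocalOp_fst_mul.analyticAt hf))
  refine h4.trans ?_
  rw [h1, h2, h3]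
  ring

/-- t∂/∂t fixes tU(x) and acts on t²f as t²(t∂/∂t + 2)f, whence the k + 2 in the factors. -/
theorem euler_expansion_psum {U : (Fin n → ℂ) → ℂ} {R : ℝ} {a b : (Option (Fin n) →₀ ℕ) → ℂ}
    (ha : ConvergesOn R a) (hab : ∀ m, b m = ((m none : ℂ) + 2) * a m)
    {p : ℂ × (Fin n → ℂ)} (hp : ‖p‖ < R) :
    euler (expansion (fun p => U p.2) (psum a)) p = expansion (fun p => U p.2) (psum b) p := by
  have hd := hasDerivAt_fst (ha.analyticAt_psum hp).differentiableAt
  have he := ha.euler_psum hp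
  rw [euler, hd.deriv] at he
  have h1 : HasDerivAt (fun t : ℂ => expansion (fun p => U p.2) (psum a) (t, p.2))
      (1 * U p.2 + (1 * (p.1 * psum a p) +
        p.1 * (1 * psum a p + p.1 * fderiv ℂ (psum a) p (1, 0)))) p.1 :=
    ((hasDerivAt_id' p.1).fun_mul (hasDerivAt_const p.1 (U p.2)) |>.congr_deriv (by ring)).fun_add
      ((hasDerivAt_id' p.1).fun_mul ((hasDerivAt_id' p.1).fun_mul hd))
  have hs1 := (ha _ (norm_coords_lt hp)).of_norm
  have hs2 := (ha.tdeg_mul _ (norm_coords_lt hp)).of_norm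
  have h2 : psum b p = psum (fun m => m none * a m) p + 2 * psum a p := by
    simp only [psum]
    rw [← tsum_mul_left, ← hs2.tsum_add (hs1.mul_left 2)]
    refine tsum_congr fun m => ?_
    rw [hab]
    ring
  rw [euler, h1.deriv, expansion, h2, ← he]
  ring

/-- The equation has a holomorphic solution vanishing for `t = 0`. -/
theorem exists_isRegularSolution {Δ : Set (JetSpace n)} (hΔ : IsOpen Δ) (hΔ0 : (0, 0, 0) ∈ Δ)
    (hF : AnalyticAt ℂ F (0, 0, 0))
    (hA2 : ∀ᶠ x in 𝓝 (0 : Fin n → ℂ), F (0, x, 0) = 0)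
    (hA3 : ∀ᶠ x in 𝓝 (0 : Fin n → ℂ), ∀ q : Lam n, 0 < ∑ j, q.1.2 j → dz q F (0, x, 0) = 0)
    (hexp : ∀ lam : ℂ, IsCharExponent F 0 lam → lam.re < 0) :
    ∃ u₀, IsRegularSolution Δ F u₀ := by
  set c₁ : (Fin n → ℂ) → ℂ := fun x => dz (idx10 n) F (0, x, 0) with hc₁_def
  set c₀ : (Fin n → ℂ) → ℂ := fun x => dz (idx00 n) F (0, x, 0) with hc₀_def
  have hc₁ : AnalyticAt ℂ c₁ 0 := analyticAt_dz _ hF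
  have hc₀ : AnalyticAt ℂ c₀ 0 := analyticAt_dz _ hF
  have hroot : ∀ lam : ℂ, lam ^ 2 - (c₁ 0 * lam + c₀ 0) = 0 → lam.re < 0 := hexp
  -- Otherwise 1 would be a characteristic exponent with positive real part.
  have he0 : 1 - c₁ 0 - c₀ 0 ≠ 0 := by
    intro h
    have := hroot 1 (by linear_combination h)
    norm_num at this
  have hea : AnalyticAt ℂ (fun x => 1 - c₁ x - c₀ x) 0 := (analyticAt_const.sub hc₁).sub hc₀
  set U : (Fin n → ℂ) → ℂ := fun x => dt F x / (1 - c₁ x - c₀ x) with hU_def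
  have hU : AnalyticAt ℂ U 0 := (analyticAt_dt hF).div hea he0
  have hUeq : ∀ᶠ x in 𝓝 (0 : Fin n → ℂ), U x = dt F x + c₁ x * U x + c₀ x * U x := by
    filter_upwards [hea.continuousAt.eventually_ne he0] with x hx
    have : U x * (1 - c₁ x - c₀ x) = dt F x := div_mul_cancel₀ _ hx
    linear_combination this
  set V : ℂ × (Fin n → ℂ) → ℂ := fun p => U p.2 with hV_def
  have hV : AnalyticAt ℂ V (0, 0) := AnalyticAt.fun_comp (g := U) hU analyticAt_snd
  set Z : ℂ × (Fin n → ℂ) → Lam n → ℂ := fun p q => dx q.1.2 V p with hZ_def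
  have hZ : AnalyticAt ℂ Z (0, 0) :=
    analyticAt_pi_iff.2 fun q => (isLocalOp_dx q.1.2).analyticAt hV
  obtain ⟨K, hK, hrem⟩ := exists_remainder hF hA2 hA3 hZ
  obtain ⟨c, r, hr, hc, hKc⟩ := analyticAt_exists_words hK
  obtain ⟨b₁, r₁, hr₁, hb₁, hb₁c⟩ := analyticAt_exists_words (hc₁.sub (analyticAt_const (v := c₁ 0)))
  obtain ⟨b₀, r₀, hr₀, hb₀, hb₀c⟩ := analyticAt_exists_words (hc₀.sub (analyticAt_const (v := c₀ 0)))
  have hb₁0 : b₁ [] = 0 := by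
    have := eq_nil_of_hasSum_words (hb₁c 0 (by simpa using hr₁))
    simpa using this
  have hb₀0 : b₀ [] = 0 := by
    have := eq_nil_of_hasSum_words (hb₀c 0 (by simpa using hr₀))
    simpa using this
  have hrb : 0 < min r₁ r₀ := lt_min hr₁ hr₀
  obtain ⟨R, v, hR, hv, hconv, heq⟩ := exists_coefficients hroot hr hc hrb
    (summable_words_of_le hrb.le (min_le_left _ _) hb₁) hb₁0
    (summable_words_of_le hrb.le (min_le_right _ _) hb₀) hb₀0
  set w : ℕ → ℂ × (Fin n → ℂ) → ℂ := fun i => expansion V (psum (v i)) with hw_def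
  have hball : ∀ᶠ p in 𝓝 ((0, 0) : ℂ × (Fin n → ℂ)), ‖p‖ < R :=
    continuous_norm.continuousAt.eventually_lt_const (by simpa using hR)
  have hpsum : ∀ i ≤ 2, AnalyticAt ℂ (psum (v i)) ((0, 0) : ℂ × (Fin n → ℂ)) :=
    fun i hi => (hconv i hi).analyticAt_psum (by simpa using hR)
  have hwa : ∀ i ≤ 2, AnalyticAt ℂ (w i) (0, 0) := fun i hi => analyticAt_expansion hV (hpsum i hi)
  have heul : ∀ i ≤ 2, euler^[i] (w 0) =ᶠ[𝓝 (0, 0)] w i := by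
    intro i hi
    induction i with
    | zero => rfl
    | succ i ih =>
      rw [Function.iterate_succ']
      refine (euler_congr (ih (by omega))).trans ?_
      filter_upwards [hball] with p hp
      refine euler_expansion_psum (hconv i (by omega)) (fun m => ?_) hp
      rw [hv (i + 1), hv i, pow_succ]
      ring
  set ζ : ℂ × (Fin n → ℂ) → Lam n → ℂ :=
    fun p q => p.1 * dx q.1.2 (psum (v q.1.1)) p with hζ_def
  have hζ : AnalyticAt ℂ ζ (0, 0) := analyticAt_pi_iff.2 fun q =>
    analyticAt_fst.mul ((isLocalOp_dx _).analyticAt (hpsum _ q.2.2.le))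
  have hjet : ∀ᶠ p in 𝓝 ((0, 0) : ℂ × (Fin n → ℂ)), jet euler (w 0) p = p.1 • (Z p + ζ p) := by
    have hall : ∀ᶠ p in 𝓝 ((0, 0) : ℂ × (Fin n → ℂ)), ∀ i ≤ 1, AnalyticAt ℂ (psum (v i)) p ∧
        euler^[i] (w 0) =ᶠ[𝓝 p] w i := by
      have h : ∀ i ≤ 2, ∀ᶠ p in 𝓝 ((0, 0) : ℂ × (Fin n → ℂ)), AnalyticAt ℂ (psum (v i)) p ∧
          euler^[i] (w 0) =ᶠ[𝓝 p] w i := fun i hi =>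
        (hpsum i hi).eventually_analyticAt.and (heul i hi).eventually_nhds
      filter_upwards [h 0 (by norm_num), h 1 (by norm_num)] with p h0 h1 i hi
      interval_cases i
      · exact h0
      · exact h1
    filter_upwards [hall, hV.eventually_analyticAt, (hwa 0 (by norm_num)).eventually_analyticAt]
      with p hp hpV hpw
    funext q
    have hq : q.1.1 ≤ 1 := by have := q.2.2; omega
    have h1 := (isLocalOp_euler.iterate q.1.1).comm_dx hpw q.1.2
    have h2 := ((isLocalOp_dx q.1.2).congr (hp _ hq).2).self_of_nhds
    have h3 := dx_expansion hpV (hp _ hq).1 q.1.2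
    exact h1.symm.trans (h2.trans h3)
  set y : ℂ × (Fin n → ℂ) → JetIndex n → ℂ := fun p => jetPoint p.1 p.2 (ζ p) with hy_def
  have hy : ContinuousAt y (0, 0) := by
    refine continuousAt_pi.2 ?_
    rintro (_ | j | q)
    · exact continuousAt_fst
    · exact (continuous_apply j).continuousAt.comp continuousAt_snd
    · exact (continuous_apply q).continuousAt.comp hζ.continuousAt
  have hy0 : y (0, 0) = 0 := by
    funext o
    rcases o with _ | j | q
    · rfl
    · rfl
    · exact zero_mul _
  have hjc : ContinuousAt (fun p : ℂ × (Fin n → ℂ) =>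
      ((p.1, p.2, p.1 • (Z p + ζ p)) : JetSpace n)) (0, 0) :=
    continuousAt_fst.prodMk (continuousAt_snd.prodMk
      (continuousAt_fst.smul (hZ.continuousAt.add hζ.continuousAt)))
  have hΔev : ∀ᶠ p in 𝓝 ((0, 0) : ℂ × (Fin n → ℂ)), ((p.1, p.2, p.1 • (Z p + ζ p)) : JetSpace n) ∈ Δ :=
    hjc.eventually_mem (hΔ.mem_nhds (by simpa only [zero_smul] using hΔ0))
  have hrem' := hy.eventually (by rw [hy0]; exact hrem)
  have hyr : ∀ᶠ p in 𝓝 ((0, 0) : ℂ × (Fin n → ℂ)), ‖y p‖ < r :=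
    hy.norm.eventually_lt_const (by simpa only [hy0, norm_zero] using hr)
  have hsmall : ∀ s : ℝ, 0 < s → ∀ᶠ p in 𝓝 ((0, 0) : ℂ × (Fin n → ℂ)), ‖p.2‖ < s := fun s hs =>
    (continuous_norm.comp continuous_snd).continuousAt.eventually_lt_const (by simpa using hs)
  have hUev : ∀ᶠ p in 𝓝 ((0, 0) : ℂ × (Fin n → ℂ)),
      U p.2 = dt F p.2 + c₁ p.2 * U p.2 + c₀ p.2 * U p.2 :=
    (continuousAt_snd (p := ((0, 0) : ℂ × (Fin n → ℂ)))).eventually hUeq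
  have hmain : ∀ᶠ p in 𝓝 ((0, 0) : ℂ × (Fin n → ℂ)), AnalyticAt ℂ (w 0) p ∧
      ((p.1, p.2, jet euler (w 0) p) ∈ Δ ∧ euler^[2] (w 0) p = F (p.1, p.2, jet euler (w 0) p)) := by
    filter_upwards [(hwa 0 (by norm_num)).eventually_analyticAt, hjet, hΔev, hrem', hyr,
      hsmall r₁ hr₁, hsmall r₀ hr₀, hUev, heul 2 le_rfl, hball]
      with p hpa hpj hpΔ hpr hpy hp₁ hp₀ hpU hpe hpR
    rw [hpj]
    refine ⟨hpa, hpΔ, ?_⟩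
    have hbase : baseOf (y p) = p := rfl
    have hfib : fiberOf (y p) = ζ p := rfl
    have hnone : y p none = p.1 := rfl
    rw [hbase, hfib, hnone, ← (hKc _ hpy).tsum_eq] at hpr
    have hpv := heq p hpR
    have e1 : wordSum b₁ id p.2 = c₁ p.2 - c₁ 0 := (hb₁c p.2 hp₁).tsum_eq
    have e0 : wordSum b₀ id p.2 = c₀ p.2 - c₀ 0 := (hb₀c p.2 hp₀).tsum_eq
    have eK : wordSum c id (jetPoint p.1 p.2 fun q : Lam n => p.1 * dx q.1.2 (psum (v q.1.1)) p) =
      ∑' l, c l * (l.map (y p)).prod := rfl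
    rw [e1, e0, eK] at hpv
    have hZ10 : Z p (idx10 n) = U p.2 := congrFun (dx_zero V) p
    have hZ00 : Z p (idx00 n) = U p.2 := congrFun (dx_zero V) p
    have hζ10 : ζ p (idx10 n) = p.1 * psum (v 1) p :=
      congrArg (p.1 * ·) (congrFun (dx_zero (psum (v 1))) p)
    have hζ00 : ζ p (idx00 n) = p.1 * psum (v 0) p :=
      congrArg (p.1 * ·) (congrFun (dx_zero (psum (v 0))) p)
    rw [hpr, hpe, linPart, Pi.add_apply, Pi.add_apply, hZ10, hZ00, hζ10, hζ00]
    simp only [hw_def, expansion, hV_def]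
    -- The terms of order t cancel by the choice of U, and t² times the equation for f gives the
    -- rest.
    linear_combination p.1 * hpU + p.1 ^ 2 * hpv
  obtain ⟨W, hW, hWo, hW0⟩ := eventually_nhds_iff.1 hmain
  refine ⟨w 0, W, hWo, hW0, fun p hp => (hW p hp).1, fun p hp => (hW p hp).2, fun x _ => ?_⟩
  simp only [hw_def, expansion, zero_mul, add_zero]

end Existence

end Fuchs

theorem theorem2 (n : ℕ)
    (Δ : Set (Fuchs.JetSpace n)) (hΔ : IsOpen Δ) (hΔ0 : (0, 0, 0) ∈ Δ)
    (F : Fuchs.JetSpace n → ℂ)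
    (hA1 : AnalyticOnNhd ℂ F Δ)
    (hA2 : ∀ x : Fin n → ℂ, (0, x, 0) ∈ Δ → F (0, x, 0) = 0)
    (hA3 : ∀ (q : Fuchs.Lam n) (x : Fin n → ℂ), 0 < ∑ j, q.1.2 j → (0, x, 0) ∈ Δ →
      Fuchs.dz q F (0, x, 0) = 0)
    (hexp : ∀ lam : ℂ, Fuchs.IsCharExponent F 0 lam → lam.re < 0)
    (θ₁ θ₂ : ℝ) (hI : θ₁ < θ₂) (r₀ R₀ : ℝ) (hr₀ : 0 < r₀) (hR₀ : 0 < R₀)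
    (u : ℂ × (Fin n → ℂ) → ℂ)
    (hu : Fuchs.IsSectorialSolution Δ F θ₁ θ₂ r₀ R₀ u)
    (hlim : Fuchs.LimsupCondition θ₁ θ₂ u) :
    ∃ u₀ : ℂ × (Fin n → ℂ) → ℂ,
      Fuchs.IsRegularSolution Δ F u₀ ∧
      (∀ v : ℂ × (Fin n → ℂ) → ℂ, Fuchs.IsRegularSolution Δ F v →
        v =ᶠ[𝓝 (0, 0)] u₀) ∧
      ∃ σ δ : ℝ, 0 < σ ∧ σ ≤ r₀ ∧ 0 < δ ∧ δ ≤ R₀ ∧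
        ∀ s ∈ Fuchs.sector θ₁ θ₂ σ, ∀ x ∈ Fuchs.polydisc n δ,
          u (s, x) = u₀ (Complex.exp s, x) := by
  have hF := hA1 _ hΔ0
  have hcont : ContinuousAt (fun x : Fin n → ℂ => ((0, x, 0) : Fuchs.JetSpace n)) 0 :=
    continuousAt_const.prodMk (continuousAt_id.prodMk continuousAt_const)
  have hev : ∀ᶠ x in 𝓝 (0 : Fin n → ℂ), ((0, x, 0) : Fuchs.JetSpace n) ∈ Δ :=
    hcont.eventually_mem (hΔ.mem_nhds hΔ0)
  have hA3' : ∀ᶠ x in 𝓝 (0 : Fin n → ℂ), ∀ q : Fuchs.Lam n, 0 < ∑ j, q.1.2 j →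
      Fuchs.dz q F (0, x, 0) = 0 := hev.mono fun x hx q hq => hA3 q x hq hx
  obtain ⟨u₀, hu₀⟩ := Fuchs.exists_isRegularSolution hΔ hΔ0 hF (hev.mono hA2) hA3' hexp
  exact ⟨u₀, hu₀, fun v hv => hv.eventuallyEq hF hA3' hexp hu₀,
    Fuchs.eq_regular_of_limsupCondition hF hA3' hexp hI hr₀ hR₀ hu hlim hu₀⟩
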